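/- **Setting.** Let $\boldsymbol p=(p_k)_{k\ge1}$ be a probability distribution on $\{1,2,\dots\}$, $\mu=\sum_k kp_k$, and let $T\in(0,\infty)$ with $T\ge\mu/2$. Let $\mathcal D_\infty$, $\mathcal D$ be the spaces of right-continuous functions with left limits from $[0,T]$ to $\mathbb R^\infty$ (sequences indexed by $k\ge0$, product topology) and to $\mathbb R$. *Rate function.* For $x=(x_0,x_1,\dots)$ with $x_k\ge0$ for $k\ge1$, put $r(x)=x_0^++\sum_{k\ge1}kx_k$, and $r_0(x)=x_0^+/r(x)$, $r_k(x)=kx_k/r(x)$ $(k\ge1)$ if $r(x)\in(0,\infty)$, all $r_k(x)=0$ otherwise. Let $\mathcal C_T$ be the set of continuous $(\boldsymbol\zeta,\psi)\in\mathcal D_\infty\times\mathcal D$ such that $\psi(0)=0$ and $\psi$ is absolutely continuous; $\zeta_0(t)=\psi(t)-\inf_{0\le s\le t}(\psi(s)\wedge0)$; and, for $k\ge1$, $\zeta_k$ is nonnegative, non-increasing, absolutely continuous with $\zeta_k(0)=p_k$. Let $\ell(x)=x\log x-x+1$. Set $I_T=\infty$ off $\mathcal C_T$, and for $(\boldsymbol\zeta,\psi)\in\mathcal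 C_T$ $$I_T(\boldsymbol\zeta,\psi)=\inf_{\boldsymbol\varphi}\sum_{k\ge0}\int_{[0,T]\times[0,1]}\ell(\varphi_k(s,y))\,ds\,dy ,$$ the infimum being over all sequences of measurable $\varphi_k:[0,T]\times[0,1]\to\mathbb R_+$, $k\ge0$, such that, with $B_k(t)=\int_{[0,t]\times[0,1]}1_{[0,r_k(\boldsymbol\zeta(s)))}(y)\varphi_k(s,y)\,ds\,dy$ (finite), one has $\psi(t)=\sum_{k\ge0}(k-2)B_k(t)$ and $\zeta_k(t)=p_k-B_k(t)$ for $k\ge1$, $t\in[0,T]$. *Trajectory.* Put $G_0(z)=\sum_{k\ge1}p_kz^k$, $G_1(z)=\sum_{k\ge1}\frac{kp_k}{\mu}z^{k-1}$, and for $s\in(0,1]$ let $F_s(t)=G_0(s)-G_0(st)$, $t\in[0,1]$; $f_s(t)=F_s^{-1}(t)$ for $0\le t\le G_0(s)$, $f_s(t)=0$ for $t>G_0(s)$, and $f_0=0$. Define $(\boldsymbol\zeta^*,\psi^*)$ as follows. - If $\sum_kk(k-2)p_k\le0$: $\zeta^*_0(t)=0$ and $\zeta^*_k(t)=p_kf_1(t)^k$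 for $k\ge1$. - If $\sum_kk(k-2)p_k>0$: let $\rho$ be the unique solution of $G_1(\rho)=\rho$ in $(0,1)$ if $p_1>0$, and $\rho=0$ if $p_1=0$; let $\tau=\frac\mu2(1-\rho^2)$. Then $\zeta^*_0(t)=\big[\mu-2t-\mu\sqrt{1-2t/\mu}\,G_1(\sqrt{1-2t/\mu})\big]1_{[0,\tau]}(t)$ and, for $k\ge1$, $\zeta^*_k(t)=p_k(1-2t/\mu)^{k/2}$ for $0\le t\le\tau$, $\zeta^*_k(t)=p_k\rho^kf_\rho(t-\tau)^k$ for $t>\tau$. In both cases $\psi^*(t)=-2\int_0^tr_0(\boldsymbol\zeta^*(s))\,ds+\sum_{k\ge1}(k-2)(p_k-\zeta^*_k(t))$. *Exploration process.* For each $n$ let $(d^{(n)}_i)_{i\le n}$ be positive integers with even sum, and $n_k=|\{i:d_i^{(n)}=k\}|$. Let $(A(j),V(j))_{j\ge0}$ be the edge-exploration Markov chain of the configuration model with these degrees ($A$ is the number of active half-edges, $V_k$ the number of sleeping vertices of degree $k$): it starts from $A(0)=0$, $V_k(0)=n_k$, is absorbed at $(0,0)$, and otherwise moves from $(a,v)$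 to $(a-2\cdot1_{\{a>0\}},v)$ with probability $\frac{(a-1)^+}{\sum_iiv_i+(a-1)^+}$ and to $(a+k-2\cdot1_{\{a>0\}},v-e_k)$ with probability $\frac{kv_k}{\sum_iiv_i+(a-1)^+}$, $k\ge1$. Let $N$ be a Poisson process of rate $n$ independent of the chain, and put $X^n_0(t)=\frac1n(A(N(t))-1)$, $X^n_k(t)=\frac1nV_k(N(t))$ for $k\ge1$, and $Y^n(t)=X^n_0(t)-\frac2n\,|\{i<N(t):A(i)=0,\ V(i)\ne0\}|$. **Statement.** 1. Suppose $\sum_kk^2p_k<\infty$. If $\sum_kk(k-2)p_k>0$ and $p_1>0$, then $G_1(\rho)=\rho$ has exactly one solution $\rho\in(0,1)$. The pair $(\boldsymbol\zeta^*,\psi^*)$ belongs to $\mathcal D_\infty\times\mathcal D$, and it is the unique element of $\mathcal D_\infty\times\mathcal D$ with $I_T(\boldsymbol\zeta,\psi)=0$. 2. Suppose $n_k/n\to p_k$ for every $k\ge1$ and $\sup_n\sum_k\frac{n_k}nk^2<\infty$. Then $\sum_kk^2p_k<\infty$ (so that 1. applies), and $(\boldsymbol\zeta^*,\psi^*)$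 is the law-of-large-numbers limit of the exploration process: as $n\to\infty$, $\sup_{t\in[0,T]}|X^n_k(t)-\zeta^*_k(t)|\to0$ in probability for every $k\ge0$, and $\sup_{t\in[0,T]}|Y^n(t)-\psi^*(t)|\to0$ in probability. -/

import Mathlib

open Set Filter Topology MeasureTheory ProbabilityTheory
open scoped NNReal ENNReal

noncomputable section

namespace ConfigModel

/-! ### Path space -/

/-- `𝔻([0,T] : E)`: right continuous functions with left limits on `[0,T]`. -/
@[ext]
structure CadlagPath (T : ℝ≥0) (E : Type*) [TopologicalSpace E] where
  toFun : Icc (0 : ℝ) (T : ℝ) → E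
  right_cts : ∀ t, ContinuousWithinAt toFun (Ici t) t
  left_lim : ∀ t, ∃ l, Tendsto toFun (𝓝[<] t) (𝓝 l)

/-- The path as a function on `ℝ`, frozen outside `[0,T]`; only its values on `[0,T]` matter. -/
def CadlagPath.extend {T : ℝ≥0} {E : Type*} [TopologicalSpace E] (f : CadlagPath T E) : ℝ → E :=
  IccExtend T.2 f.toFun

/-- `𝓓_∞ × 𝓓`, where `𝓓_∞ = 𝔻([0,T] : ℝ^∞)` (product topology on `ℝ^∞`) and
`𝓓 = 𝔻([0,T] : ℝ)`. -/
abbrev PathSpace (T : ℝ≥0) : Type := CadlagPath T (ℕ → ℝ) × CadlagPath T ℝ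

/-- The coordinates `ζ_k`, `k ∈ ℕ₀`, of a point of path space. -/
def PathSpace.zeta {T : ℝ≥0} (P : PathSpace T) (t : ℝ) : ℕ → ℝ := P.1.extend t

/-- The last component `ψ` of a point of path space. -/
def PathSpace.psi {T : ℝ≥0} (P : PathSpace T) (t : ℝ) : ℝ := P.2.extend t

/-! ### The rate function -/

/-- A probability distribution on `{1, 2, …}`. -/
structure IsDegreeDistribution (p : ℕ → ℝ) : Prop where
  zero : p 0 = 0
  nonneg : ∀ k, 0 ≤ p k
  hasSum : HasSum p 1

/-- `r(x) = x₀⁺ + ∑_{k ≥ 1} k x_k ∈ [0,∞]` for `x ∈ ℝ × ℝ₊^∞`. -/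
def r (x : ℕ → ℝ) : ℝ≥0∞ :=
  ENNReal.ofReal (x 0) + ∑' k : ℕ, ENNReal.ofReal ((k : ℝ) * x k)

/-- `r₀(x) = x₀⁺ / r(x)` and `r_k(x) = k x_k / r(x)` for `k ≥ 1`, and `0` unless
`r(x) ∈ (0,∞)`. -/
def rk (k : ℕ) (x : ℕ → ℝ) : ℝ :=
  if 0 < r x ∧ r x < ∞ then (if k = 0 then max (x 0) 0 else (k : ℝ) * x k) / (r x).toReal
  else 0

/-- The one-dimensional Skorokhod map. -/
def skorokhodMap (ψ : ℝ → ℝ) (t : ℝ) : ℝ :=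
  ψ t - sInf ((fun s => min (ψ s) 0) '' Icc 0 t)

/-- The set `𝓒_T` of continuous trajectories on which the rate function may be finite. -/
structure IsAdmissible (p : ℕ → ℝ) {T : ℝ≥0} (P : PathSpace T) : Prop where
  cts_zeta : Continuous P.1.toFun
  cts_psi : Continuous P.2.toFun
  psi_zero : P.psi 0 = 0
  psi_ac : AbsolutelyContinuousOnInterval P.psi 0 T
  zeta_zero : ∀ t ∈ Icc (0 : ℝ) T, P.zeta t 0 = skorokhodMap P.psi t
  init : ∀ k, 1 ≤ k → P.zeta 0 k = p k
  anti : ∀ k, 1 ≤ k → AntitoneOn (fun t => P.zeta t k) (Icc (0 : ℝ) T)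
  ac : ∀ k, 1 ≤ k → AbsolutelyContinuousOnInterval (fun t => P.zeta t k) 0 T
  nonneg : ∀ k, 1 ≤ k → ∀ t ∈ Icc (0 : ℝ) T, 0 ≤ P.zeta t k

/-- `1_{[0, r_k(ζ(s)))}(y) φ_k(s,y)`, at `z = (s,y)`. -/
def jumpRate {T : ℝ≥0} (P : PathSpace T) (φ : ℕ → ℝ × ℝ → ℝ≥0) (k : ℕ) (z : ℝ × ℝ) : ℝ :=
  if z.2 < rk k (P.zeta z.1) then (φ k z : ℝ) else 0

/-- `∫_{[0,t] × [0,1]} 1_{[0, r_k(ζ(s)))}(y) φ_k(s,y) ds dy`. -/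
def jumpMass {T : ℝ≥0} (P : PathSpace T) (φ : ℕ → ℝ × ℝ → ℝ≥0) (k : ℕ) (t : ℝ) : ℝ :=
  ∫ z in Icc (0 : ℝ) t ×ˢ Icc (0 : ℝ) 1, jumpRate P φ k z

/-- The set `𝓢_T(ζ, ψ)` of controls `φ = (φ_k)_{k ≥ 0}` producing `(ζ, ψ)`; only the values of
`φ_k` on `[0,T] × [0,1]` matter. -/
structure IsControl (p : ℕ → ℝ) {T : ℝ≥0} (P : PathSpace T) (φ : ℕ → ℝ × ℝ → ℝ≥0) : Prop where
  meas : ∀ k, Measurable (φ k)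
  integrable : ∀ k, IntegrableOn (jumpRate P φ k) (Icc (0 : ℝ) T ×ˢ Icc (0 : ℝ) 1)
  psi_eq : ∀ t ∈ Icc (0 : ℝ) T, HasSum (fun k : ℕ => ((k : ℝ) - 2) * jumpMass P φ k t) (P.psi t)
  zeta_eq : ∀ t ∈ Icc (0 : ℝ) T, ∀ k, 1 ≤ k → P.zeta t k = p k - jumpMass P φ k t

/-- `ℓ(x) = x log x - x + 1`. -/
def ell (x : ℝ) : ℝ := x * Real.log x - x + 1

/-- `∑_{k ≥ 0} ∫_{[0,T] × [0,1]} ℓ(φ_k(s,y)) ds dy ∈ [0,∞]`. -/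
def controlCost (T : ℝ≥0) (φ : ℕ → ℝ × ℝ → ℝ≥0) : ℝ≥0∞ :=
  ∑' k : ℕ, ∫⁻ z in Icc (0 : ℝ) T ×ˢ Icc (0 : ℝ) 1, ENNReal.ofReal (ell (φ k z))

open Classical in
/-- The rate function `I_T` on `𝓓_∞ × 𝓓`. -/
def rateFunction (p : ℕ → ℝ) {T : ℝ≥0} (P : PathSpace T) : ℝ≥0∞ :=
  if IsAdmissible p P then ⨅ φ ∈ {φ | IsControl p P φ}, controlCost T φ else ∞

/-! ### The explicit trajectory -/

/-- `μ = ∑ k p_k`. -/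
def mean (p : ℕ → ℝ) : ℝ := ∑' k : ℕ, (k : ℝ) * p k

/-- `∑ k (k - 2) p_k`, whose sign separates the (sub)critical from the supercritical case. -/
def criticality (p : ℕ → ℝ) : ℝ := ∑' k : ℕ, (k : ℝ) * ((k : ℝ) - 2) * p k

/-- `G₀(z) = ∑ p_k z^k`. -/
def G0 (p : ℕ → ℝ) (z : ℝ) : ℝ := ∑' k : ℕ, p k * z ^ k

/-- `G₁(z) = ∑ (k p_k / μ) z^(k-1)`; the term `k = 0` vanishes. -/
def G1 (p : ℕ → ℝ) (z : ℝ) : ℝ := ∑' k : ℕ, (k : ℝ) * p k / mean p * z ^ (k - 1)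

/-- `F_s(t) = G₀(s) - G₀(s t)`. -/
def F (p : ℕ → ℝ) (s t : ℝ) : ℝ := G0 p s - G0 p (s * t)

/-- `f_s(t) = F_s⁻¹(t)` for `0 ≤ t ≤ G₀(s)`, where `F_s` is inverted as a function on `[0,1]`,
and `f_s(t) = 0` for `t > G₀(s)`; `f₀ = 0`. -/
def f (p : ℕ → ℝ) (s t : ℝ) : ℝ :=
  if s = 0 then 0
  else if 0 ≤ t ∧ t ≤ G0 p s then Function.invFunOn (F p s) (Icc 0 1) t
  else 0

/-- `ρ`: the solution of `G₁(ρ) = ρ` in `(0,1)` if `p₁ > 0`, and `0` if `p₁ = 0`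
(used in the supercritical case). -/
def rho (p : ℕ → ℝ) : ℝ :=
  if 0 < p 1 then Classical.epsilon fun z : ℝ => z ∈ Ioo (0 : ℝ) 1 ∧ G1 p z = z else 0

/-- `τ = (μ / 2) (1 - ρ²)`. -/
def tau (p : ℕ → ℝ) : ℝ := mean p / 2 * (1 - rho p ^ 2)

/-- The trajectory `ζ` in the case `∑ k (k - 2) p_k ≤ 0`. -/
def zetaSub (p : ℕ → ℝ) (t : ℝ) (k : ℕ) : ℝ :=
  if k = 0 then 0 else p k * f p 1 t ^ k

/-- The trajectory `ζ` in the case `∑ k (k - 2) p_k > 0`. -/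
def zetaSuper (p : ℕ → ℝ) (t : ℝ) (k : ℕ) : ℝ :=
  if k = 0 then
    (if t ≤ tau p then
      mean p - 2 * t - mean p * √(1 - 2 * t / mean p) * G1 p (√(1 - 2 * t / mean p))
    else 0)
  else if t ≤ tau p then p k * (1 - 2 * t / mean p) ^ ((k : ℝ) / 2)
  else p k * rho p ^ k * f p (rho p) (t - tau p) ^ k

open Classical in
/-- The limit trajectory `ζ(t) = (ζ_k(t))_{k ≥ 0}`, for `t ≥ 0`. -/
def zetaLim (p : ℕ → ℝ) (t : ℝ) : ℕ → ℝ :=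
  if criticality p ≤ 0 then zetaSub p t else zetaSuper p t

/-- `ψ(t) = -2 ∫₀ᵗ r₀(ζ(s)) ds + ∑_{k ≥ 1} (k - 2) (p_k - ζ_k(t))`, for `t ≥ 0`. -/
def psiLim (p : ℕ → ℝ) (t : ℝ) : ℝ :=
  -2 * (∫ s in (0 : ℝ)..t, rk 0 (zetaLim p s)) +
    ∑' j : ℕ, (((j + 1 : ℕ) : ℝ) - 2) * (p (j + 1) - zetaLim p t (j + 1))

/-! ### Degree sequences -/

/-- `n_k`: the number of vertices of degree `k`. -/
def degCount {n : ℕ} (d : Fin n → ℕ) (k : ℕ) : ℕ := (Finset.univ.filter fun i => d i = k).card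

/-- Degree sequences of configuration models on `n` vertices, `n ∈ ℕ`, without vertices of
degree zero. -/
structure IsDegreeArray (d : (n : ℕ) → Fin n → ℕ) : Prop where
  pos : ∀ n i, 0 < d n i
  even_sum : ∀ n, Even (∑ i, d n i)

/-- `n_k / n → p_k` for all `k ≥ 1`. -/
def DegreesConverge (d : (n : ℕ) → Fin n → ℕ) (p : ℕ → ℝ) : Prop :=
  ∀ k, 1 ≤ k → Tendsto (fun n : ℕ => (degCount (d n) k : ℝ) / n) atTop (𝓝 (p k))

/-- `sup_n ∑_k (n_k / n) k² < ∞`. -/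
def BoundedSecondMoment (d : (n : ℕ) → Fin n → ℕ) : Prop :=
  BddAbove (range fun n : ℕ => ∑' k : ℕ, (degCount (d n) k : ℝ) / n * (k : ℝ) ^ 2)

/-! ### The exploration process -/

/-- One-step transition probabilities of the edge-exploration algorithm. The state is `(a, v)`,
where `a` is the number of active half-edges and `v k` the number of sleeping vertices of
degree `k`; `(0, 0)` is absorbing. Natural-number subtraction turns `a - 1` into `(a - 1)⁺`. -/
def stepProb (x y : ℕ × (ℕ →₀ ℕ)) : ℝ≥0 :=
  if x.1 = 0 ∧ x.2 = 0 then (if y = x then 1 else 0)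
  else
    let total : ℝ≥0 := ((x.2.sum fun k m => k * m) + (x.1 - 1) : ℕ)
    let used : ℕ := if 0 < x.1 then 2 else 0
    (if y = (x.1 - used, x.2) then ((x.1 - 1 : ℕ) : ℝ≥0) / total else 0) +
      ∑ k ∈ x.2.support,
        if y = (x.1 + k - used, x.2 - Finsupp.single k 1) then
          ((k * x.2 k : ℕ) : ℝ≥0) / total
        else 0

/-- The edge-exploration chain `(A(j), V(j))`, `j ∈ ℕ₀`, of the configuration model with degree
sequence `d`: the Markov chain with transition probabilities `stepProb` started with all
vertices and half-edges asleep. -/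
structure IsEdgeExploration {Ω : Type*} [MeasurableSpace Ω] (μ : Measure Ω) {n : ℕ}
    (d : Fin n → ℕ) (A : ℕ → Ω → ℕ) (V : ℕ → Ω → ℕ →₀ ℕ) : Prop where
  meas_A : ∀ j, Measurable (A j)
  meas_V : ∀ j k, Measurable fun ω => V j ω k
  init : ∀ᵐ ω ∂μ, A 0 ω = 0 ∧ ∀ k, V 0 ω k = degCount d k
  markov : ∀ (j : ℕ) (x : ℕ → ℕ × (ℕ →₀ ℕ)),
    μ {ω | ∀ i ≤ j + 1, (A i ω, V i ω) = x i} =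
      μ {ω | ∀ i ≤ j, (A i ω, V i ω) = x i} * (stepProb (x j) (x (j + 1)) : ℝ≥0∞)

/-- A Poisson process with the given rate. -/
structure IsPoissonProcess {Ω : Type*} [MeasurableSpace Ω] (μ : Measure Ω) (rate : ℝ≥0)
    (N : ℝ≥0 → Ω → ℕ) : Prop where
  meas : ∀ t, Measurable (N t)
  zero : ∀ᵐ ω ∂μ, N 0 ω = 0
  paths : ∀ᵐ ω ∂μ, (Monotone fun t => N t ω) ∧
    ∀ t, ContinuousWithinAt (fun s => N s ω) (Ici t) t
  law : ∀ s t, s ≤ t → HasLaw (fun ω => N t ω - N s ω) (poissonMeasure (rate * (t - s))) μ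
  indep : HasIndepIncrements N μ

/-- The data of the continuous time exploration: the edge-exploration chain, run at the jump
times of an independent Poisson process of rate `n`. -/
structure IsExploration {Ω : Type*} [MeasurableSpace Ω] (μ : Measure Ω) {n : ℕ}
    (d : Fin n → ℕ) (A : ℕ → Ω → ℕ) (V : ℕ → Ω → ℕ →₀ ℕ) (N : ℝ≥0 → Ω → ℕ) : Prop where
  chain : IsEdgeExploration μ d A V
  clock : IsPoissonProcess μ n N
  indep : IndepFun (fun ω (j : ℕ) => (A j ω, fun k => V j ω k)) (fun ω t => N t ω) μ

/-- The scaled state `Xⁿ(t) = n⁻¹ (A(N(t)) - 1, V₁(N(t)), V₂(N(t)), …)`. -/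
def stateX {Ω : Type*} (n : ℕ) (A : ℕ → Ω → ℕ) (V : ℕ → Ω → ℕ →₀ ℕ) (N : ℝ≥0 → Ω → ℕ)
    (t : ℝ≥0) (ω : Ω) (k : ℕ) : ℝ :=
  if k = 0 then ((A (N t ω) ω : ℝ) - 1) / n else (V (N t ω) ω k : ℝ) / n

open Classical in
/-- The regulator `ηⁿ(t)`: it grows by `2 / n` whenever a new component is started, that is, at
each step taken from a state without active half-edges but with sleeping vertices. -/
def regulator {Ω : Type*} (n : ℕ) (A : ℕ → Ω → ℕ) (V : ℕ → Ω → ℕ →₀ ℕ) (N : ℝ≥0 → Ω → ℕ)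
    (t : ℝ≥0) (ω : Ω) : ℝ :=
  2 / n * (((Finset.range (N t ω)).filter fun i => A i ω = 0 ∧ V i ω ≠ 0).card : ℝ)

/-- `Yⁿ = Xⁿ₀ - ηⁿ`. -/
def stateY {Ω : Type*} (n : ℕ) (A : ℕ → Ω → ℕ) (V : ℕ → Ω → ℕ →₀ ℕ) (N : ℝ≥0 → Ω → ℕ)
    (t : ℝ≥0) (ω : Ω) : ℝ :=
  stateX n A V N t ω 0 - regulator n A V N t ω

end ConfigModel

end

open ConfigModel

namespace ConfigModel

/-! ### Generating functions -/

section Analytic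

variable {p : ℕ → ℝ}

/-! Everything is governed by one parameter u, decreasing from 1 to 0. When it has the value u, the
sleeping vertices of degree k have mass p_k u^k, and the unpaired half-edges have mass u κ(u) with
κ(v) = μ max(v, G₁(v)). The maximum encodes two regimes. The sleeping half-edges have mass μ u
G₁(u); if G₁(u) < u there is a surplus μ u² - μ u G₁(u) of active ones, and otherwise there is none.
A sleeping vertex of degree k wakes at rate k / (u κ(u)), so u' = -1/κ(u), that is, Φ(u(t)) = t with
Φ(u) = ∫_u^1 κ. Convexity of G₁ and G₁(1) = 1 locate the two regimes and give Φ in closed form,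
which turns u into the explicit trajectory (`zetaLim_eq`). They also make κ(v)/v nonincreasing
(`kap_mul_le`), on which both the uniqueness and the Skorokhod property rest.

The core is the uniqueness theorem `IsFluid.eq_limit`. Its hypothesis `IsFluid` is a list of
inequalities between values at two times, weak enough to hold both for zeros of the rate function
and for pointwise limits of rescaled chains. They imply z_k = p_k u^k with u' = -u/R; comparison
arguments then give R = u κ(u), hence Φ(u(t)) = t.

Zeros of I_T: smallness of ∫ ℓ(φ_k) makes φ_k close to 1 in L¹ (`abs_sub_one_le_ell`), so I_T = 0
forces the jump masses to equal ∫ r_k(ζ), with no need of a minimising control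
(`rateFunction_eq_zero`). Such a trajectory is fluid (`isFluid_of_isFlow`), hence the explicit one.
Conversely the explicit trajectory solves the equations with φ ≡ 1 and its component ζ₀ is the
Skorokhod reflection of ψ (`zetaU_zero_eq_skorokhodMap`).

Law of large numbers: the compensated numbers of explored vertices are martingales with increments
at most 1, so by Chebyshev on a grid they are o(n) uniformly; the same works for the Poisson clock.
Paths with small compensators have, along any ultrafilter, limits which are fluid
(`IsScaled.isFluid`). The bounded second moment prevents loss of half-edge mass in the limit. A
compactness argument turns this into a deterministic tolerance (`exists_tolerance`), and a union
bound finishes the proof. -/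

theorem summable_first_moment (hp : IsDegreeDistribution p)
    (h2 : Summable fun k : ℕ => (k : ℝ) ^ 2 * p k) : Summable fun k : ℕ => (k : ℝ) * p k := by
  refine Summable.of_nonneg_of_le (fun k => mul_nonneg k.cast_nonneg (hp.nonneg k)) (fun k => ?_) h2
  refine mul_le_mul_of_nonneg_right ?_ (hp.nonneg k)
  exact_mod_cast Nat.le_self_pow two_ne_zero k

theorem one_le_mean (hp : IsDegreeDistribution p) (h1 : Summable fun k : ℕ => (k : ℝ) * p k) :
    1 ≤ mean p := by
  rw [← hp.hasSum.tsum_eq]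
  refine hp.hasSum.summable.tsum_le_tsum (fun k => ?_) h1
  rcases Nat.eq_zero_or_pos k with rfl | hk
  · simp [hp.zero]
  · exact le_mul_of_one_le_left (hp.nonneg k) (by exact_mod_cast hk)

theorem mean_pos (hp : IsDegreeDistribution p) (h1 : Summable fun k : ℕ => (k : ℝ) * p k) :
    0 < mean p := one_pos.trans_le (one_le_mean hp h1)

/-- The size-biased weights `k p_k / μ`. -/
theorem weight_nonneg (hp : IsDegreeDistribution p) (h1 : Summable fun k : ℕ => (k : ℝ) * p k)
    (k : ℕ) : 0 ≤ (k : ℝ) * p k / mean p :=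
  div_nonneg (mul_nonneg k.cast_nonneg (hp.nonneg k)) (mean_pos hp h1).le

theorem summable_G1 (hp : IsDegreeDistribution p) (h1 : Summable fun k : ℕ => (k : ℝ) * p k)
    {v : ℝ} (hv : v ∈ Icc (0 : ℝ) 1) :
    Summable fun k : ℕ => (k : ℝ) * p k / mean p * v ^ (k - 1) :=
  Summable.of_nonneg_of_le
    (fun k => mul_nonneg (weight_nonneg hp h1 k) (pow_nonneg hv.1 _))
    (fun k => mul_le_of_le_one_right (weight_nonneg hp h1 k) (pow_le_one₀ hv.1 hv.2))
    (h1.div_const _)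

theorem G1_one (hp : IsDegreeDistribution p) (h1 : Summable fun k : ℕ => (k : ℝ) * p k) :
    G1 p 1 = 1 := by
  simp only [G1, one_pow, mul_one]
  rw [tsum_div_const]
  exact div_self (mean_pos hp h1).ne'

theorem G1_nonneg (hp : IsDegreeDistribution p) (h1 : Summable fun k : ℕ => (k : ℝ) * p k)
    {v : ℝ} (hv : 0 ≤ v) : 0 ≤ G1 p v :=
  tsum_nonneg fun k => mul_nonneg (weight_nonneg hp h1 k) (pow_nonneg hv _)

theorem continuousOn_G1 (hp : IsDegreeDistribution p) (h1 : Summable fun k : ℕ => (k : ℝ) * p k) :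
    ContinuousOn (G1 p) (Icc 0 1) := by
  refine continuousOn_tsum (u := fun k : ℕ => (k : ℝ) * p k / mean p)
    (fun k => by fun_prop) (h1.div_const _) fun k v hv => ?_
  rw [Real.norm_of_nonneg (mul_nonneg (weight_nonneg hp h1 k) (pow_nonneg hv.1 _))]
  exact mul_le_of_le_one_right (weight_nonneg hp h1 k) (pow_le_one₀ hv.1 hv.2)

theorem convexOn_G1 (hp : IsDegreeDistribution p) (h1 : Summable fun k : ℕ => (k : ℝ) * p k) :
    ConvexOn ℝ (Icc 0 1) (G1 p) := by
  refine ⟨convex_Icc 0 1, fun x hx y hy a b ha hb hab => ?_⟩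
  have hxy := convex_Icc (0 : ℝ) 1 hx hy ha hb hab
  simp only [smul_eq_mul] at hxy ⊢
  simp only [G1]
  rw [← tsum_mul_left, ← tsum_mul_left,
    ← ((summable_G1 hp h1 hx).mul_left a).tsum_add ((summable_G1 hp h1 hy).mul_left b)]
  refine (summable_G1 hp h1 hxy).tsum_le_tsum (fun k => ?_)
    (((summable_G1 hp h1 hx).mul_left a).add ((summable_G1 hp h1 hy).mul_left b))
  have := (convexOn_pow (k - 1)).2 (mem_Ici.2 hx.1) (mem_Ici.2 hy.1) ha hb hab
  simp only [smul_eq_mul] at this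
  calc _ ≤ (k : ℝ) * p k / mean p * (a * x ^ (k - 1) + b * y ^ (k - 1)) :=
        mul_le_mul_of_nonneg_left this (weight_nonneg hp h1 k)
    _ = _ := by ring

/-- `∑ k p_k v^k = μ v G₁(v)`. -/
theorem hasSum_halfEdges (hp : IsDegreeDistribution p)
    (h1 : Summable fun k : ℕ => (k : ℝ) * p k) {v : ℝ} (hv : v ∈ Icc (0 : ℝ) 1) :
    HasSum (fun k : ℕ => (k : ℝ) * (p k * v ^ k)) (mean p * v * G1 p v) := by
  suffices e : (fun k : ℕ => (k : ℝ) * (p k * v ^ k)) =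
      fun k : ℕ => mean p * v * ((k : ℝ) * p k / mean p * v ^ (k - 1)) by
    rw [e]
    exact (summable_G1 hp h1 hv).hasSum.mul_left (mean p * v)
  funext k
  rcases Nat.eq_zero_or_pos k with rfl | hk
  · simp
  · have : v ^ k = v * v ^ (k - 1) := by rw [← pow_succ', Nat.sub_add_cancel hk]
    rw [this]
    have := (mean_pos hp h1).ne'
    field_simp

theorem summable_G0 (hp : IsDegreeDistribution p) {v : ℝ} (hv : v ∈ Icc (0 : ℝ) 1) :
    Summable fun k : ℕ => p k * v ^ k :=
  Summable.of_nonneg_of_le (fun k => mul_nonneg (hp.nonneg k) (pow_nonneg hv.1 _))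
    (fun k => mul_le_of_le_one_right (hp.nonneg k) (pow_le_one₀ hv.1 hv.2)) hp.hasSum.summable

theorem G0_zero (hp : IsDegreeDistribution p) : G0 p 0 = 0 := by
  refine (tsum_congr fun k => ?_).trans tsum_zero
  rcases Nat.eq_zero_or_pos k with rfl | hk
  · simp [hp.zero]
  · simp [hk.ne']

theorem continuousOn_G0 (hp : IsDegreeDistribution p) : ContinuousOn (G0 p) (Icc 0 1) := by
  refine continuousOn_tsum (u := p) (fun k => by fun_prop) hp.hasSum.summable fun k v hv => ?_
  rw [Real.norm_of_nonneg (mul_nonneg (hp.nonneg k) (pow_nonneg hv.1 _))]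
  exact mul_le_of_le_one_right (hp.nonneg k) (pow_le_one₀ hv.1 hv.2)

theorem hasDerivAt_G0 (hp : IsDegreeDistribution p) (h1 : Summable fun k : ℕ => (k : ℝ) * p k)
    {v : ℝ} (hv : v ∈ Ioo (0 : ℝ) 1) : HasDerivAt (G0 p) (mean p * G1 p v) v := by
  have key : HasDerivAt (fun z => ∑' k : ℕ, p k * z ^ k)
      (∑' k : ℕ, p k * ((k : ℝ) * v ^ (k - 1))) v := by
    refine hasDerivAt_tsum_of_isPreconnected (u := fun k : ℕ => (k : ℝ) * p k)
      (t := Ioo 0 1) h1 isOpen_Ioo isPreconnected_Ioo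
      (fun k y _ => (hasDerivAt_pow k y).const_mul (p k)) (fun k y hy => ?_) hv
      (summable_G0 hp (Ioo_subset_Icc_self hv)) hv
    rw [Real.norm_of_nonneg (mul_nonneg (hp.nonneg k)
      (mul_nonneg k.cast_nonneg (pow_nonneg hy.1.le _)))]
    have : y ^ (k - 1) ≤ 1 := pow_le_one₀ hy.1.le hy.2.le
    nlinarith [mul_nonneg (k.cast_nonneg : (0 : ℝ) ≤ k) (hp.nonneg k)]
  have e : mean p * G1 p v = ∑' k : ℕ, p k * ((k : ℝ) * v ^ (k - 1)) := by
    simp only [G1]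
    rw [← tsum_mul_left]
    refine tsum_congr fun k => ?_
    have := (mean_pos hp h1).ne'
    field_simp
  rw [e]
  exact key

/-! ### The time change -/

/-- `κ(v) = μ max(v, G₁(v))`. -/
noncomputable def kap (p : ℕ → ℝ) (v : ℝ) : ℝ := mean p * max v (G1 p v)

theorem continuousOn_kap (hp : IsDegreeDistribution p)
    (h1 : Summable fun k : ℕ => (k : ℝ) * p k) : ContinuousOn (kap p) (Icc 0 1) :=
  continuousOn_const.mul (continuousOn_id.sup (continuousOn_G1 hp h1))

theorem mul_le_kap (hp : IsDegreeDistribution p) (h1 : Summable fun k : ℕ => (k : ℝ) * p k)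
    (v : ℝ) : mean p * v ≤ kap p v :=
  mul_le_mul_of_nonneg_left (le_max_left _ _) (mean_pos hp h1).le

theorem mul_G1_le_kap (hp : IsDegreeDistribution p) (h1 : Summable fun k : ℕ => (k : ℝ) * p k)
    (v : ℝ) : mean p * G1 p v ≤ kap p v :=
  mul_le_mul_of_nonneg_left (le_max_right _ _) (mean_pos hp h1).le

theorem kap_pos (hp : IsDegreeDistribution p) (h1 : Summable fun k : ℕ => (k : ℝ) * p k)
    {v : ℝ} (hv : 0 < v) : 0 < kap p v :=
  (mul_pos (mean_pos hp h1) hv).trans_le (mul_le_kap hp h1 v)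

theorem kap_nonneg (hp : IsDegreeDistribution p) (h1 : Summable fun k : ℕ => (k : ℝ) * p k)
    {v : ℝ} (hv : 0 ≤ v) : 0 ≤ kap p v :=
  (mul_nonneg (mean_pos hp h1).le hv).trans (mul_le_kap hp h1 v)

theorem kap_one (hp : IsDegreeDistribution p) (h1 : Summable fun k : ℕ => (k : ℝ) * p k) :
    kap p 1 = mean p := by simp [kap, G1_one hp h1]

/-- `κ(v) / v` is nonincreasing. -/
theorem kap_mul_le (hp : IsDegreeDistribution p) (h1 : Summable fun k : ℕ => (k : ℝ) * p k)
    {w v : ℝ} (hw : 0 ≤ w) (hwv : w ≤ v) (hv : v ≤ 1) : kap p v * w ≤ kap p w * v := by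
  have hm := mean_pos hp h1
  suffices h : max v (G1 p v) * w ≤ max w (G1 p w) * v by
    simpa [kap, mul_assoc] using mul_le_mul_of_nonneg_left h hm.le
  have hv0 : 0 ≤ v := hw.trans hwv
  rcases le_total (G1 p v) v with hG | hG
  · rw [max_eq_left hG]
    nlinarith [le_max_left w (G1 p w)]
  · rw [max_eq_right hG]
    rcases eq_or_lt_of_le hv with rfl | hv1
    · rw [G1_one hp h1]; nlinarith [le_max_left w (G1 p w)]
    -- Remaining case v ≤ G₁(v), v < 1. If G₁(w) v < G₁(v) w, then the chord of G₁ from w to 1,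
    -- which ends at (1, 1), forces G₁(v) < v.
    by_contra hlt
    push Not at hlt
    have hGw : G1 p w * v < G1 p v * w :=
      (mul_le_mul_of_nonneg_right (le_max_right w (G1 p w)) hv0).trans_lt hlt
    have hwv' : w < v := lt_of_le_of_ne hwv (by rintro rfl; exact lt_irrefl _ hGw)
    have hw1 : 0 < 1 - w := by linarith
    have hc := (convexOn_G1 hp h1).2 (show w ∈ Icc (0 : ℝ) 1 from ⟨hw, by linarith⟩)
      (show (1 : ℝ) ∈ Icc (0 : ℝ) 1 by simp)
      (show 0 ≤ (1 - v) / (1 - w) from div_nonneg (by linarith) hw1.le)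
      (show 0 ≤ (v - w) / (1 - w) from div_nonneg (by linarith) hw1.le)
      (by field_simp; ring)
    have hcomb : (1 - v) / (1 - w) * w + (v - w) / (1 - w) * 1 = v := by field_simp; ring
    simp only [smul_eq_mul, hcomb, G1_one hp h1] at hc
    have hc' : G1 p v * (1 - w) ≤ (1 - v) * G1 p w + (v - w) := by
      have := mul_le_mul_of_nonneg_right hc hw1.le
      field_simp at this
      linarith
    have hv0' : 0 < v := hw.trans_lt hwv'
    nlinarith [mul_le_mul_of_nonneg_right hc' hv0,
      mul_lt_mul_of_pos_left hGw (by linarith : 0 < 1 - v),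
      mul_nonneg (sub_nonneg.2 hwv) (sub_nonneg.2 hG)]

/-- `Φ(u) = ∫_u^1 κ(v) dv`, the time at which the fluid limit has parameter `u`. -/
noncomputable def Phi (p : ℕ → ℝ) (u : ℝ) : ℝ := ∫ v in u..1, kap p v

theorem intervalIntegrable_kap (hp : IsDegreeDistribution p)
    (h1 : Summable fun k : ℕ => (k : ℝ) * p k) {a b : ℝ} (ha : a ∈ Icc (0 : ℝ) 1)
    (hb : b ∈ Icc (0 : ℝ) 1) : IntervalIntegrable (kap p) volume a b :=
  ((continuousOn_kap hp h1).mono (uIcc_subset_Icc ha hb)).intervalIntegrable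

theorem Phi_sub (hp : IsDegreeDistribution p) (h1 : Summable fun k : ℕ => (k : ℝ) * p k)
    {w v : ℝ} (hw : w ∈ Icc (0 : ℝ) 1) (hv : v ∈ Icc (0 : ℝ) 1) :
    Phi p w - Phi p v = ∫ x in w..v, kap p x := by
  have h3 := intervalIntegral.integral_add_adjacent_intervals
    (intervalIntegrable_kap hp h1 hw hv)
    (intervalIntegrable_kap hp h1 hv (by simp : (1 : ℝ) ∈ Icc (0 : ℝ) 1))
  simp only [Phi]
  linarith

/-- Obtained by integrating κ(v) x ≤ κ(x) v over x ∈ [w, v]. It is used below to invert Φ and to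
show that the regulator is nondecreasing in time. -/
theorem sq_sub_sq_le_Phi (hp : IsDegreeDistribution p) (h1 : Summable fun k : ℕ => (k : ℝ) * p k)
    {w v : ℝ} (hw : 0 ≤ w) (hwv : w ≤ v) (hv : v ≤ 1) :
    kap p v * (v ^ 2 - w ^ 2) ≤ 2 * v * (Phi p w - Phi p v) := by
  rw [Phi_sub hp h1 ⟨hw, hwv.trans hv⟩ ⟨hw.trans hwv, hv⟩]
  have : ∫ x in w..v, kap p v * x ≤ ∫ x in w..v, kap p x * v := by
    refine intervalIntegral.integral_mono_on hwv ?_ ?_ fun x hx =>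
      kap_mul_le hp h1 (hw.trans hx.1) hx.2 hv
    · exact (continuous_const.mul continuous_id).intervalIntegrable _ _
    · exact (intervalIntegrable_kap hp h1 ⟨hw, hwv.trans hv⟩ ⟨hw.trans hwv, hv⟩).mul_const _
  rw [intervalIntegral.integral_const_mul, integral_id, intervalIntegral.integral_mul_const] at this
  linarith

/-- Follows from κ(v) ≥ μ v and (v - w)² ≤ v² - w². A linear lower bound is not available, since
κ(0) = p₁ may vanish; the quadratic one still gives injectivity of Φ and an inverse that is Hölder
of exponent 1/2. -/
theorem mul_sq_le_Phi (hp : IsDegreeDistribution p) (h1 : Summable fun k : ℕ => (k : ℝ) * p k)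
    {w v : ℝ} (hw : 0 ≤ w) (hwv : w ≤ v) (hv : v ≤ 1) :
    mean p * (v - w) ^ 2 ≤ 2 * (Phi p w - Phi p v) := by
  have hm := mean_pos hp h1
  rcases (hw.trans hwv).eq_or_lt with h0 | h0
  · have : w = v := by linarith
    subst this; simp
  have h := sq_sub_sq_le_Phi hp h1 hw hwv hv
  have h' := mul_le_kap hp h1 v
  have : v * (mean p * (v - w) ^ 2) ≤ v * (2 * (Phi p w - Phi p v)) := by
    have e1 : (v - w) ^ 2 ≤ v ^ 2 - w ^ 2 := by nlinarith
    have e0 : 0 ≤ (v - w) ^ 2 := sq_nonneg _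
    nlinarith [mul_le_mul h' e1 e0 (kap_nonneg hp h1 h0.le)]
  exact le_of_mul_le_mul_left this h0

theorem Phi_injOn (hp : IsDegreeDistribution p) (h1 : Summable fun k : ℕ => (k : ℝ) * p k)
    {w v : ℝ} (hw : w ∈ Icc (0 : ℝ) 1) (hv : v ∈ Icc (0 : ℝ) 1) (h : Phi p w = Phi p v) :
    w = v := by
  have hm := mean_pos hp h1
  rcases le_total w v with hl | hl
  · have := mul_sq_le_Phi hp h1 hw.1 hl hv.2
    nlinarith [sq_nonneg (v - w), mul_nonneg hm.le (sq_nonneg (v - w)),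
      pow_eq_zero_iff (two_ne_zero) |>.1
        (le_antisymm (by nlinarith [one_le_mean hp h1, sq_nonneg (v - w)]) (sq_nonneg (v - w)))]
  · have := mul_sq_le_Phi hp h1 hv.1 hl hw.2
    nlinarith [pow_eq_zero_iff (two_ne_zero) |>.1
        (le_antisymm (by nlinarith [one_le_mean hp h1, sq_nonneg (w - v)]) (sq_nonneg (w - v)))]

theorem Phi_one : Phi p 1 = 0 := by simp [Phi]

theorem Phi_antitone (hp : IsDegreeDistribution p) (h1 : Summable fun k : ℕ => (k : ℝ) * p k)
    {w v : ℝ} (hw : 0 ≤ w) (hwv : w ≤ v) (hv : v ≤ 1) : Phi p v ≤ Phi p w := by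
  have := mul_sq_le_Phi hp h1 hw hwv hv
  nlinarith [mul_nonneg (mean_pos hp h1).le (sq_nonneg (v - w))]

theorem continuousOn_Phi (hp : IsDegreeDistribution p)
    (h1 : Summable fun k : ℕ => (k : ℝ) * p k) : ContinuousOn (Phi p) (Icc 0 1) := by
  have h := intervalIntegral.continuousOn_primitive_interval_left
    (μ := volume) (f := kap p) (a := 0) (b := 1)
    (by rw [uIcc_of_le zero_le_one]; exact (continuousOn_kap hp h1).integrableOn_Icc)
  rwa [uIcc_of_le zero_le_one] at h

theorem hasDerivAt_Phi (hp : IsDegreeDistribution p) (h1 : Summable fun k : ℕ => (k : ℝ) * p k)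
    {v : ℝ} (hv : v ∈ Ioo (0 : ℝ) 1) : HasDerivAt (Phi p) (-kap p v) v := by
  have hc : ContinuousAt (kap p) v :=
    (continuousOn_kap hp h1).continuousAt (Icc_mem_nhds hv.1 hv.2)
  refine intervalIntegral.integral_hasDerivAt_left
    (intervalIntegrable_kap hp h1 (Ioo_subset_Icc_self hv) (by simp)) ?_ hc
  exact ((continuousOn_kap hp h1).mono Ioo_subset_Icc_self).stronglyMeasurableAtFilter
    isOpen_Ioo v hv

theorem Phi_zero_pos (hp : IsDegreeDistribution p) (h1 : Summable fun k : ℕ => (k : ℝ) * p k) :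
    0 < Phi p 0 := by
  have := mul_sq_le_Phi hp h1 le_rfl zero_le_one le_rfl
  rw [Phi_one] at this
  nlinarith [mean_pos hp h1]

/-- Clamping t to [0, Φ(0)] makes the inverse of Φ defined, monotone and continuous on all of ℝ. -/
theorem exists_Phi_eq (hp : IsDegreeDistribution p) (h1 : Summable fun k : ℕ => (k : ℝ) * p k)
    (t : ℝ) : ∃ v ∈ Icc (0 : ℝ) 1, Phi p v = min (max t 0) (Phi p 0) := by
  refine intermediate_value_Icc' zero_le_one (continuousOn_Phi hp h1) ⟨?_, min_le_right _ _⟩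
  rw [Phi_one]
  exact le_min (le_max_right _ _) (Phi_zero_pos hp h1).le

open Classical in
/-- The parameter `u` of the fluid limit at time `t`: the solution of `Φ(u) = t`, and `0` after
the extinction time `Φ(0)`. -/
noncomputable def uLim (p : ℕ → ℝ) (t : ℝ) : ℝ :=
  if h : ∃ v ∈ Icc (0 : ℝ) 1, Phi p v = min (max t 0) (Phi p 0) then h.choose else 0

theorem uLim_mem (hp : IsDegreeDistribution p) (h1 : Summable fun k : ℕ => (k : ℝ) * p k)
    (t : ℝ) : uLim p t ∈ Icc (0 : ℝ) 1 := by
  rw [uLim, dif_pos (exists_Phi_eq hp h1 t)]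
  exact (exists_Phi_eq hp h1 t).choose_spec.1

theorem Phi_uLim (hp : IsDegreeDistribution p) (h1 : Summable fun k : ℕ => (k : ℝ) * p k)
    (t : ℝ) : Phi p (uLim p t) = min (max t 0) (Phi p 0) := by
  rw [uLim, dif_pos (exists_Phi_eq hp h1 t)]
  exact (exists_Phi_eq hp h1 t).choose_spec.2

theorem uLim_eq (hp : IsDegreeDistribution p) (h1 : Summable fun k : ℕ => (k : ℝ) * p k)
    {t v : ℝ} (ht : 0 ≤ t) (hv : v ∈ Icc (0 : ℝ) 1) (h : Phi p v = t) : uLim p t = v := by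
  refine Phi_injOn hp h1 (uLim_mem hp h1 t) hv ?_
  rw [Phi_uLim hp h1, h, max_eq_left ht, min_eq_left]
  rw [← h]
  exact Phi_antitone hp h1 le_rfl hv.1 hv.2

theorem uLim_zero (hp : IsDegreeDistribution p) (h1 : Summable fun k : ℕ => (k : ℝ) * p k) :
    uLim p 0 = 1 := uLim_eq hp h1 le_rfl (by simp) Phi_one

theorem uLim_eq_zero (hp : IsDegreeDistribution p) (h1 : Summable fun k : ℕ => (k : ℝ) * p k)
    {t : ℝ} (ht : Phi p 0 ≤ t) : uLim p t = 0 := by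
  refine Phi_injOn hp h1 (uLim_mem hp h1 t) (by simp) ?_
  rw [Phi_uLim hp h1, min_eq_right (ht.trans (le_max_left _ _))]

theorem uLim_pos (hp : IsDegreeDistribution p) (h1 : Summable fun k : ℕ => (k : ℝ) * p k)
    {t : ℝ} (ht : t < Phi p 0) : 0 < uLim p t := by
  refine (uLim_mem hp h1 t).1.lt_of_ne fun h => ?_
  have := Phi_uLim hp h1 t
  rw [← h] at this
  have h2 : Phi p 0 ≤ max t 0 := by rw [this]; exact min_le_left _ _
  exact absurd h2 (not_le.2 (max_lt ht (Phi_zero_pos hp h1)))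

theorem uLim_antitone (hp : IsDegreeDistribution p) (h1 : Summable fun k : ℕ => (k : ℝ) * p k) :
    Antitone (uLim p) := by
  intro s t hst
  by_contra h
  push Not at h
  have h' := Phi_antitone hp h1 (uLim_mem hp h1 s).1 h.le (uLim_mem hp h1 t).2
  have h'' : Phi p (uLim p s) ≤ Phi p (uLim p t) := by
    rw [Phi_uLim hp h1, Phi_uLim hp h1]
    exact min_le_min (max_le_max hst le_rfl) le_rfl
  exact h.ne (Phi_injOn hp h1 (uLim_mem hp h1 s) (uLim_mem hp h1 t) (le_antisymm h'' h'))

theorem continuous_uLim (hp : IsDegreeDistribution p)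
    (h1 : Summable fun k : ℕ => (k : ℝ) * p k) : Continuous (uLim p) := by
  have key : ∀ s t, mean p * (uLim p s - uLim p t) ^ 2 ≤
      2 * |min (max t 0) (Phi p 0) - min (max s 0) (Phi p 0)| := by
    intro s t
    rw [← Phi_uLim hp h1, ← Phi_uLim hp h1]
    rcases le_total (uLim p s) (uLim p t) with h | h
    · have := mul_sq_le_Phi hp h1 (uLim_mem hp h1 s).1 h (uLim_mem hp h1 t).2
      have e : (uLim p s - uLim p t) ^ 2 = (uLim p t - uLim p s) ^ 2 := by ring
      rw [e, abs_sub_comm]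
      linarith [le_abs_self (Phi p (uLim p s) - Phi p (uLim p t))]
    · have := mul_sq_le_Phi hp h1 (uLim_mem hp h1 t).1 h (uLim_mem hp h1 s).2
      linarith [le_abs_self (Phi p (uLim p t) - Phi p (uLim p s))]
  rw [continuous_iff_continuousAt]
  intro t
  have hb : Tendsto (fun s => 2 * |min (max t 0) (Phi p 0) - min (max s 0) (Phi p 0)|) (𝓝 t)
      (𝓝 0) := by
    have : Continuous fun s : ℝ => 2 * |min (max t 0) (Phi p 0) - min (max s 0) (Phi p 0)| := by
      fun_prop
    simpa using this.tendsto t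
  have hsq : Tendsto (fun s => (uLim p s - uLim p t) ^ 2) (𝓝 t) (𝓝 0) := by
    refine squeeze_zero (fun s => sq_nonneg _) (fun s => ?_) hb
    nlinarith [key s t, one_le_mean hp h1, sq_nonneg (uLim p s - uLim p t)]
  have habs : Tendsto (fun s => |uLim p s - uLim p t|) (𝓝 t) (𝓝 0) := by
    have := (Real.continuous_sqrt.tendsto 0).comp hsq
    simpa [Function.comp_def, Real.sqrt_sq_eq_abs] using this
  exact tendsto_iff_dist_tendsto_zero.2 (by simpa [Real.dist_eq] using habs)

theorem hasDerivAt_uLim (hp : IsDegreeDistribution p) (h1 : Summable fun k : ℕ => (k : ℝ) * p k)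
    {t : ℝ} (ht : t ∈ Ioo 0 (Phi p 0)) :
    HasDerivAt (uLim p) (-(kap p (uLim p t))⁻¹) t := by
  have hpos := uLim_pos hp h1 ht.2
  have hlt : uLim p t < 1 := by
    refine (uLim_mem hp h1 t).2.lt_of_ne fun h => ?_
    have := Phi_uLim hp h1 t
    rw [h, Phi_one] at this
    exact absurd this (lt_min (lt_max_of_lt_left ht.1) (Phi_zero_pos hp h1)).ne
  have := HasDerivAt.of_local_left_inverse (f := Phi p) (g := uLim p) (a := t)
    (continuous_uLim hp h1).continuousAt (hasDerivAt_Phi hp h1 ⟨hpos, hlt⟩)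
    (neg_ne_zero.2 (kap_pos hp h1 hpos).ne') ?_
  · rwa [inv_neg] at this
  · filter_upwards [Ioo_mem_nhds ht.1 ht.2] with y hy
    rw [Phi_uLim hp h1, max_eq_left hy.1.le, min_eq_left hy.2.le]

end Analytic


/-! ### The fixed points of `G₁` -/

section FixedPoint

variable {p : ℕ → ℝ}

/-- `G₁'(1) = 1 + μ⁻¹ ∑ k (k - 2) p_k`, as a series. -/
theorem hasSum_weight_mul_pred (hp : IsDegreeDistribution p)
    (h2 : Summable fun k : ℕ => (k : ℝ) ^ 2 * p k) :
    HasSum (fun k : ℕ => (k : ℝ) * p k / mean p * ((k - 1 : ℕ) : ℝ))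
      (1 + criticality p / mean p) := by
  have h1 := summable_first_moment hp h2
  have hm := mean_pos hp h1
  have hs : Summable fun k : ℕ => (k : ℝ) * ((k : ℝ) - 2) * p k := by
    refine (h2.sub (h1.mul_left 2)).congr fun k => ?_
    ring
  have h := (h1.hasSum.add hs.hasSum).div_const (mean p)
  have e1 : ((∑' k : ℕ, (k : ℝ) * p k) + ∑' k : ℕ, (k : ℝ) * ((k : ℝ) - 2) * p k) / mean p =
      1 + criticality p / mean p := by
    change (mean p + criticality p) / mean p = _
    field_simp
  rw [e1] at h
  suffices e : (fun k : ℕ => (k : ℝ) * p k / mean p * ((k - 1 : ℕ) : ℝ)) =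
      fun k : ℕ => ((k : ℝ) * p k + (k : ℝ) * ((k : ℝ) - 2) * p k) / mean p by rwa [e]
  funext k
  rcases Nat.eq_zero_or_pos k with rfl | hk
  · simp
  · rw [Nat.cast_sub hk]
    push_cast
    ring

/-- Bernoulli's inequality, summed over k, puts G₁ above its tangent at 1, whose slope G₁'(1) is at
most 1 here. -/
theorem le_G1_of_criticality_nonpos (hp : IsDegreeDistribution p)
    (h2 : Summable fun k : ℕ => (k : ℝ) ^ 2 * p k) (hc : criticality p ≤ 0) {v : ℝ}
    (hv : v ∈ Icc (0 : ℝ) 1) : v ≤ G1 p v := by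
  have h1 := summable_first_moment hp h2
  have hm := mean_pos hp h1
  have hw : HasSum (fun k : ℕ => (k : ℝ) * p k / mean p) 1 := by
    have := h1.hasSum.div_const (mean p)
    rwa [show (∑' k : ℕ, (k : ℝ) * p k) / mean p = 1 from div_self hm.ne'] at this
  have hb := hw.add ((hasSum_weight_mul_pred hp h2).mul_right (v - 1))
  have hle := hasSum_le (fun k => ?_) hb (summable_G1 hp h1 hv).hasSum
  · have : criticality p / mean p ≤ 0 := div_nonpos_of_nonpos_of_nonneg hc hm.le
    have e : G1 p v = ∑' k : ℕ, (k : ℝ) * p k / mean p * v ^ (k - 1) := rfl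
    rw [e]
    nlinarith [hv.2]
  · have := one_add_mul_le_pow (show (-2 : ℝ) ≤ v - 1 by linarith [hv.1]) (k - 1)
    rw [add_sub_cancel] at this
    nlinarith [mul_le_mul_of_nonneg_left this (weight_nonneg hp h1 k)]

/-- G₁ has slope greater than 1 at the end point 1. If G₁(v) ≥ v near 1, the difference quotient (1
- G₁(v))/(1 - v) = ∑ weight · (1 + v + … + v^(k-2)) would be at most 1. Letting v → 1 in finite
partial sums, which avoids differentiating at the boundary, gives G₁'(1) ≤ 1. -/
theorem exists_G1_lt (hp : IsDegreeDistribution p)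
    (h2 : Summable fun k : ℕ => (k : ℝ) ^ 2 * p k) (hc : 0 < criticality p) {w : ℝ}
    (hw : w ∈ Ico (0 : ℝ) 1) : ∃ v ∈ Ioo w 1, G1 p v < v := by
  have h1 := summable_first_moment hp h2
  have hm := mean_pos hp h1
  by_contra! hcon
  have hsum : HasSum (fun k : ℕ => (k : ℝ) * p k / mean p) 1 := by
    have := h1.hasSum.div_const (mean p)
    rwa [show (∑' k : ℕ, (k : ℝ) * p k) / mean p = 1 from div_self hm.ne'] at this
  have hfin : ∀ s : Finset ℕ, ∑ k ∈ s, (k : ℝ) * p k / mean p * ((k - 1 : ℕ) : ℝ) ≤ 1 := by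
    intro s
    have hbd : ∀ v ∈ Ioo w 1, ∑ k ∈ s, (k : ℝ) * p k / mean p *
        (∑ i ∈ Finset.range (k - 1), v ^ i) ≤ 1 := by
      intro v hv
      have hvI : v ∈ Icc (0 : ℝ) 1 := ⟨hw.1.trans hv.1.le, hv.2.le⟩
      have hG := hcon v hv
      have hd := hsum.sub (summable_G1 hp h1 hvI).hasSum
      have hle := sum_le_hasSum s (fun k _ => ?_) hd
      · have e : ∑ k ∈ s, ((k : ℝ) * p k / mean p - (k : ℝ) * p k / mean p * v ^ (k - 1)) =
            (∑ k ∈ s, (k : ℝ) * p k / mean p * (∑ i ∈ Finset.range (k - 1), v ^ i)) * (1 - v) := by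
          rw [Finset.sum_mul]
          refine Finset.sum_congr rfl fun k _ => ?_
          rw [mul_assoc, geom_sum_mul_neg]
          ring
        rw [e] at hle
        have hG' : v ≤ ∑' k : ℕ, (k : ℝ) * p k / mean p * v ^ (k - 1) := hG
        have h1v : 0 < 1 - v := by linarith [hv.2]
        exact le_of_mul_le_mul_right (by linarith) h1v
      · have : v ^ (k - 1) ≤ 1 := pow_le_one₀ hvI.1 hvI.2
        nlinarith [weight_nonneg hp h1 k]
    have hcont : Continuous fun v : ℝ => ∑ k ∈ s, (k : ℝ) * p k / mean p *
        (∑ i ∈ Finset.range (k - 1), v ^ i) := by fun_prop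
    have ht : Tendsto (fun v : ℝ => ∑ k ∈ s, (k : ℝ) * p k / mean p *
        (∑ i ∈ Finset.range (k - 1), v ^ i)) (𝓝[<] 1)
        (𝓝 (∑ k ∈ s, (k : ℝ) * p k / mean p * ((k - 1 : ℕ) : ℝ))) := by
      have := (hcont.tendsto 1).mono_left (nhdsWithin_le_nhds (s := Iio 1))
      simpa using this
    exact le_of_tendsto ht (by filter_upwards [Ioo_mem_nhdsLT hw.2] with v hv using hbd v hv)
  have := (hasSum_weight_mul_pred hp h2).tsum_eq ▸
    (hasSum_weight_mul_pred hp h2).summable.tsum_le_of_sum_le hfin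
  have h3 : 0 < criticality p / mean p := div_pos hc hm
  linarith

/-- A convexity estimate: `G₁` lies below the chord from `(w, G₁(w))` to `(x, G₁(x))`. -/
theorem G1_chord (hp : IsDegreeDistribution p) (h1 : Summable fun k : ℕ => (k : ℝ) * p k)
    {w v x : ℝ} (hw : 0 ≤ w) (hwv : w ≤ v) (hvx : v ≤ x) (hx : x ≤ 1) :
    G1 p v * (x - w) ≤ (x - v) * G1 p w + (v - w) * G1 p x := by
  rcases (hwv.trans hvx).eq_or_lt with h | h
  · have e1 : v = w := by linarith
    have e2 : x = w := by linarith
    subst e1; subst e2; simp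
  have hd : 0 < x - w := sub_pos.2 h
  have hc := (convexOn_G1 hp h1).2 (show w ∈ Icc (0 : ℝ) 1 from ⟨hw, by linarith⟩)
    (show x ∈ Icc (0 : ℝ) 1 from ⟨by linarith, hx⟩)
    (show 0 ≤ (x - v) / (x - w) from div_nonneg (by linarith) hd.le)
    (show 0 ≤ (v - w) / (x - w) from div_nonneg (by linarith) hd.le)
    (by field_simp; ring)
  have hcomb : (x - v) / (x - w) * w + (v - w) / (x - w) * x = v := by field_simp; ring
  simp only [smul_eq_mul, hcomb] at hc
  have := mul_le_mul_of_nonneg_right hc hd.le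
  field_simp at this
  linarith

theorem G1_zero : G1 p 0 = p 1 / mean p := by
  rw [G1, tsum_eq_single 1]
  · simp
  · intro k hk
    rcases Nat.eq_zero_or_pos k with rfl | hk0
    · simp
    · have : k - 1 ≠ 0 := by omega
      simp [this]

/-- Existence is the intermediate value theorem between 0, where G₁(0) = p₁/μ > 0, and a point where
G₁(v) < v; uniqueness comes from convexity. -/
theorem existsUnique_fixedPoint (hp : IsDegreeDistribution p)
    (h2 : Summable fun k : ℕ => (k : ℝ) ^ 2 * p k) (hc : 0 < criticality p) (hp1 : 0 < p 1) :
    ∃! z : ℝ, z ∈ Ioo (0 : ℝ) 1 ∧ G1 p z = z := by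
  have h1 := summable_first_moment hp h2
  have hm := mean_pos hp h1
  obtain ⟨v, hv, hGv⟩ := exists_G1_lt hp h2 hc (w := 0) (by simp)
  have hcont : ContinuousOn (fun x => G1 p x - x) (Icc 0 v) :=
    ((continuousOn_G1 hp h1).mono (Icc_subset_Icc_right hv.2.le)).sub continuousOn_id
  have h0 : 0 < G1 p 0 - 0 := by rw [G1_zero, sub_zero]; exact div_pos hp1 hm
  obtain ⟨z, hz, hz0⟩ := intermediate_value_Icc' hv.1.le hcont
    (show (0 : ℝ) ∈ Icc (G1 p v - v) (G1 p 0 - 0) from ⟨by linarith, h0.le⟩)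
  have hz0' : G1 p z - z = 0 := hz0
  have hzpos : 0 < z := hz.1.lt_of_ne fun h => by
    rw [← h] at hz0'; linarith
  refine ⟨z, ⟨⟨hzpos, hz.2.trans_lt hv.2⟩, by linarith⟩, ?_⟩
  -- For fixed points a < b, a point x > b with G₁(x) < x would put the chord from a to x strictly
  -- below the diagonal at b.
  have huniq : ∀ a b : ℝ, a ∈ Ioo (0 : ℝ) 1 → G1 p a = a → b ∈ Ioo (0 : ℝ) 1 → G1 p b = b →
      ¬ a < b := by
    intro a b ha hGa hb hGb hab
    obtain ⟨x, hx, hGx⟩ := exists_G1_lt hp h2 hc (w := b) ⟨hb.1.le, hb.2⟩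
    have := G1_chord hp h1 ha.1.le hab.le hx.1.le hx.2.le
    rw [hGa, hGb] at this
    nlinarith [mul_lt_mul_of_pos_left hGx (sub_pos.2 hab)]
  rintro y ⟨hy, hGy⟩
  have hzG : G1 p z = z := by linarith
  have hzI : z ∈ Ioo (0 : ℝ) 1 := ⟨hzpos, hz.2.trans_lt hv.2⟩
  exact le_antisymm (not_lt.1 (huniq z y hzI hzG hy hGy)) (not_lt.1 (huniq y z hy hGy hzI hzG))

theorem rho_spec (hp : IsDegreeDistribution p)
    (h2 : Summable fun k : ℕ => (k : ℝ) ^ 2 * p k) (hc : 0 < criticality p) :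
    rho p ∈ Ico (0 : ℝ) 1 ∧ G1 p (rho p) = rho p := by
  by_cases hp1 : 0 < p 1
  · have := Classical.epsilon_spec (existsUnique_fixedPoint hp h2 hc hp1).exists
    rw [rho, if_pos hp1]
    exact ⟨⟨this.1.1.le, this.1.2⟩, this.2⟩
  · have h0 : p 1 = 0 := le_antisymm (not_lt.1 hp1) (hp.nonneg 1)
    rw [rho, if_neg hp1]
    exact ⟨by simp, by rw [G1_zero, h0, zero_div]⟩

/-- The chord of G₁ between its fixed points ρ and 1 is the diagonal. -/
theorem G1_le_of_rho_le (hp : IsDegreeDistribution p)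
    (h2 : Summable fun k : ℕ => (k : ℝ) ^ 2 * p k) (hc : 0 < criticality p) {v : ℝ}
    (hv : v ∈ Icc (rho p) 1) : G1 p v ≤ v := by
  have h1 := summable_first_moment hp h2
  obtain ⟨hρ, hG⟩ := rho_spec hp h2 hc
  have := G1_chord hp h1 hρ.1 hv.1 hv.2 le_rfl
  rw [hG, G1_one hp h1] at this
  have hd : 0 < 1 - rho p := by linarith [hρ.2]
  nlinarith

/-- Were G₁(v) < v, the chord from v to 1 would pass below the point (ρ, ρ) of the graph. -/
theorem le_G1_of_le_rho (hp : IsDegreeDistribution p)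
    (h2 : Summable fun k : ℕ => (k : ℝ) ^ 2 * p k) (hc : 0 < criticality p) {v : ℝ}
    (hv : v ∈ Icc 0 (rho p)) : v ≤ G1 p v := by
  have h1 := summable_first_moment hp h2
  obtain ⟨hρ, hG⟩ := rho_spec hp h2 hc
  have := G1_chord hp h1 hv.1 hv.2 hρ.2.le le_rfl
  rw [hG, G1_one hp h1] at this
  have hd : 0 < 1 - rho p := by linarith [hρ.2]
  nlinarith

end FixedPoint

/-! ### The explicit trajectory in terms of the time change -/

section Explicit

variable {p : ℕ → ℝ}

theorem integral_G1 (hp : IsDegreeDistribution p) (h1 : Summable fun k : ℕ => (k : ℝ) * p k)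
    {w v : ℝ} (hw : 0 ≤ w) (hwv : w ≤ v) (hv : v ≤ 1) :
    ∫ x in w..v, mean p * G1 p x = G0 p v - G0 p w := by
  have hsub : Icc w v ⊆ Icc (0 : ℝ) 1 := Icc_subset_Icc hw hv
  refine intervalIntegral.integral_eq_sub_of_hasDerivAt_of_le hwv
    ((continuousOn_G0 hp).mono hsub)
    (fun x hx => hasDerivAt_G0 hp h1 ⟨hw.trans_lt hx.1, hx.2.trans_le hv⟩) ?_
  refine ContinuousOn.intervalIntegrable ?_
  rw [uIcc_of_le hwv]
  exact continuousOn_const.mul ((continuousOn_G1 hp h1).mono hsub)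

/-- On [ρ, 1] the maximum in κ is the linear term. In the supercritical case this identifies `tau`
as Φ(ρ). -/
theorem Phi_of_ge {ρ : ℝ} (hle : ∀ v ∈ Icc ρ 1, G1 p v ≤ v) {v : ℝ}
    (hv : v ∈ Icc ρ 1) : Phi p v = mean p / 2 * (1 - v ^ 2) := by
  have : Phi p v = ∫ x in v..1, mean p * x := by
    refine intervalIntegral.integral_congr fun x hx => ?_
    rw [uIcc_of_le hv.2] at hx
    simp only [kap]
    rw [max_eq_left (hle x ⟨hv.1.trans hx.1, hx.2⟩)]
  rw [this, intervalIntegral.integral_const_mul, integral_id]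
  ring

theorem Phi_of_le (hp : IsDegreeDistribution p) (h1 : Summable fun k : ℕ => (k : ℝ) * p k)
    {ρ : ℝ} (hρ : ρ ∈ Icc (0 : ℝ) 1)
    (hle : ∀ v ∈ Icc ρ 1, G1 p v ≤ v) (hge : ∀ v ∈ Icc 0 ρ, v ≤ G1 p v) {v : ℝ}
    (hv : v ∈ Icc 0 ρ) : Phi p v = mean p / 2 * (1 - ρ ^ 2) + (G0 p ρ - G0 p v) := by
  have h := Phi_sub hp h1 ⟨hv.1, hv.2.trans hρ.2⟩ hρ
  rw [Phi_of_ge hle ⟨le_rfl, hρ.2⟩] at h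
  have : ∫ x in v..ρ, kap p x = ∫ x in v..ρ, mean p * G1 p x := by
    refine intervalIntegral.integral_congr fun x hx => ?_
    rw [uIcc_of_le hv.2] at hx
    simp only [kap]
    rw [max_eq_right (hge x ⟨hv.1.trans hx.1, hx.2⟩)]
  rw [this, integral_G1 hp h1 hv.1 hv.2 hρ.2] at h
  linarith

theorem f_spec (hp : IsDegreeDistribution p) {s t : ℝ} (hs : s ∈ Ioc (0 : ℝ) 1) (ht : 0 ≤ t)
    (ht' : t ≤ G0 p s) : f p s t ∈ Icc (0 : ℝ) 1 ∧ G0 p s - G0 p (s * f p s t) = t := by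
  have hex : ∃ x ∈ Icc (0 : ℝ) 1, F p s x = t := by
    have hc : ContinuousOn (F p s) (Icc 0 1) := by
      refine continuousOn_const.sub ((continuousOn_G0 hp).comp (by fun_prop) fun x hx => ?_)
      exact ⟨mul_nonneg hs.1.le hx.1, mul_le_one₀ hs.2 hx.1 hx.2⟩
    refine intermediate_value_Icc' zero_le_one hc ⟨?_, ?_⟩
    · simpa [F] using ht
    · simpa [F, G0_zero hp] using ht'
  rw [f, if_neg hs.1.ne', if_pos ⟨ht, ht'⟩]
  exact ⟨Function.invFunOn_mem hex, Function.invFunOn_eq hex⟩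

/-- Below ρ, Φ exceeds its value at ρ by G₀(ρ) - G₀(v), and `f` inverts exactly this difference. The
threshold ρ is left free so that ρ = 1, with a first phase of length zero, covers the case without a
giant component. -/
theorem mul_f_eq_uLim (hp : IsDegreeDistribution p) (h1 : Summable fun k : ℕ => (k : ℝ) * p k)
    {ρ : ℝ} (hρ : ρ ∈ Icc (0 : ℝ) 1)
    (hle : ∀ v ∈ Icc ρ 1, G1 p v ≤ v) (hge : ∀ v ∈ Icc 0 ρ, v ≤ G1 p v) {t : ℝ}
    (ht : mean p / 2 * (1 - ρ ^ 2) ≤ t) :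
    uLim p t ∈ Icc 0 ρ ∧ ρ * f p ρ (t - mean p / 2 * (1 - ρ ^ 2)) = uLim p t := by
  have hm := mean_pos hp h1
  have hτ : 0 ≤ mean p / 2 * (1 - ρ ^ 2) :=
    mul_nonneg (by linarith) (by nlinarith [hρ.1, hρ.2])
  have hΦ0 := Phi_of_le hp h1 hρ hle hge (v := 0) ⟨le_rfl, hρ.1⟩
  rw [G0_zero hp, sub_zero] at hΦ0
  rcases hρ.1.eq_or_lt with h0 | h0
  · subst h0
    rw [G0_zero hp, add_zero] at hΦ0
    rw [uLim_eq_zero hp h1 (hΦ0.trans_le ht)]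
    simp
  by_cases hle' : t - mean p / 2 * (1 - ρ ^ 2) ≤ G0 p ρ
  · obtain ⟨hf, hG⟩ := f_spec hp (s := ρ) ⟨h0, hρ.2⟩ (sub_nonneg.2 ht) hle'
    have hmem : ρ * f p ρ (t - mean p / 2 * (1 - ρ ^ 2)) ∈ Icc 0 ρ :=
      ⟨mul_nonneg h0.le hf.1, mul_le_of_le_one_right h0.le hf.2⟩
    have := Phi_of_le hp h1 hρ hle hge hmem
    rw [hG] at this
    have he := uLim_eq hp h1 (hτ.trans ht) ⟨hmem.1, hmem.2.trans hρ.2⟩ (by linarith)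
    rw [he]
    exact ⟨hmem, rfl⟩
  -- Beyond the range of the inverse all vertices are explored, and both the default value of `f`
  -- and `uLim` are 0.
  · rw [uLim_eq_zero hp h1 (t := t) (by rw [hΦ0]; linarith), f, if_neg h0.ne',
      if_neg fun h => hle' h.2]
    simpa using h0.le

/-- The limit trajectory `ζ` in terms of the time change. -/
theorem zetaLim_eq (hp : IsDegreeDistribution p)
    (h2 : Summable fun k : ℕ => (k : ℝ) ^ 2 * p k) {t : ℝ} (ht : 0 ≤ t) :
    zetaLim p t 0 = mean p * uLim p t * max (uLim p t - G1 p (uLim p t)) 0 ∧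
      ∀ k, 1 ≤ k → zetaLim p t k = p k * uLim p t ^ k := by
  have h1 := summable_first_moment hp h2
  have hm := mean_pos hp h1
  by_cases hc : criticality p ≤ 0
  · have hge : ∀ v ∈ Icc (0 : ℝ) 1, v ≤ G1 p v :=
      fun v hv => le_G1_of_criticality_nonpos hp h2 hc hv
    have hle : ∀ v ∈ Icc (1 : ℝ) 1, G1 p v ≤ v := by
      intro v hv
      obtain rfl : v = 1 := le_antisymm hv.2 hv.1
      exact (G1_one hp h1).le
    obtain ⟨hmem, hu⟩ := mul_f_eq_uLim hp h1 (ρ := 1) (by simp) hle hge (t := t) (by simpa using ht)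
    simp only [one_pow, sub_self, mul_zero, sub_zero, one_mul] at hu
    rw [zetaLim, if_pos hc]
    refine ⟨?_, fun k hk => ?_⟩
    · rw [max_eq_right (by linarith [hge _ hmem])]
      simp [zetaSub]
    · rw [zetaSub, if_neg (by omega), hu]
  · have hc' : 0 < criticality p := not_le.1 hc
    obtain ⟨hρ, hGρ⟩ := rho_spec hp h2 hc'
    have hle : ∀ v ∈ Icc (rho p) 1, G1 p v ≤ v := fun v hv => G1_le_of_rho_le hp h2 hc' hv
    have hge : ∀ v ∈ Icc 0 (rho p), v ≤ G1 p v := fun v hv => le_G1_of_le_rho hp h2 hc' hv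
    rw [zetaLim, if_neg hc]
    by_cases htau : t ≤ tau p
    · have htau' : t ≤ mean p / 2 * (1 - rho p ^ 2) := htau
      have hq : rho p ^ 2 ≤ 1 - 2 * t / mean p := by
        rw [le_sub_iff_add_le, ← le_sub_iff_add_le', div_le_iff₀ hm]
        linarith
      have hq0 : 0 ≤ 1 - 2 * t / mean p := (sq_nonneg _).trans hq
      have hs : √(1 - 2 * t / mean p) ∈ Icc (rho p) 1 := by
        refine ⟨Real.le_sqrt_of_sq_le hq, Real.sqrt_le_one.2 ?_⟩
        have : 0 ≤ 2 * t / mean p := by positivity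
        linarith
      have hu : uLim p t = √(1 - 2 * t / mean p) := by
        refine uLim_eq hp h1 ht ⟨hρ.1.trans hs.1, hs.2⟩ ?_
        rw [Phi_of_ge hle hs, Real.sq_sqrt hq0]
        field_simp
        ring
      rw [hu]
      refine ⟨?_, fun k hk => ?_⟩
      · rw [max_eq_left (by linarith [hle _ hs])]
        simp only [zetaSuper, if_true, if_pos htau]
        have := Real.mul_self_sqrt hq0
        have e : mean p * √(1 - 2 * t / mean p) * √(1 - 2 * t / mean p) = mean p - 2 * t := by
          rw [mul_assoc, this]; field_simp
        rw [mul_sub, e]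
      · simp only [zetaSuper, if_neg (show ¬ k = 0 by omega), if_pos htau]
        rw [Real.sqrt_eq_rpow, ← Real.rpow_natCast, ← Real.rpow_mul hq0]
        congr 2
        ring
    · have htau' : tau p < t := not_le.1 htau
      obtain ⟨hmem, hu⟩ := mul_f_eq_uLim hp h1 (ρ := rho p) ⟨hρ.1, hρ.2.le⟩ hle hge (t := t)
        htau'.le
      refine ⟨?_, fun k hk => ?_⟩
      · rw [max_eq_right (by linarith [hge _ hmem])]
        simp [zetaSuper, htau]
      · simp only [zetaSuper, if_neg (show ¬ k = 0 by omega), if_neg htau]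
        rw [← hu, mul_pow, ← mul_assoc]
        rfl

end Explicit


/-! ### Calculus on intervals -/

theorem eq_of_hasDerivAt_zero {g : ℝ → ℝ} {a b : ℝ} (hab : a ≤ b) (hc : ContinuousOn g (Icc a b))
    (hd : ∀ x ∈ Ioo a b, HasDerivAt g 0 x) : g b = g a := by
  rcases hab.eq_or_lt with rfl | h
  · rfl
  obtain ⟨c, -, hc⟩ := exists_hasDerivAt_eq_slope g (fun _ => 0) h hc hd
  have : b - a ≠ 0 := (sub_pos.2 h).ne'
  field_simp at hc
  linarith

theorem le_of_hasDerivAt_nonneg {g g' : ℝ → ℝ} {a b : ℝ} (hab : a ≤ b)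
    (hc : ContinuousOn g (Icc a b)) (hd : ∀ x ∈ Ioo a b, HasDerivAt g (g' x) x)
    (h0 : ∀ x ∈ Ioo a b, 0 ≤ g' x) : g a ≤ g b := by
  rcases hab.eq_or_lt with rfl | h
  · rfl
  obtain ⟨c, hcI, hc⟩ := exists_hasDerivAt_eq_slope g g' h hc hd
  have h1 := h0 c hcI
  rw [hc, div_nonneg_iff] at h1
  rcases h1 with h1 | h1 <;> linarith [h1.1, h1.2]

/-- The last time at which a continuous function is nonnegative. -/
theorem exists_last_zero {g : ℝ → ℝ} {a b : ℝ} (hab : a ≤ b) (hc : ContinuousOn g (Icc a b))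
    (ha : 0 ≤ g a) (hb : g b < 0) : ∃ s ∈ Ico a b, g s = 0 ∧ ∀ x ∈ Ioc s b, g x < 0 := by
  have hS : IsCompact (Icc a b ∩ g ⁻¹' Ici 0) :=
    isCompact_Icc.of_isClosed_subset (hc.preimage_isClosed_of_isClosed isClosed_Icc isClosed_Ici)
      inter_subset_left
  have hne : (Icc a b ∩ g ⁻¹' Ici 0).Nonempty := ⟨a, ⟨le_rfl, hab⟩, ha⟩
  obtain ⟨⟨has, hsb⟩, hs0⟩ := hS.sSup_mem hne
  set s := sSup (Icc a b ∩ g ⁻¹' Ici 0) with hs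
  have hs0' : 0 ≤ g s := hs0
  have hlt : s < b := hsb.lt_of_ne fun h => by rw [h] at hs0'; linarith
  have hafter : ∀ x ∈ Ioc s b, g x < 0 := by
    intro x hx
    by_contra hcon
    have := le_csSup hS.bddAbove (show x ∈ Icc a b ∩ g ⁻¹' Ici 0 from
      ⟨⟨has.trans hx.1.le, hx.2⟩, not_lt.1 hcon⟩)
    exact absurd hx.1 (not_lt.2 this)
  refine ⟨s, ⟨has, hlt⟩, le_antisymm ?_ hs0', hafter⟩
  have hcs : ContinuousWithinAt g (Ioc s b) s :=
    (hc s ⟨has, hsb⟩).mono fun x hx => ⟨has.trans hx.1.le, hx.2⟩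
  have : (𝓝[Ioc s b] s).NeBot := by
    rw [nhdsWithin_Ioc_eq_nhdsGT hlt]; infer_instance
  exact le_of_tendsto hcs (eventually_nhdsWithin_of_forall fun x hx => (hafter x hx).le)

theorem lipschitzOnWith_of_antitone {g : ℝ → ℝ} {T K : ℝ} (hg : AntitoneOn g (Icc 0 T))
    (hK : ∀ s ∈ Icc 0 T, ∀ t ∈ Icc 0 T, s ≤ t → g s - g t ≤ K * (t - s)) :
    LipschitzOnWith K.toNNReal g (Icc 0 T) := by
  refine LipschitzOnWith.of_dist_le_mul fun s hs t ht => ?_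
  rw [Real.dist_eq, Real.dist_eq]
  have hK' := Real.le_coe_toNNReal K
  rcases le_total s t with hst | hst
  · rw [abs_of_nonneg (sub_nonneg.2 (hg hs ht hst)), abs_of_nonpos (sub_nonpos.2 hst)]
    exact (hK s hs t ht hst).trans ((mul_le_mul_of_nonneg_right hK' (sub_nonneg.2 hst)).trans
      (by rw [neg_sub]))
  · rw [abs_of_nonpos (sub_nonpos.2 (hg ht hs hst)), abs_of_nonneg (sub_nonneg.2 hst), neg_sub]
    exact (hK t ht s hs hst).trans (mul_le_mul_of_nonneg_right hK' (sub_nonneg.2 hst))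

/-! ### Fluid trajectories -/

/-- `∑ k z_k`, the mass of sleeping half-edges. -/
noncomputable def sleepMass (z : ℕ → ℝ) : ℝ := ∑' k : ℕ, (k : ℝ) * z k

/-- The fluid dynamics of the exploration: `z t k` is the mass of sleeping vertices of degree `k`
and `R t` is the mass of all half-edges which have not been paired at time `t`. -/
structure IsFluid (p : ℕ → ℝ) (T : ℝ) (z : ℝ → ℕ → ℝ) (R : ℝ → ℝ) : Prop where
  init : ∀ k, 1 ≤ k → z 0 k = p k
  anti : ∀ k, 1 ≤ k → AntitoneOn (fun t => z t k) (Icc 0 T)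
  nonneg : ∀ k, 1 ≤ k → ∀ t ∈ Icc 0 T, 0 ≤ z t k
  R_zero : R 0 = mean p
  R_anti : AntitoneOn R (Icc 0 T)
  R_lip : ∀ s ∈ Icc 0 T, ∀ t ∈ Icc 0 T, s ≤ t → R s - R t ≤ 2 * (t - s)
  mass_le : ∀ t ∈ Icc 0 T, sleepMass (z t) ≤ R t
  -- Since the sleeping mass and R decrease, the hypothesis means that active half-edges are present
  -- throughout [s, t]; then half-edges disappear at the full rate 2.
  drop : ∀ s ∈ Icc 0 T, ∀ t ∈ Icc 0 T, s ≤ t → sleepMass (z s) < R t → R t = R s - 2 * (t - s)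
  -- The rate k z_k / R is evaluated with its numerator and denominator at opposite ends of the
  -- interval, in the direction of monotonicity. Such bounds need no continuity and pass to
  -- pointwise limits.
  lower : ∀ k, 1 ≤ k → ∀ s ∈ Icc 0 T, ∀ t ∈ Icc 0 T, s ≤ t → 0 < R t →
    (t - s) * (k * z t k / R s) ≤ z s k - z t k
  upper : ∀ k, 1 ≤ k → ∀ s ∈ Icc 0 T, ∀ t ∈ Icc 0 T, s ≤ t → 0 < R t →
    z s k - z t k ≤ (t - s) * (k * z s k / R t)

namespace IsFluid

variable {p : ℕ → ℝ} {T : ℝ} {z : ℝ → ℕ → ℝ} {R : ℝ → ℝ}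

theorem mono (h : IsFluid p T z R) {T' : ℝ} (hT : T' ≤ T) : IsFluid p T' z R := by
  have hs : Icc (0 : ℝ) T' ⊆ Icc 0 T := Icc_subset_Icc_right hT
  exact ⟨h.init, fun k hk => (h.anti k hk).mono hs, fun k hk t ht => h.nonneg k hk t (hs ht),
    h.R_zero, h.R_anti.mono hs, fun s hs' t ht => h.R_lip s (hs hs') t (hs ht),
    fun t ht => h.mass_le t (hs ht), fun s hs' t ht => h.drop s (hs hs') t (hs ht),
    fun k hk s hs' t ht => h.lower k hk s (hs hs') t (hs ht),
    fun k hk s hs' t ht => h.upper k hk s (hs hs') t (hs ht)⟩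

theorem continuousOn_R (h : IsFluid p T z R) : ContinuousOn R (Icc 0 T) :=
  (lipschitzOnWith_of_antitone h.R_anti h.R_lip).continuousOn

theorem le_init (h : IsFluid p T z R) {k : ℕ} (hk : 1 ≤ k) {t : ℝ} (ht : t ∈ Icc 0 T) :
    z t k ≤ p k :=
  (h.anti k hk ⟨le_rfl, ht.1.trans ht.2⟩ ht ht.1).trans (h.init k hk).le

theorem summable_mass (h : IsFluid p T z R) (h1 : Summable fun k : ℕ => (k : ℝ) * p k) {t : ℝ}
    (ht : t ∈ Icc 0 T) : Summable fun k : ℕ => (k : ℝ) * z t k := by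
  refine Summable.of_nonneg_of_le (fun k => ?_) (fun k => ?_) h1
  · rcases Nat.eq_zero_or_pos k with rfl | hk
    · simp
    · exact mul_nonneg k.cast_nonneg (h.nonneg k hk t ht)
  · rcases Nat.eq_zero_or_pos k with rfl | hk
    · simp
    · exact mul_le_mul_of_nonneg_left (h.le_init hk ht) k.cast_nonneg

theorem mul_le_R (h : IsFluid p T z R) (h1 : Summable fun k : ℕ => (k : ℝ) * p k) {k : ℕ}
    {t : ℝ} (ht : t ∈ Icc 0 T) : (k : ℝ) * z t k ≤ R t := by
  refine ((h.summable_mass h1 ht).le_tsum k fun j _ => ?_).trans (h.mass_le t ht)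
  rcases Nat.eq_zero_or_pos j with rfl | hj
  · simp
  · exact mul_nonneg j.cast_nonneg (h.nonneg j hj t ht)

theorem R_nonneg (h : IsFluid p T z R) (h1 : Summable fun k : ℕ => (k : ℝ) * p k) {t : ℝ}
    (ht : t ∈ Icc 0 T) : 0 ≤ R t := by
  simpa using h.mul_le_R h1 (k := 0) ht

theorem continuousOn_z (h : IsFluid p T z R) (hR : ∀ t ∈ Icc 0 T, 0 < R t) {k : ℕ}
    (hk : 1 ≤ k) : ContinuousOn (fun t => z t k) (Icc 0 T) := by
  rcases lt_or_ge T 0 with hT | hT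
  · rw [Icc_eq_empty (not_le.2 hT)]; exact continuousOn_empty _
  have hTI : T ∈ Icc 0 T := ⟨hT, le_rfl⟩
  have key : ∀ s ∈ Icc 0 T, ∀ t ∈ Icc 0 T, s ≤ t → z s k - z t k ≤ (k * p k / R T) * (t - s) := by
    intro s hs t ht hst
    refine (h.upper k hk s hs t ht hst (hR t ht)).trans ?_
    rw [mul_comm]
    refine mul_le_mul_of_nonneg_right ?_ (sub_nonneg.2 hst)
    exact div_le_div₀ (mul_nonneg k.cast_nonneg ((h.nonneg k hk s hs).trans (h.le_init hk hs)))
      (mul_le_mul_of_nonneg_left (h.le_init hk hs) k.cast_nonneg) (hR T hTI)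
      (h.R_anti ht hTI ht.2)
  exact (lipschitzOnWith_of_antitone (h.anti k hk) key).continuousOn

/-- The fields `lower` and `upper` bracket the slope between -k z_t/R_s and -k z_s/R_t, both of
which tend to the claimed derivative. Which of them is larger depends on the order of s and t, hence
the minimum and the maximum. -/
theorem hasDerivAt_z (h : IsFluid p T z R) (hR : ∀ t ∈ Icc 0 T, 0 < R t) {k : ℕ}
    (hk : 1 ≤ k) {t : ℝ} (ht : t ∈ Ioo 0 T) :
    HasDerivAt (fun t => z t k) (-(k * z t k / R t)) t := by
  have htI := Ioo_subset_Icc_self ht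
  have hnhds : Icc 0 T ∈ 𝓝 t := Icc_mem_nhds ht.1 ht.2
  have hRc : ContinuousAt R t := h.continuousOn_R.continuousAt hnhds
  have hzc : ContinuousAt (fun t => z t k) t := (h.continuousOn_z hR hk).continuousAt hnhds
  have hA : Tendsto (fun s => -(k * z t k / R s)) (𝓝[≠] t) (𝓝 (-(k * z t k / R t))) :=
    ((tendsto_const_nhds.div hRc.tendsto (hR t htI).ne').neg).mono_left nhdsWithin_le_nhds
  have hB : Tendsto (fun s => -(k * z s k / R t)) (𝓝[≠] t) (𝓝 (-(k * z t k / R t))) :=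
    (((tendsto_const_nhds.mul hzc.tendsto).div_const _).neg).mono_left nhdsWithin_le_nhds
  have hmin := hA.min hB
  have hmax := hA.max hB
  rw [min_self] at hmin
  rw [max_self] at hmax
  rw [hasDerivAt_iff_tendsto_slope]
  have hev : ∀ᶠ s in 𝓝[≠] t, s ∈ Icc 0 T ∧ s ≠ t :=
    (show ∀ᶠ s in 𝓝[≠] t, s ∈ Icc 0 T from nhdsWithin_le_nhds hnhds).and self_mem_nhdsWithin
  have hslope : ∀ s, s ∈ Icc 0 T ∧ s ≠ t →
      min (-(k * z t k / R s)) (-(k * z s k / R t)) ≤ slope (fun t => z t k) t s ∧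
      slope (fun t => z t k) t s ≤ max (-(k * z t k / R s)) (-(k * z s k / R t)) := by
    rintro s ⟨hs, hne⟩
    rw [slope_def_field]
    rcases lt_or_gt_of_ne hne with hlt | hlt
    · have hl := h.lower k hk s hs t htI hlt.le (hR t htI)
      have hu := h.upper k hk s hs t htI hlt.le (hR t htI)
      have hd : 0 < t - s := sub_pos.2 hlt
      have e : (z s k - z t k) / (s - t) = -((z s k - z t k) / (t - s)) := by
        rw [← neg_sub t s, div_neg]
      constructor
      · refine (min_le_right _ _).trans ?_
        rw [e, neg_le_neg_iff, div_le_iff₀ hd]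
        linarith
      · refine le_trans ?_ (le_max_left _ _)
        rw [e, neg_le_neg_iff, le_div_iff₀ hd]
        linarith
    · have hl := h.lower k hk t htI s hs hlt.le (hR s hs)
      have hu := h.upper k hk t htI s hs hlt.le (hR s hs)
      have hd : 0 < s - t := sub_pos.2 hlt
      constructor
      · refine (min_le_left _ _).trans ?_
        rw [le_div_iff₀ hd]
        linarith
      · refine le_trans ?_ (le_max_right _ _)
        rw [div_le_iff₀ hd]
        linarith
  exact tendsto_of_tendsto_of_tendsto_of_le_of_le' hmin hmax
    (hev.mono fun s hs => (hslope s hs).1) (hev.mono fun s hs => (hslope s hs).2)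

/-- While half-edges are left, `z_k = p_k u^k` where `u' = -u / R`. -/
theorem exists_param (h : IsFluid p T z R) (hT : 0 ≤ T) (hR : ∀ t ∈ Icc 0 T, 0 < R t) :
    ∃ u : ℝ → ℝ, Continuous u ∧ u 0 = 1 ∧ (∀ t ∈ Icc 0 T, u t ∈ Ioc (0 : ℝ) 1) ∧
      (∀ t ∈ Ioc 0 T, u t < 1) ∧ Antitone u ∧
      (∀ t ∈ Ioo 0 T, HasDerivAt u (-(u t / R t)) t) ∧
      ∀ t ∈ Icc 0 T, ∀ k, 1 ≤ k → z t k = p k * u t ^ k := by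
  -- The parameter is u = exp(-∫ 1/R); R is frozen outside [0, T] so that the integral is
  -- differentiable everywhere.
  set Rc : ℝ → ℝ := fun t => (R (projIcc 0 T hT t))⁻¹ with hRc
  have hRcc : Continuous Rc := by
    have h' : Continuous ((Icc 0 T).domRestrict R) :=
      continuousOn_iff_continuous_domRestrict.1 h.continuousOn_R
    exact (h'.comp continuous_projIcc).inv₀ fun t => (hR _ (projIcc 0 T hT t).2).ne'
  have hRcpos : ∀ t, 0 < Rc t := fun t => inv_pos.2 (hR _ (projIcc 0 T hT t).2)
  have hRceq : ∀ t ∈ Icc 0 T, Rc t = (R t)⁻¹ := fun t ht => by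
    simp only [hRc]; rw [projIcc_of_mem hT ht]
  set lam : ℝ → ℝ := fun t => ∫ x in (0 : ℝ)..t, Rc x with hlam
  have hlamd : ∀ t, HasDerivAt lam (Rc t) t := fun t =>
    intervalIntegral.integral_hasDerivAt_right (hRcc.intervalIntegrable _ _)
      (hRcc.stronglyMeasurableAtFilter _ _) hRcc.continuousAt
  have hlamc : Continuous lam := continuous_iff_continuousAt.2 fun t => (hlamd t).continuousAt
  have hlam0 : lam 0 = 0 := by simp [hlam]
  have hlammono : StrictMono lam :=
    strictMono_of_hasDerivAt_pos (fun t => hlamd t) fun t => hRcpos t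
  refine ⟨fun t => Real.exp (-lam t), by fun_prop, by simp [hlam0], fun t ht => ?_,
    fun t ht => ?_, ?_, fun t ht => ?_, fun t ht k hk => ?_⟩
  · refine ⟨Real.exp_pos _, Real.exp_le_one_iff.2 (neg_nonpos.2 ?_)⟩
    rw [← hlam0]; exact hlammono.monotone ht.1
  · refine Real.exp_lt_one_iff.2 (neg_neg_iff_pos.2 ?_)
    rw [← hlam0]; exact hlammono ht.1
  · intro s t hst
    exact Real.exp_le_exp.2 (neg_le_neg (hlammono.monotone hst))
  · have := (hlamd t).neg.exp
    rw [hRceq t (Ioo_subset_Icc_self ht)] at this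
    refine this.congr_deriv ?_
    rw [div_eq_mul_inv]
    simp
  · have hconst := eq_of_hasDerivAt_zero (g := fun s => z s k * Real.exp (k * lam s)) ht.1
      (((h.continuousOn_z hR hk).mono (Icc_subset_Icc_right ht.2)).mul (by fun_prop))
      (fun x hx => ?_)
    · simp only [hlam0, h.init k hk, mul_zero, Real.exp_zero, mul_one] at hconst
      rw [← hconst, ← Real.exp_nat_mul, mul_assoc, ← Real.exp_add]
      simp
    · have hxI : x ∈ Ioo 0 T := ⟨hx.1, hx.2.trans_le ht.2⟩
      have hd := (h.hasDerivAt_z hR hk hxI).mul (((hlamd x).const_mul (k : ℝ)).exp)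
      rw [hRceq x (Ioo_subset_Icc_self hxI)] at hd
      refine hd.congr_deriv ?_
      rw [div_eq_mul_inv]
      ring

/-- With u from `exists_param`, the sleeping mass is μ u G₁(u). Two comparison arguments show that R
is neither below nor above u κ(u); then u' = -u/R becomes u' = -1/κ(u), which integrates to Φ(u(t))
= t. -/
theorem eq_of_pos (hp : IsDegreeDistribution p) (h1 : Summable fun k : ℕ => (k : ℝ) * p k)
    (h : IsFluid p T z R) (hT : 0 ≤ T) (hRT : 0 < R T) :
    R T = uLim p T * kap p (uLim p T) ∧ ∀ k, 1 ≤ k → z T k = p k * uLim p T ^ k := by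
  have hm := mean_pos hp h1
  have hTI : T ∈ Icc 0 T := ⟨hT, le_rfl⟩
  have hR : ∀ t ∈ Icc 0 T, 0 < R t := fun t ht => hRT.trans_le (h.R_anti ht hTI ht.2)
  obtain ⟨u, huc, hu0, hu, hu1, huanti, hud, hz⟩ := h.exists_param hT hR
  have huI : ∀ t ∈ Icc 0 T, u t ∈ Icc (0 : ℝ) 1 := fun t ht => Ioc_subset_Icc_self (hu t ht)
  have hW : ∀ t ∈ Icc 0 T, sleepMass (z t) = mean p * u t * G1 p (u t) := by
    intro t ht
    rw [← (hasSum_halfEdges hp h1 (huI t ht)).tsum_eq]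
    refine tsum_congr fun k => ?_
    rcases Nat.eq_zero_or_pos k with rfl | hk
    · simp
    · rw [hz t ht k hk]
  have hWc : ContinuousOn (fun t => sleepMass (z t)) (Icc 0 T) := by
    refine ContinuousOn.congr (f := fun t => mean p * u t * G1 p (u t)) ?_ hW
    exact (continuous_const.mul huc).continuousOn.mul
      ((continuousOn_G1 hp h1).comp huc.continuousOn huI)
  -- The function μ u² has derivative -2 μ u²/R, so it falls at rate at least 2 wherever it exceeds
  -- R, whereas R falls at rate at most 2. Hence it cannot overtake R after the last time at which
  -- they agree.
  have hsq : ∀ t ∈ Icc 0 T, mean p * u t ^ 2 ≤ R t := by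
    intro t ht
    by_contra hcon
    push Not at hcon
    have hsub : Icc 0 t ⊆ Icc 0 T := Icc_subset_Icc_right ht.2
    obtain ⟨s, hs, hs0, hafter⟩ := exists_last_zero (g := fun x => R x - mean p * u x ^ 2) ht.1
      ((h.continuousOn_R.mono hsub).sub (by fun_prop)) (by simp [h.R_zero, hu0]) (by simpa using hcon)
    have hle := le_of_hasDerivAt_nonneg (g := fun x => -2 * x - mean p * u x ^ 2)
      (g' := fun x => -2 - mean p * (2 * u x * -(u x / R x))) hs.2.le (by fun_prop)
      (fun x hx => ?_) (fun x hx => ?_)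
    · have hR' := h.R_lip s (hsub ⟨hs.1, hs.2.le⟩) t ht hs.2.le
      linarith
    · have hxI : x ∈ Ioo 0 T := ⟨hs.1.trans_lt hx.1, hx.2.trans_le ht.2⟩
      have h1 := ((hud x hxI).pow 2).const_mul (mean p)
      have h2 := ((hasDerivAt_id x).const_mul (-2 : ℝ)).sub h1
      refine h2.congr_deriv ?_
      push_cast
      ring
    · have hxI : x ∈ Icc 0 T := ⟨hs.1.trans hx.1.le, hx.2.le.trans ht.2⟩
      have h3 := hafter x ⟨hx.1, hx.2.le⟩
      have h4 := hR x hxI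
      simp only [sub_neg] at h3
      have : 1 ≤ mean p * u x ^ 2 / R x := (one_le_div h4).2 h3.le
      have e : -2 - mean p * (2 * u x * -(u x / R x)) = 2 * (mean p * u x ^ 2 / R x - 1) := by ring
      rw [e]
      linarith
  have hge : ∀ t ∈ Icc 0 T, u t * kap p (u t) ≤ R t := by
    intro t ht
    have h3 := h.mass_le t ht
    rw [hW t ht] at h3
    have h4 := hsq t ht
    rcases le_total (u t) (G1 p (u t)) with hle | hle
    · rw [kap, max_eq_right hle]; linarith
    · rw [kap, max_eq_left hle]; linarith
  -- If R > u κ(u) at time t, go back to the last time s of equality. On (s, t) there are active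
  -- half-edges, so R' = -2 and R/u² is constant. Thus R_t/u_t² = κ(u_s)/u_s ≤ κ(u_t)/u_t because
  -- κ(v)/v is nonincreasing: a contradiction.
  have heq : ∀ t ∈ Icc 0 T, R t = u t * kap p (u t) := by
    intro t ht
    refine le_antisymm ?_ (hge t ht)
    by_contra hcon
    push Not at hcon
    have hsub : Icc 0 t ⊆ Icc 0 T := Icc_subset_Icc_right ht.2
    have hkc : ContinuousOn (fun x => u x * kap p (u x)) (Icc 0 t) :=
      huc.continuousOn.mul ((continuousOn_kap hp h1).comp huc.continuousOn
        fun x hx => huI x (hsub hx))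
    obtain ⟨s, hs, hs0, hafter⟩ := exists_last_zero (g := fun x => u x * kap p (u x) - R x) ht.1
      (hkc.sub (h.continuousOn_R.mono hsub))
      (by simp [h.R_zero, hu0, kap_one hp h1]) (by simpa using hcon)
    have hsI : s ∈ Icc 0 T := hsub ⟨hs.1, hs.2.le⟩
    have hconst := eq_of_hasDerivAt_zero (g := fun x => R x / u x ^ 2) hs.2.le ?_ ?_
    · have hut := (hu t ht).1
      have hus := (hu s hsI).1
      have hk := kap_mul_le hp h1 hut.le (huanti hs.2.le) (hu s hsI).2
      rw [div_eq_div_iff (by positivity) (by positivity),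
        show R s = u s * kap p (u s) by linarith] at hconst
      have h5 : R t * u s ^ 2 ≤ u t * kap p (u t) * u s ^ 2 := by
        rw [hconst]
        nlinarith [mul_le_mul_of_nonneg_left hk (mul_nonneg hus.le hut.le)]
      have h6 := le_of_mul_le_mul_right h5 (by positivity)
      linarith
    · refine ContinuousOn.div (h.continuousOn_R.mono fun x hx => hsub ⟨hs.1.trans hx.1, hx.2⟩)
        (by fun_prop) fun x hx => ?_
      exact (pow_pos (hu x (hsub ⟨hs.1.trans hx.1, hx.2⟩)).1 2).ne'
    · intro x hx
      have hxI : x ∈ Ioo 0 T := ⟨hs.1.trans_lt hx.1, hx.2.trans_le ht.2⟩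
      have hxI' := Ioo_subset_Icc_self hxI
      have hnhds : Icc 0 T ∈ 𝓝 x := Icc_mem_nhds hxI.1 hxI.2
      have hWR : sleepMass (z x) < R x := by
        have h3 := hafter x ⟨hx.1, hx.2.le⟩
        simp only [sub_neg] at h3
        refine lt_of_le_of_lt ?_ h3
        rw [hW x hxI']
        nlinarith [mul_le_mul_of_nonneg_left (mul_G1_le_kap hp h1 (u x)) (huI x hxI').1]
      have hRd : HasDerivAt R (-2) x := by
        have e1 : ∀ᶠ y in 𝓝 x, sleepMass (z x) < R y :=
          (h.continuousOn_R.continuousAt hnhds).eventually (lt_mem_nhds hWR)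
        have e2 : ∀ᶠ y in 𝓝 x, sleepMass (z y) < R x :=
          (hWc.continuousAt hnhds).eventually (gt_mem_nhds hWR)
        have e3 : ∀ᶠ y in 𝓝 x, R y = R x - 2 * (y - x) := by
          filter_upwards [e1, e2, hnhds] with y hy1 hy2 hy
          rcases le_total x y with hxy | hxy
          · exact h.drop x hxI' y hy hxy hy1
          · have := h.drop y hy x hxI' hxy hy2
            linarith
        have hd : HasDerivAt (fun y : ℝ => R x - 2 * (y - x)) (-2) x := by
          have := (((hasDerivAt_id x).sub_const x).const_mul (2 : ℝ)).const_sub (R x)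
          simpa using this
        exact hd.congr_of_eventuallyEq e3
      have hupos := (hu x hxI').1
      have hd := hRd.div ((hud x hxI).pow 2) (pow_pos hupos 2).ne'
      refine hd.congr_deriv ?_
      have := hR x hxI'
      simp only [Pi.pow_apply]
      field_simp
      push_cast
      ring
  have hPhi := eq_of_hasDerivAt_zero (g := fun x => Phi p (u x) - x) hT
    (((continuousOn_Phi hp h1).comp huc.continuousOn huI).sub continuousOn_id) (fun x hx => ?_)
  · simp only [hu0, Phi_one, sub_zero] at hPhi
    have := uLim_eq hp h1 hT (huI T hTI) (sub_eq_zero.1 hPhi)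
    rw [this]
    exact ⟨heq T hTI, fun k hk => hz T hTI k hk⟩
  · have hxI' := Ioo_subset_Icc_self hx
    have hΦ := hasDerivAt_Phi hp h1 (v := u x) ⟨(hu x hxI').1, hu1 x ⟨hx.1, hx.2.le⟩⟩
    have hd := (hΦ.comp x (hud x hx)).sub (hasDerivAt_id x)
    refine hd.congr_deriv ?_
    rw [heq x hxI']
    have := (hu x hxI').1
    have := kap_pos hp h1 this
    field_simp
    ring

/-- Fluid trajectories are unique. -/
theorem eq_limit (hp : IsDegreeDistribution p) (h1 : Summable fun k : ℕ => (k : ℝ) * p k)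
    (h : IsFluid p T z R) {t : ℝ} (ht : t ∈ Icc 0 T) :
    R t = uLim p t * kap p (uLim p t) ∧ ∀ k, 1 ≤ k → z t k = p k * uLim p t ^ k := by
  rcases (h.R_nonneg h1 ht).eq_or_lt with h0 | h0
  · have hu : uLim p t = 0 := by
      -- R vanishes at t, where `eq_of_pos` does not apply. If the candidate u(t) were positive, R
      -- would take the value c/2 > 0 at some earlier s, although R(s) = u κ(u) ≥ μ u(s)² ≥ c.
      by_contra hne
      have hupos : 0 < uLim p t := (uLim_mem hp h1 t).1.lt_of_ne (Ne.symm hne)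
      have hm := mean_pos hp h1
      set c := mean p * uLim p t ^ 2 with hc
      have hcpos : 0 < c := by positivity
      have hcle : c ≤ mean p := mul_le_of_le_one_right hm.le
        (pow_le_one₀ hupos.le (uLim_mem hp h1 t).2)
      obtain ⟨s, hs, hsc⟩ := intermediate_value_Icc' ht.1
        (h.continuousOn_R.mono (Icc_subset_Icc_right ht.2))
        (show c / 2 ∈ Icc (R t) (R 0) by rw [← h0, h.R_zero]; constructor <;> linarith)
      have hpos := ((h.mono (hs.2.trans ht.2)).eq_of_pos hp h1 hs.1 (by rw [hsc]; linarith)).1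
      have hanti := uLim_antitone hp h1 hs.2
      have hk := mul_le_kap hp h1 (uLim p s)
      have : c ≤ R s := by
        rw [hpos, hc]
        nlinarith [mul_le_mul_of_nonneg_left hk (hupos.le.trans hanti),
          mul_le_mul hanti hanti hupos.le (hupos.le.trans hanti)]
      linarith
    rw [hu, ← h0]
    refine ⟨by simp, fun k hk => ?_⟩
    have hle := h.mul_le_R h1 (k := k) ht
    rw [← h0] at hle
    have hk' : (0 : ℝ) < k := by exact_mod_cast hk
    have := h.nonneg k hk t ht
    rw [zero_pow (by omega), mul_zero]
    nlinarith
  · exact (h.mono ht.2).eq_of_pos hp h1 ht.1 h0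

end IsFluid


/-! ### The jump rates -/

section JumpRates

/-- `x₀⁺ + ∑ k x_k` as a real number. -/
noncomputable def totalMass (x : ℕ → ℝ) : ℝ := max (x 0) 0 + sleepMass x

theorem mul_nonneg_of_nonneg {x : ℕ → ℝ} (hx : ∀ k, 1 ≤ k → 0 ≤ x k) (k : ℕ) :
    0 ≤ (k : ℝ) * x k := by
  rcases Nat.eq_zero_or_pos k with rfl | hk
  · simp
  · exact mul_nonneg k.cast_nonneg (hx k hk)

theorem sleepMass_nonneg {x : ℕ → ℝ} (hx : ∀ k, 1 ≤ k → 0 ≤ x k) : 0 ≤ sleepMass x :=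
  tsum_nonneg (mul_nonneg_of_nonneg hx)

theorem totalMass_nonneg {x : ℕ → ℝ} (hx : ∀ k, 1 ≤ k → 0 ≤ x k) : 0 ≤ totalMass x :=
  add_nonneg (le_max_right _ _) (sleepMass_nonneg hx)

theorem r_eq_ofReal {x : ℕ → ℝ} (hx : ∀ k, 1 ≤ k → 0 ≤ x k)
    (hs : Summable fun k : ℕ => (k : ℝ) * x k) : r x = ENNReal.ofReal (totalMass x) := by
  rw [r, totalMass, ENNReal.ofReal_add (le_max_right _ _) (sleepMass_nonneg hx), sleepMass,
    ENNReal.ofReal_tsum_of_nonneg (mul_nonneg_of_nonneg hx) hs]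
  simp [ENNReal.ofReal_max]

/-- The convention that all rates vanish when the total mass is 0 agrees with division by zero, so
no case distinction remains once the mass is summable. -/
theorem rk_eq {x : ℕ → ℝ} (hx : ∀ k, 1 ≤ k → 0 ≤ x k)
    (hs : Summable fun k : ℕ => (k : ℝ) * x k) (k : ℕ) :
    rk k x = (if k = 0 then max (x 0) 0 else (k : ℝ) * x k) / totalMass x := by
  rw [rk, r_eq_ofReal hx hs]
  rcases (totalMass_nonneg hx).eq_or_lt with h | h
  · simp [← h]
  · rw [if_pos ⟨ENNReal.ofReal_pos.2 h, ENNReal.ofReal_lt_top⟩, ENNReal.toReal_ofReal h.le]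

theorem hasSum_numerators {x : ℕ → ℝ} (hs : Summable fun k : ℕ => (k : ℝ) * x k) :
    HasSum (fun k : ℕ => if k = 0 then max (x 0) 0 else (k : ℝ) * x k) (totalMass x) := by
  have h := (hasSum_ite_eq 0 (max (x 0) 0)).add hs.hasSum
  suffices e : (fun k : ℕ => if k = 0 then max (x 0) 0 else (k : ℝ) * x k) =
      fun k : ℕ => (if k = 0 then max (x 0) 0 else 0) + (k : ℝ) * x k by rwa [e]
  funext k
  rcases Nat.eq_zero_or_pos k with rfl | hk
  · simp
  · simp [hk.ne']

theorem rk_nonneg {x : ℕ → ℝ} (hx : ∀ k, 1 ≤ k → 0 ≤ x k)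
    (hs : Summable fun k : ℕ => (k : ℝ) * x k) (k : ℕ) : 0 ≤ rk k x := by
  rw [rk_eq hx hs]
  refine div_nonneg ?_ (totalMass_nonneg hx)
  split_ifs
  · exact le_max_right _ _
  · exact mul_nonneg_of_nonneg hx k

/-- Until exhaustion every tick of the clock is exactly one jump: this is what allows ψ to be
expressed by the half-edge mass and the busy time alone. -/
theorem hasSum_rk {x : ℕ → ℝ} (hx : ∀ k, 1 ≤ k → 0 ≤ x k)
    (hs : Summable fun k : ℕ => (k : ℝ) * x k) :
    HasSum (fun k => rk k x) (if 0 < totalMass x then 1 else 0) := by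
  have h := (hasSum_numerators hs).div_const (totalMass x)
  simp only [rk_eq hx hs]
  split_ifs with h0
  · rwa [div_self h0.ne'] at h
  · have : totalMass x = 0 := le_antisymm (not_lt.1 h0) (totalMass_nonneg hx)
    simp only [this, div_zero] at h ⊢
    exact h

theorem rk_le_one {x : ℕ → ℝ} (hx : ∀ k, 1 ≤ k → 0 ≤ x k)
    (hs : Summable fun k : ℕ => (k : ℝ) * x k) (k : ℕ) : rk k x ≤ 1 := by
  refine ((hasSum_rk hx hs).summable.le_tsum k fun j _ => rk_nonneg hx hs j).trans ?_
  rw [(hasSum_rk hx hs).tsum_eq]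
  split_ifs <;> norm_num

theorem measurable_rk {x : ℝ → ℕ → ℝ} (hx : ∀ k, Measurable fun s => x s k) (k : ℕ) :
    Measurable fun s => rk k (x s) := by
  have hr : Measurable fun s => r (x s) := by
    refine (hx 0).ennreal_ofReal.add (Measurable.tsum fun k => ?_)
    exact ((hx k).const_mul _).ennreal_ofReal
  refine Measurable.ite ((measurableSet_lt measurable_const hr).inter
    (measurableSet_lt hr measurable_const)) ?_ measurable_const
  refine Measurable.div ?_ hr.ennreal_toReal
  split_ifs
  · exact (hx 0).max measurable_const
  · exact (hx k).const_mul _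

end JumpRates

/-! ### Trajectories driven by the jump rates -/

/-- Trajectories with `ζ_k(t) = p_k - ∫₀ᵗ r_k(ζ(s)) ds`. -/
structure IsFlow (p : ℕ → ℝ) (T : ℝ) (x : ℝ → ℕ → ℝ) : Prop where
  meas : ∀ k, Measurable fun s => x s k
  nonneg : ∀ t ∈ Icc 0 T, ∀ k, 1 ≤ k → 0 ≤ x t k
  integral_eq : ∀ t ∈ Icc 0 T, ∀ k, 1 ≤ k → x t k = p k - ∫ s in (0 : ℝ)..t, rk k (x s)
  le_init : ∀ t ∈ Icc 0 T, ∀ k, 1 ≤ k → x t k ≤ p k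

namespace IsFlow

variable {p : ℕ → ℝ} {T : ℝ} {x : ℝ → ℕ → ℝ}

theorem summable (h : IsFlow p T x) (h1 : Summable fun k : ℕ => (k : ℝ) * p k) {t : ℝ}
    (ht : t ∈ Icc 0 T) : Summable fun k : ℕ => (k : ℝ) * x t k := by
  refine Summable.of_nonneg_of_le (mul_nonneg_of_nonneg (h.nonneg t ht)) (fun k => ?_) h1
  rcases Nat.eq_zero_or_pos k with rfl | hk
  · simp
  · exact mul_le_mul_of_nonneg_left (h.le_init t ht k hk) k.cast_nonneg

theorem abs_rk_le (h : IsFlow p T x) (h1 : Summable fun k : ℕ => (k : ℝ) * p k) {t : ℝ}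
    (ht : t ∈ Icc 0 T) (k : ℕ) : |rk k (x t)| ≤ 1 := by
  rw [abs_of_nonneg (rk_nonneg (h.nonneg t ht) (h.summable h1 ht) k)]
  exact rk_le_one (h.nonneg t ht) (h.summable h1 ht) k

theorem intervalIntegrable_rk (h : IsFlow p T x) (h1 : Summable fun k : ℕ => (k : ℝ) * p k)
    {s t : ℝ} (hs : s ∈ Icc 0 T) (ht : t ∈ Icc 0 T) (k : ℕ) :
    IntervalIntegrable (fun s => rk k (x s)) volume s t := by
  refine (intervalIntegrable_const (c := (1 : ℝ))).mono_fun
    (measurable_rk h.meas k).aestronglyMeasurable ?_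
  refine (ae_restrict_iff' measurableSet_uIoc).2 (ae_of_all _ fun y hy => ?_)
  simpa using h.abs_rk_le h1 (uIcc_subset_Icc hs ht (uIoc_subset_uIcc hy)) k

theorem sub_eq (h : IsFlow p T x) (h1 : Summable fun k : ℕ => (k : ℝ) * p k)
    {s t : ℝ} (hs : s ∈ Icc 0 T) (ht : t ∈ Icc 0 T) {k : ℕ} (hk : 1 ≤ k) :
    x s k - x t k = ∫ y in s..t, rk k (x y) := by
  have h0 : (0 : ℝ) ∈ Icc 0 T := ⟨le_rfl, hs.1.trans hs.2⟩
  rw [h.integral_eq s hs k hk, h.integral_eq t ht k hk,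
    ← intervalIntegral.integral_interval_sub_left (h.intervalIntegrable_rk h1 h0 ht k)
      (h.intervalIntegrable_rk h1 h0 hs k)]
  ring

theorem hasSum_integral (h : IsFlow p T x) (h1 : Summable fun k : ℕ => (k : ℝ) * p k)
    {s t : ℝ} (hs : s ∈ Icc 0 T) (ht : t ∈ Icc 0 T) :
    HasSum (fun k => ∫ y in s..t, rk k (x y))
      (∫ y in s..t, if 0 < totalMass (x y) then (1 : ℝ) else 0) := by
  have hmem : ∀ y, y ∈ uIoc s t → y ∈ Icc 0 T :=
    fun y hy => uIcc_subset_Icc hs ht (uIoc_subset_uIcc hy)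
  refine intervalIntegral.hasSum_integral_of_dominated_convergence
    (fun k y => rk k (x y)) (fun k => (measurable_rk h.meas k).aestronglyMeasurable) ?_ ?_ ?_ ?_
  · refine fun k => ae_of_all _ fun y hy => ?_
    rw [Real.norm_of_nonneg (rk_nonneg (h.nonneg y (hmem y hy)) (h.summable h1 (hmem y hy)) k)]
  · exact ae_of_all _ fun y hy =>
      (hasSum_rk (h.nonneg y (hmem y hy)) (h.summable h1 (hmem y hy))).summable
  · refine (intervalIntegrable_const (c := (1 : ℝ))).mono_fun
      (Measurable.tsum fun k => measurable_rk h.meas k).aestronglyMeasurable ?_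
    refine (ae_restrict_iff' measurableSet_uIoc).2 (ae_of_all _ fun y hy => ?_)
    simp only
    rw [(hasSum_rk (h.nonneg y (hmem y hy)) (h.summable h1 (hmem y hy))).tsum_eq]
    split_ifs <;> simp
  · exact ae_of_all _ fun y hy => hasSum_rk (h.nonneg y (hmem y hy)) (h.summable h1 (hmem y hy))

/-- The formula for `ψ`, rewritten by means of the number of half-edges used. -/
theorem psi_formula (h1 : Summable fun k : ℕ => (k : ℝ) * p k)
    (h : IsFlow p T x) {t : ℝ} (ht : t ∈ Icc 0 T) :
    -2 * (∫ s in (0 : ℝ)..t, rk 0 (x s)) +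
      ∑' j : ℕ, (((j + 1 : ℕ) : ℝ) - 2) * (p (j + 1) - x t (j + 1)) =
    mean p - sleepMass (x t) - 2 * ∫ s in (0 : ℝ)..t, if 0 < totalMass (x s) then (1 : ℝ) else 0 := by
  have h0 : (0 : ℝ) ∈ Icc 0 T := ⟨le_rfl, ht.1.trans ht.2⟩
  have hI := (hasSum_nat_add_iff' 1).2 (h.hasSum_integral h1 h0 ht)
  have hM := (hasSum_nat_add_iff' 1).2 (h1.hasSum.sub (h.summable h1 ht).hasSum)
  simp only [Finset.range_one, Finset.sum_singleton, CharP.cast_eq_zero, zero_mul, sub_zero] at hI hM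
  have hS := hM.sub (hI.mul_left 2)
  -- Subtracting twice the number p_k - x_k of jumps from the mass k (p_k - x_k) of half-edges
  -- produces the weights k - 2.
  have e : ∀ j : ℕ, (((j + 1 : ℕ) : ℝ) * p (j + 1) - ((j + 1 : ℕ) : ℝ) * x t (j + 1)) -
      2 * (∫ y in (0 : ℝ)..t, rk (j + 1) (x y)) =
      (((j + 1 : ℕ) : ℝ) - 2) * (p (j + 1) - x t (j + 1)) := by
    intro j
    rw [h.integral_eq t ht (j + 1) (by omega)]
    ring
  simp only [e] at hS
  rw [hS.tsum_eq]
  simp only [mean, sleepMass]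
  ring

end IsFlow

/-! ### The limit trajectory is a solution -/

section Limit

variable {p : ℕ → ℝ}

/-- The limit trajectory in terms of the time change. -/
noncomputable def zetaU (p : ℕ → ℝ) (t : ℝ) (k : ℕ) : ℝ :=
  if k = 0 then mean p * uLim p t * max (uLim p t - G1 p (uLim p t)) 0 else p k * uLim p t ^ k

theorem zetaLim_eq_zetaU (hp : IsDegreeDistribution p)
    (h2 : Summable fun k : ℕ => (k : ℝ) ^ 2 * p k) {t : ℝ} (ht : 0 ≤ t) :
    zetaLim p t = zetaU p t := by
  funext k
  obtain ⟨h0, hk⟩ := zetaLim_eq hp h2 ht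
  rcases Nat.eq_zero_or_pos k with rfl | hkpos
  · rw [h0]; simp [zetaU]
  · rw [hk k hkpos]; simp [zetaU, hkpos.ne']

theorem continuous_zetaU (hp : IsDegreeDistribution p)
    (h1 : Summable fun k : ℕ => (k : ℝ) * p k) : Continuous (zetaU p) := by
  have hu := continuous_uLim hp h1
  have hG : Continuous fun t => G1 p (uLim p t) := by
    rw [← continuousOn_univ]
    exact (continuousOn_G1 hp h1).comp hu.continuousOn fun t _ => uLim_mem hp h1 t
  refine continuous_pi fun k => ?_
  by_cases hk : k = 0
  · simp only [zetaU, hk, if_true]; fun_prop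
  · simp only [zetaU, hk, if_false]; fun_prop

theorem zetaU_nonneg (hp : IsDegreeDistribution p) (h1 : Summable fun k : ℕ => (k : ℝ) * p k)
    (t : ℝ) (k : ℕ) : 0 ≤ zetaU p t k := by
  have hu := (uLim_mem hp h1 t).1
  rw [zetaU]
  split_ifs
  · exact mul_nonneg (mul_nonneg (mean_pos hp h1).le hu) (le_max_right _ _)
  · exact mul_nonneg (hp.nonneg k) (pow_nonneg hu k)

theorem zetaU_le (hp : IsDegreeDistribution p) (h1 : Summable fun k : ℕ => (k : ℝ) * p k)
    (t : ℝ) {k : ℕ} (hk : 1 ≤ k) : zetaU p t k ≤ p k := by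
  have hu := uLim_mem hp h1 t
  rw [zetaU, if_neg (by omega)]
  exact mul_le_of_le_one_right (hp.nonneg k) (pow_le_one₀ hu.1 hu.2)

theorem sleepMass_zetaU (hp : IsDegreeDistribution p) (h1 : Summable fun k : ℕ => (k : ℝ) * p k)
    (t : ℝ) : sleepMass (zetaU p t) = mean p * uLim p t * G1 p (uLim p t) := by
  rw [← (hasSum_halfEdges hp h1 (uLim_mem hp h1 t)).tsum_eq]
  refine tsum_congr fun k => ?_
  rcases Nat.eq_zero_or_pos k with rfl | hk
  · simp
  · simp [zetaU, hk.ne']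

theorem summable_zetaU (hp : IsDegreeDistribution p) (h1 : Summable fun k : ℕ => (k : ℝ) * p k)
    (t : ℝ) : Summable fun k : ℕ => (k : ℝ) * zetaU p t k := by
  refine Summable.of_nonneg_of_le
    (fun k => mul_nonneg k.cast_nonneg (zetaU_nonneg hp h1 t k)) (fun k => ?_) h1
  rcases Nat.eq_zero_or_pos k with rfl | hk
  · simp
  · exact mul_le_mul_of_nonneg_left (zetaU_le hp h1 t hk) k.cast_nonneg

/-- This is max(u - G₁, 0) + G₁ = max(u, G₁): active plus sleeping half-edges. -/
theorem zetaU_zero_add (hp : IsDegreeDistribution p) (h1 : Summable fun k : ℕ => (k : ℝ) * p k)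
    (t : ℝ) : zetaU p t 0 + sleepMass (zetaU p t) = uLim p t * kap p (uLim p t) := by
  rw [sleepMass_zetaU hp h1, zetaU, if_pos rfl, kap]
  rcases le_total (uLim p t) (G1 p (uLim p t)) with h | h
  · rw [max_eq_right h, max_eq_right (by linarith)]; ring
  · rw [max_eq_left h, max_eq_left (by linarith)]; ring

theorem totalMass_zetaU (hp : IsDegreeDistribution p) (h1 : Summable fun k : ℕ => (k : ℝ) * p k)
    (t : ℝ) : totalMass (zetaU p t) = uLim p t * kap p (uLim p t) := by
  rw [totalMass, max_eq_left (zetaU_nonneg hp h1 t 0), zetaU_zero_add hp h1]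

theorem totalMass_zetaU_pos_iff (hp : IsDegreeDistribution p)
    (h1 : Summable fun k : ℕ => (k : ℝ) * p k) (t : ℝ) :
    0 < totalMass (zetaU p t) ↔ t < Phi p 0 := by
  rw [totalMass_zetaU hp h1]
  refine ⟨fun h => ?_, fun h => ?_⟩
  · by_contra hcon
    rw [uLim_eq_zero hp h1 (not_lt.1 hcon), zero_mul] at h
    exact lt_irrefl _ h
  · have := uLim_pos hp h1 h
    exact mul_pos this (kap_pos hp h1 this)

theorem rk_zetaU (hp : IsDegreeDistribution p) (h1 : Summable fun k : ℕ => (k : ℝ) * p k)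
    (t : ℝ) {k : ℕ} (hk : 1 ≤ k) :
    rk k (zetaU p t) = k * (p k * uLim p t ^ k) / (uLim p t * kap p (uLim p t)) := by
  rw [rk_eq (fun k _ => zetaU_nonneg hp h1 t k) (summable_zetaU hp h1 t), totalMass_zetaU hp h1,
    if_neg (by omega), zetaU, if_neg (by omega)]

/-- Since (u^k)' = -k u^(k-1)/κ(u). The extinction time is left out because u may have a corner, or
infinite slope, there; the fundamental theorem of calculus tolerates one exceptional point. -/
theorem hasDerivAt_zetaU (hp : IsDegreeDistribution p) (h1 : Summable fun k : ℕ => (k : ℝ) * p k)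
    {t : ℝ} (ht : 0 < t) (ht' : t ≠ Phi p 0) {k : ℕ} (hk : 1 ≤ k) :
    HasDerivAt (fun t => zetaU p t k) (-rk k (zetaU p t)) t := by
  have e : (fun t => zetaU p t k) = fun t => p k * uLim p t ^ k := by
    funext t; simp [zetaU, show k ≠ 0 by omega]
  rw [e, rk_zetaU hp h1 t hk]
  rcases lt_or_gt_of_ne ht' with hlt | hlt
  · have hu := uLim_pos hp h1 hlt
    have hkap := kap_pos hp h1 hu
    refine (((hasDerivAt_uLim hp h1 ⟨ht, hlt⟩).pow k).const_mul (p k)).congr_deriv ?_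
    obtain ⟨j, rfl⟩ : ∃ j, k = j + 1 := ⟨k - 1, by omega⟩
    rw [Nat.add_sub_cancel, pow_succ]
    field_simp
  · rw [uLim_eq_zero hp h1 hlt.le]
    simp only [zero_mul, div_zero, neg_zero]
    refine (hasDerivAt_const t (0 : ℝ)).congr_of_eventuallyEq ?_
    filter_upwards [lt_mem_nhds hlt] with y hy
    simp [uLim_eq_zero hp h1 (le_of_lt hy), show k ≠ 0 by omega]

theorem isFlow_zetaU (hp : IsDegreeDistribution p) (h1 : Summable fun k : ℕ => (k : ℝ) * p k)
    (T : ℝ) : IsFlow p T (zetaU p) := by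
  have hmeas : ∀ k, Measurable fun s => zetaU p s k := fun k =>
    ((continuous_apply k).comp (continuous_zetaU hp h1)).measurable
  refine ⟨hmeas, fun t _ k _ => zetaU_nonneg hp h1 t k, fun t ht k hk => ?_,
    fun t _ k hk => zetaU_le hp h1 t hk⟩
  have hint : IntervalIntegrable (fun s => -rk k (zetaU p s)) volume 0 t := by
    refine (intervalIntegrable_const (c := (1 : ℝ))).mono_fun
      (measurable_rk hmeas k).neg.aestronglyMeasurable (ae_of_all _ fun y => ?_)
    have h3 := rk_nonneg (fun k _ => zetaU_nonneg hp h1 y k) (summable_zetaU hp h1 y) k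
    have h4 := rk_le_one (fun k _ => zetaU_nonneg hp h1 y k) (summable_zetaU hp h1 y) k
    simp only [norm_neg, Real.norm_eq_abs, abs_of_nonneg h3]
    simpa using h4
  have := integral_eq_of_hasDerivAt_off_countable_of_le (fun t => zetaU p t k)
    (fun s => -rk k (zetaU p s)) ht.1 (countable_singleton (Phi p 0))
    ((continuous_apply k).comp (continuous_zetaU hp h1)).continuousOn
    (fun y hy => hasDerivAt_zetaU hp h1 hy.1.1 (by simpa using hy.2) hk) hint
  rw [intervalIntegral.integral_neg] at this
  have h0 : zetaU p 0 k = p k := by simp [zetaU, uLim_zero hp h1, show k ≠ 0 by omega]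
  rw [h0] at this
  linarith

theorem integral_busy (hp : IsDegreeDistribution p) (h1 : Summable fun k : ℕ => (k : ℝ) * p k)
    {t : ℝ} (ht : 0 ≤ t) :
    ∫ s in (0 : ℝ)..t, (if 0 < totalMass (zetaU p s) then (1 : ℝ) else 0) = min t (Phi p 0) := by
  simp only [totalMass_zetaU_pos_iff hp h1]
  have hmeas : Measurable fun s : ℝ => if s < Phi p 0 then (1 : ℝ) else 0 :=
    Measurable.ite measurableSet_Iio measurable_const measurable_const
  have := integral_eq_of_hasDerivAt_off_countable_of_le (fun t => min t (Phi p 0))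
    (fun s => if s < Phi p 0 then (1 : ℝ) else 0) ht (countable_singleton (Phi p 0))
    (by fun_prop) (fun y hy => ?_) ?_
  · rw [this, min_eq_left (Phi_zero_pos hp h1).le, sub_zero]
  · have hne : y ≠ Phi p 0 := by simpa using hy.2
    rcases lt_or_gt_of_ne hne with hlt | hlt
    · rw [if_pos hlt]
      refine (hasDerivAt_id y).congr_of_eventuallyEq ?_
      filter_upwards [gt_mem_nhds hlt] with x hx
      exact min_eq_left (le_of_lt hx)
    · rw [if_neg (not_lt.2 hlt.le)]
      refine (hasDerivAt_const y (Phi p 0)).congr_of_eventuallyEq ?_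
      filter_upwards [lt_mem_nhds hlt] with x hx
      exact min_eq_right (le_of_lt hx)
  · refine (intervalIntegrable_const (c := (1 : ℝ))).mono_fun hmeas.aestronglyMeasurable
      (ae_of_all _ fun y => ?_)
    simp only
    split_ifs <;> simp

theorem psiLim_eq_integral (hp : IsDegreeDistribution p)
    (h2 : Summable fun k : ℕ => (k : ℝ) ^ 2 * p k) {t : ℝ} (ht : 0 ≤ t) :
    psiLim p t = -2 * (∫ s in (0 : ℝ)..t, rk 0 (zetaU p s)) +
      ∑' j : ℕ, (((j + 1 : ℕ) : ℝ) - 2) * (p (j + 1) - zetaU p t (j + 1)) := by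
  rw [psiLim, zetaLim_eq_zetaU hp h2 ht]
  congr 2
  refine intervalIntegral.integral_congr fun s hs => ?_
  rw [uIcc_of_le ht] at hs
  simp only [zetaLim_eq_zetaU hp h2 hs.1]

theorem psiLim_eq (hp : IsDegreeDistribution p)
    (h2 : Summable fun k : ℕ => (k : ℝ) ^ 2 * p k) {t : ℝ} (ht : 0 ≤ t) :
    psiLim p t = mean p - sleepMass (zetaU p t) - 2 * min t (Phi p 0) := by
  have h1 := summable_first_moment hp h2
  rw [psiLim_eq_integral hp h2 ht, (isFlow_zetaU hp h1 t).psi_formula h1 ⟨ht, le_rfl⟩,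
    integral_busy hp h1 ht]

/-- All jump rates of the limit are bounded by a multiple of `k p_k`. -/
theorem exists_rk_le (hp : IsDegreeDistribution p) (h1 : Summable fun k : ℕ => (k : ℝ) * p k) :
    ∃ C : ℝ, ∀ t k, 1 ≤ k → rk k (zetaU p t) ≤ C * (k * p k) := by
  have hex : ∃ k, p k ≠ 0 := by
    by_contra! h
    have := hp.hasSum.tsum_eq
    simp [h] at this
  classical
  -- With m the least degree in the support, the denominator u κ(u) dominates m p_m u^m, hence m p_m
  -- u^k for every k ≥ m. The bound therefore survives u → 0.
  set m := Nat.find hex with hm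
  have hpm : 0 < p m := (hp.nonneg m).lt_of_ne (Nat.find_spec hex).symm
  have hm1 : 1 ≤ m := by
    rw [Nat.one_le_iff_ne_zero]
    intro h0
    rw [h0, hp.zero] at hpm
    exact lt_irrefl _ hpm
  have hmpos : (0 : ℝ) < m := by exact_mod_cast hm1
  refine ⟨(m * p m)⁻¹, fun t k hk => ?_⟩
  have hu := uLim_mem hp h1 t
  by_cases hkm : k < m
  · have : p k = 0 := by
      by_contra h
      exact Nat.find_min hex hkm h
    rw [rk_zetaU hp h1 t hk, this]
    simp
  rw [rk_zetaU hp h1 t hk]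
  rcases hu.1.eq_or_lt with h0 | h0
  · rw [← h0]
    simp only [zero_mul, div_zero]
    have := hp.nonneg k
    positivity
  have hge : m * (p m * uLim p t ^ m) ≤ uLim p t * kap p (uLim p t) := by
    have h3 : (m : ℝ) * (p m * uLim p t ^ m) ≤ mean p * uLim p t * G1 p (uLim p t) := by
      have h4 := hasSum_halfEdges hp h1 hu
      refine le_hasSum h4 m fun j _ => ?_
      have := hp.nonneg j
      have := hu.1
      positivity
    have := mul_le_mul_of_nonneg_left (mul_G1_le_kap hp h1 (uLim p t)) hu.1
    linarith
  rw [div_le_iff₀ (mul_pos h0 (kap_pos hp h1 h0))]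
  have hpow : uLim p t ^ k ≤ uLim p t ^ m := pow_le_pow_of_le_one hu.1 hu.2 (not_lt.1 hkm)
  have hkp : 0 ≤ (k : ℝ) * p k := mul_nonneg k.cast_nonneg (hp.nonneg k)
  calc (k : ℝ) * (p k * uLim p t ^ k) = (k * p k) * uLim p t ^ k := by ring
    _ ≤ (k * p k) * uLim p t ^ m := mul_le_mul_of_nonneg_left hpow hkp
    _ = (m * p m)⁻¹ * (k * p k) * (m * (p m * uLim p t ^ m)) := by field_simp
    _ ≤ _ := mul_le_mul_of_nonneg_left hge (by positivity)

/-! ### Regularity of the limit trajectory and the Skorokhod problem -/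

theorem zetaU_sub_le (hp : IsDegreeDistribution p) (h1 : Summable fun k : ℕ => (k : ℝ) * p k)
    {C : ℝ} (hC : ∀ t k, 1 ≤ k → rk k (zetaU p t) ≤ C * (k * p k)) {s t : ℝ} (hs : 0 ≤ s)
    (hst : s ≤ t) {k : ℕ} (hk : 1 ≤ k) :
    zetaU p s k - zetaU p t k ≤ C * (k * p k) * (t - s) := by
  have hflow := isFlow_zetaU hp h1 t
  have hsI : s ∈ Icc 0 t := ⟨hs, hst⟩
  have htI : t ∈ Icc 0 t := ⟨hs.trans hst, le_rfl⟩
  rw [hflow.sub_eq h1 hsI htI hk]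
  have := intervalIntegral.integral_mono_on hst (hflow.intervalIntegrable_rk h1 hsI htI k)
    (intervalIntegrable_const (c := C * (k * p k))) fun y _ => hC y k hk
  rw [intervalIntegral.integral_const, smul_eq_mul] at this
  linarith

theorem zetaU_antitone (hp : IsDegreeDistribution p) (h1 : Summable fun k : ℕ => (k : ℝ) * p k)
    {k : ℕ} (hk : 1 ≤ k) : Antitone fun t => zetaU p t k := by
  intro s t hst
  simp only [zetaU, if_neg (show k ≠ 0 by omega)]
  exact mul_le_mul_of_nonneg_left (pow_le_pow_left₀ (uLim_mem hp h1 t).1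
    (uLim_antitone hp h1 hst) k) (hp.nonneg k)

theorem sleepMass_zetaU_antitone (hp : IsDegreeDistribution p)
    (h1 : Summable fun k : ℕ => (k : ℝ) * p k) : Antitone fun t => sleepMass (zetaU p t) := by
  intro s t hst
  refine (summable_zetaU hp h1 t).tsum_le_tsum (fun k => ?_) (summable_zetaU hp h1 s)
  rcases Nat.eq_zero_or_pos k with rfl | hk
  · simp
  · exact mul_le_mul_of_nonneg_left (zetaU_antitone hp h1 hk hst) k.cast_nonneg

/-- The second moment enters here: each ζ_k is Lipschitz with constant C k p_k, so the sleeping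
half-edge mass is Lipschitz with constant C ∑ k² p_k. -/
theorem exists_lipschitz_psiLim (hp : IsDegreeDistribution p)
    (h2 : Summable fun k : ℕ => (k : ℝ) ^ 2 * p k) (T : ℝ) :
    ∃ K, LipschitzOnWith K (psiLim p) (Icc 0 T) := by
  have h1 := summable_first_moment hp h2
  obtain ⟨C, hC⟩ := exists_rk_le hp h1
  have hmass : LipschitzOnWith (C * ∑' k : ℕ, (k : ℝ) ^ 2 * p k).toNNReal
      (fun t => sleepMass (zetaU p t)) (Icc 0 T) := by
    refine lipschitzOnWith_of_antitone ((sleepMass_zetaU_antitone hp h1).antitoneOn _)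
      fun s hs t _ hst => ?_
    have h3 := (summable_zetaU hp h1 s).hasSum.sub (summable_zetaU hp h1 t).hasSum
    have h4 := (h2.hasSum.mul_left C).mul_right (t - s)
    refine hasSum_le (fun k => ?_) h3 h4
    rcases Nat.eq_zero_or_pos k with rfl | hk
    · simp
    · have := mul_le_mul_of_nonneg_left (zetaU_sub_le hp h1 hC hs.1 hst hk)
        (k.cast_nonneg : (0 : ℝ) ≤ k)
      calc _ = (k : ℝ) * (zetaU p s k - zetaU p t k) := by ring
        _ ≤ _ := this
        _ = _ := by ring
  have hmin : LipschitzOnWith 2 (fun t : ℝ => 2 * min t (Phi p 0)) (Icc 0 T) := by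
    refine LipschitzOnWith.of_dist_le_mul fun s _ t _ => ?_
    rw [Real.dist_eq, Real.dist_eq, ← mul_sub, abs_mul]
    have := abs_min_sub_min_le_max s (Phi p 0) t (Phi p 0)
    simp only [sub_self, abs_zero] at this
    rw [max_eq_left (abs_nonneg _)] at this
    simpa using this
  have hconst : LipschitzOnWith 0 (fun _ : ℝ => mean p) (Icc 0 T) :=
    (LipschitzWith.const _).lipschitzOnWith
  obtain ⟨K, hK⟩ : ∃ K, LipschitzOnWith K
      (fun t => mean p - sleepMass (zetaU p t) - 2 * min t (Phi p 0)) (Icc 0 T) :=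
    ⟨_, (hconst.sub hmass).sub hmin⟩
  refine ⟨K, fun s hs t ht => ?_⟩
  rw [psiLim_eq hp h2 hs.1, psiLim_eq hp h2 ht.1]
  exact hK hs ht

/-- A solution of the Skorokhod problem is given by the Skorokhod map. -/
theorem eq_skorokhodMap {ψ a η : ℝ → ℝ} {t : ℝ} (ht : 0 ≤ t)
    (ha : ∀ s ∈ Icc 0 t, 0 ≤ a s ∧ a s = ψ s + η s) (hη : ∀ s ∈ Icc 0 t, η s ≤ η t)
    (hη0 : 0 ≤ η t) (hflat : η t = 0 ∨ a t = 0) : a t = skorokhodMap ψ t := by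
  have htI : t ∈ Icc 0 t := ⟨ht, le_rfl⟩
  -- The running infimum is attained at time t itself, since η is largest there and either vanishes
  -- or leaves the reflected path at 0.
  have hmin : min (ψ t) 0 = -η t := by
    have := (ha t htI).2
    rcases hflat with h | h
    · rw [min_eq_right (by linarith [(ha t htI).1]), h, neg_zero]
    · rw [min_eq_left (by linarith)]; linarith
  have hleast : IsLeast ((fun s => min (ψ s) 0) '' Icc 0 t) (-η t) := by
    refine ⟨⟨t, htI, hmin⟩, ?_⟩
    rintro _ ⟨s, hs, rfl⟩
    have := ha s hs
    exact le_min (by linarith [hη s hs]) (by linarith)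
  rw [skorokhodMap, hleast.csInf_eq]
  linarith [(ha t htI).2]

/-- `u κ(u) + 2 Φ(u)` is nonincreasing in `u`. -/
theorem mul_kap_add_Phi_le (hp : IsDegreeDistribution p)
    (h1 : Summable fun k : ℕ => (k : ℝ) * p k) {w v : ℝ} (hw : 0 ≤ w) (hwv : w ≤ v) (hv : v ≤ 1) :
    v * kap p v + 2 * Phi p v ≤ w * kap p w + 2 * Phi p w := by
  rcases (hw.trans hwv).eq_or_lt with h0 | h0
  · obtain rfl : w = v := by linarith
    rfl
  have h3 := sq_sub_sq_le_Phi hp h1 hw hwv hv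
  have h4 := mul_le_mul_of_nonneg_left (kap_mul_le hp h1 hw hwv hv) hw
  have : v * (v * kap p v + 2 * Phi p v) ≤ v * (w * kap p w + 2 * Phi p w) := by nlinarith
  exact le_of_mul_le_mul_left this h0

/-- The regulator is η = u κ(u) - μ + 2Φ(u), obtained by solving ζ₀ = ψ + η. It is nondecreasing in
time because u decreases and `mul_kap_add_Phi_le` holds. -/
theorem zetaU_zero_eq_skorokhodMap (hp : IsDegreeDistribution p)
    (h2 : Summable fun k : ℕ => (k : ℝ) ^ 2 * p k) {t : ℝ} (ht : 0 ≤ t) :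
    zetaU p t 0 = skorokhodMap (psiLim p) t := by
  have h1 := summable_first_moment hp h2
  have hm := mean_pos hp h1
  have hΦ : ∀ s, 0 ≤ s → min s (Phi p 0) = Phi p (uLim p s) := fun s hs => by
    rw [Phi_uLim hp h1, max_eq_left hs]
  have hmono : ∀ s ∈ Icc 0 t, uLim p s * kap p (uLim p s) - mean p + 2 * Phi p (uLim p s) ≤
      uLim p t * kap p (uLim p t) - mean p + 2 * Phi p (uLim p t) := by
    intro s hs
    have := mul_kap_add_Phi_le hp h1 (uLim_mem hp h1 t).1 (uLim_antitone hp h1 hs.2)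
      (uLim_mem hp h1 s).2
    linarith
  refine eq_skorokhodMap (a := fun t => zetaU p t 0)
    (η := fun t => uLim p t * kap p (uLim p t) - mean p + 2 * Phi p (uLim p t)) ht
    (fun s hs => ⟨zetaU_nonneg hp h1 s 0, ?_⟩) hmono ?_ ?_
  · rw [psiLim_eq hp h2 hs.1, hΦ s hs.1]
    linarith [zetaU_zero_add hp h1 s]
  · have := hmono 0 ⟨le_rfl, ht⟩
    rw [uLim_zero hp h1, kap_one hp h1, Phi_one] at this
    linarith
  · by_cases hle : uLim p t ≤ G1 p (uLim p t)
    · right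
      simp [zetaU, max_eq_right (sub_nonpos.2 hle)]
    · left
      push Not at hle
      have hu := uLim_mem hp h1 t
      have hpos : 0 < uLim p t := (G1_nonneg hp h1 hu.1).trans_lt hle
      have hk : kap p (uLim p t) = mean p * uLim p t := by rw [kap, max_eq_left hle.le]
      -- As κ(v)/v is nonincreasing and already equals its minimum μ at u, the active regime has
      -- lasted since time 0; Φ is then explicit and η vanishes.
      have hG : ∀ v ∈ Icc (uLim p t) 1, G1 p v ≤ v := by
        intro v hv
        have h3 := kap_mul_le hp h1 hu.1 hv.1 hv.2
        rw [hk] at h3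
        have h4 := mul_le_mul_of_nonneg_right (mul_G1_le_kap hp h1 v) hu.1
        have h5 : (mean p * uLim p t) * G1 p v ≤ (mean p * uLim p t) * v := by linarith
        exact le_of_mul_le_mul_left h5 (mul_pos hm hpos)
      rw [hk, Phi_of_ge hG ⟨le_rfl, hu.2⟩]
      ring

end Limit


/-! ### Zeros of the rate function -/

section Cost

/-- Write x = y² and use log y ≥ 1 - 1/y. -/
theorem sq_sqrt_sub_one_le_ell {x : ℝ} (hx : 0 ≤ x) : (√x - 1) ^ 2 ≤ ell x := by
  rcases hx.eq_or_lt with rfl | hpos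
  · simp [ell]
  set y := √x with hy
  have hy0 : 0 < y := Real.sqrt_pos.2 hpos
  have hxy : x = y ^ 2 := (Real.sq_sqrt hx).symm
  have hlog : 1 - y⁻¹ ≤ Real.log y := Real.one_sub_inv_le_log_of_pos hy0
  rw [ell, hxy, Real.log_pow]
  have h3 : y ^ 2 * (1 - y⁻¹) ≤ y ^ 2 * Real.log y := mul_le_mul_of_nonneg_left hlog (sq_nonneg y)
  have h4 : y ^ 2 * (1 - y⁻¹) = y ^ 2 - y := by field_simp
  push_cast
  nlinarith

theorem ell_nonneg {x : ℝ} (hx : 0 ≤ x) : 0 ≤ ell x :=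
  (sq_nonneg _).trans (sq_sqrt_sub_one_le_ell hx)

/-- With s = |√x - 1| one has |x - 1| ≤ s² + 2s and 2s ≤ δ + s²/δ. As ℓ is only quadratic near 1, a
free δ is the price for a bound linear in ℓ, which can be integrated. -/
theorem abs_sub_one_le_ell {x δ : ℝ} (hx : 0 ≤ x) (hδ : 0 < δ) :
    |x - 1| ≤ δ + (1 + 1 / δ) * ell x := by
  have h := sq_sqrt_sub_one_le_ell hx
  set s := |√x - 1| with hs
  have hs0 : 0 ≤ s := abs_nonneg _
  have hs2 : s ^ 2 ≤ ell x := by rwa [hs, sq_abs]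
  have h1 : |x - 1| ≤ s ^ 2 + 2 * s := by
    have e : x - 1 = (√x - 1) * (√x - 1 + 2) := by
      have := Real.mul_self_sqrt hx
      nlinarith
    rw [e, abs_mul]
    have := abs_add_le (√x - 1) 2
    rw [abs_two] at this
    nlinarith
  have h2 : 2 * s ≤ δ + s ^ 2 / δ := by
    have : 0 ≤ (s - δ) ^ 2 / δ := div_nonneg (sq_nonneg _) hδ.le
    have e : (s - δ) ^ 2 / δ = s ^ 2 / δ - 2 * s + δ := by field_simp; ring
    linarith
  have h3 : s ^ 2 / δ ≤ 1 / δ * ell x := by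
    rw [div_eq_inv_mul, one_div]
    exact mul_le_mul_of_nonneg_left hs2 (inv_nonneg.2 hδ.le)
  linarith

theorem integral_lt_indicator {c : ℝ} (h0 : 0 ≤ c) (h1 : c ≤ 1) :
    ∫ y in Icc (0 : ℝ) 1, (if y < c then (1 : ℝ) else 0) = c := by
  have e : (fun y : ℝ => if y < c then (1 : ℝ) else 0) = (Iio c).indicator fun _ => 1 := by
    funext y; simp [indicator]
  rw [e, setIntegral_indicator measurableSet_Iio]
  have : Icc (0 : ℝ) 1 ∩ Iio c = Ico 0 c := by
    ext y
    simp only [mem_inter_iff, mem_Icc, mem_Iio, mem_Ico]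
    constructor
    · rintro ⟨⟨h, -⟩, h'⟩; exact ⟨h, h'⟩
    · rintro ⟨h, h'⟩; exact ⟨⟨h, h'.le.trans h1⟩, h'⟩
  rw [this]
  simp [h0]

theorem measurable_lt_indicator {g : ℝ → ℝ} (hg : Measurable g) :
    Measurable fun z : ℝ × ℝ => if z.2 < g z.1 then (1 : ℝ) else 0 :=
  Measurable.ite (measurableSet_lt measurable_snd (hg.comp measurable_fst)) measurable_const
    measurable_const

theorem volume_box_lt_top (t : ℝ) : volume (Icc (0 : ℝ) t ×ˢ Icc (0 : ℝ) 1) < ∞ := by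
  rw [Measure.volume_eq_prod, Measure.prod_prod]
  exact ENNReal.mul_lt_top measure_Icc_lt_top measure_Icc_lt_top

theorem integrableOn_lt_indicator {g : ℝ → ℝ} (hg : Measurable g) (t : ℝ) :
    IntegrableOn (fun z : ℝ × ℝ => if z.2 < g z.1 then (1 : ℝ) else 0)
      (Icc (0 : ℝ) t ×ˢ Icc (0 : ℝ) 1) := by
  refine Measure.integrableOn_of_bounded (M := 1) (volume_box_lt_top t).ne
    (measurable_lt_indicator hg).aestronglyMeasurable (ae_of_all _ fun z => ?_)
  split_ifs <;> simp

/-- This is the jump mass of the control φ ≡ 1, which costs nothing. -/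
theorem integral_box_indicator {g : ℝ → ℝ} (hg : Measurable g) {t : ℝ} (ht : 0 ≤ t)
    (h01 : ∀ s ∈ Icc 0 t, g s ∈ Icc (0 : ℝ) 1) :
    ∫ z in Icc (0 : ℝ) t ×ˢ Icc (0 : ℝ) 1, (if z.2 < g z.1 then (1 : ℝ) else 0) =
      ∫ s in (0 : ℝ)..t, g s := by
  have hint := integrableOn_lt_indicator hg t
  rw [Measure.volume_eq_prod] at hint ⊢
  rw [setIntegral_prod _ hint, intervalIntegral.integral_of_le ht, ← integral_Icc_eq_integral_Ioc]
  refine setIntegral_congr_fun measurableSet_Icc fun s hs => ?_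
  exact integral_lt_indicator (h01 s hs).1 (h01 s hs).2

variable {p : ℕ → ℝ} {T : ℝ≥0}

/-- Integrating `abs_sub_one_le_ell` over the box, whose area is T, bounds the L¹ distance between
φ_k and 1 by the cost. -/
theorem abs_jumpMass_sub_le {P : PathSpace T} {φ : ℕ → ℝ × ℝ → ℝ≥0} {k : ℕ}
    (hφ : Measurable (φ k))
    (hint : IntegrableOn (jumpRate P φ k) (Icc (0 : ℝ) T ×ˢ Icc (0 : ℝ) 1))
    (hmeas : Measurable fun s => rk k (P.zeta s))
    (h01 : ∀ s ∈ Icc (0 : ℝ) T, rk k (P.zeta s) ∈ Icc (0 : ℝ) 1) {c δ : ℝ} (hc : 0 ≤ c)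
    (hδ : 0 < δ) (hcost : controlCost T φ ≤ ENNReal.ofReal c) {t : ℝ} (ht : t ∈ Icc (0 : ℝ) T) :
    |jumpMass P φ k t - ∫ s in (0 : ℝ)..t, rk k (P.zeta s)| ≤ δ * T + (1 + 1 / δ) * c := by
  have hsub : Icc (0 : ℝ) t ×ˢ Icc (0 : ℝ) 1 ⊆ Icc (0 : ℝ) T ×ˢ Icc (0 : ℝ) 1 :=
    prod_mono (Icc_subset_Icc_right ht.2) le_rfl
  rw [← integral_box_indicator hmeas ht.1 fun s hs => h01 s ⟨hs.1, hs.2.trans ht.2⟩, jumpMass,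
    ← integral_sub (hint.mono_set hsub) (integrableOn_lt_indicator hmeas t), ← Real.norm_eq_abs]
  have hCpos : 0 ≤ δ * T + (1 + 1 / δ) * c := by positivity
  refine (norm_integral_le_lintegral_norm _).trans (ENNReal.toReal_le_of_le_ofReal hCpos ?_)
  have hcostk : ∫⁻ z in Icc (0 : ℝ) T ×ˢ Icc (0 : ℝ) 1, ENNReal.ofReal (ell (φ k z)) ≤
      ENNReal.ofReal c := (ENNReal.le_tsum k).trans hcost
  have hell : Measurable fun z => ENNReal.ofReal (ell (φ k z)) := by
    have hr : Measurable fun z => (φ k z : ℝ) := hφ.coe_nnreal_real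
    exact (((hr.mul (Real.measurable_log.comp hr)).sub hr).add_const 1).ennreal_ofReal
  calc ∫⁻ z in Icc (0 : ℝ) t ×ˢ Icc (0 : ℝ) 1, ENNReal.ofReal
        ‖jumpRate P φ k z - if z.2 < rk k (P.zeta z.1) then (1 : ℝ) else 0‖
      ≤ ∫⁻ z in Icc (0 : ℝ) T ×ˢ Icc (0 : ℝ) 1, ENNReal.ofReal
        ‖jumpRate P φ k z - if z.2 < rk k (P.zeta z.1) then (1 : ℝ) else 0‖ :=
        lintegral_mono_set hsub
    _ ≤ ∫⁻ z in Icc (0 : ℝ) T ×ˢ Icc (0 : ℝ) 1,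
        (ENNReal.ofReal δ + ENNReal.ofReal (1 + 1 / δ) * ENNReal.ofReal (ell (φ k z))) := by
        refine lintegral_mono fun z => ?_
        have he := ell_nonneg (φ k z).2
        rw [← ENNReal.ofReal_mul (by positivity), ← ENNReal.ofReal_add hδ.le (by positivity)]
        refine ENNReal.ofReal_le_ofReal ?_
        rw [jumpRate, Real.norm_eq_abs]
        split_ifs
        · exact abs_sub_one_le_ell (φ k z).2 hδ
        · rw [sub_self, abs_zero]; positivity
    _ = ENNReal.ofReal δ * volume (Icc (0 : ℝ) T ×ˢ Icc (0 : ℝ) 1) + ENNReal.ofReal (1 + 1 / δ) *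
        ∫⁻ z in Icc (0 : ℝ) T ×ˢ Icc (0 : ℝ) 1, ENNReal.ofReal (ell (φ k z)) := by
        rw [lintegral_add_left measurable_const, lintegral_const_mul _ hell, lintegral_const,
          Measure.restrict_apply_univ]
    _ ≤ ENNReal.ofReal δ * ENNReal.ofReal T + ENNReal.ofReal (1 + 1 / δ) * ENNReal.ofReal c := by
        gcongr
        rw [Measure.volume_eq_prod, Measure.prod_prod]
        simp
    _ = ENNReal.ofReal (δ * T + (1 + 1 / δ) * c) := by
        rw [← ENNReal.ofReal_mul hδ.le, ← ENNReal.ofReal_mul (by positivity),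
          ← ENNReal.ofReal_add (by positivity) (by positivity)]

theorem continuous_zeta {Q : PathSpace T} (h : Continuous Q.1.toFun) : Continuous Q.zeta :=
  h.Icc_extend'

theorem measurable_zeta {Q : PathSpace T} (h : Continuous Q.1.toFun) (k : ℕ) :
    Measurable fun s => Q.zeta s k :=
  ((continuous_apply k).comp (continuous_zeta h)).measurable

theorem IsAdmissible.le_init {Q : PathSpace T} (h : IsAdmissible p Q) {t : ℝ}
    (ht : t ∈ Icc (0 : ℝ) T) {k : ℕ} (hk : 1 ≤ k) : Q.zeta t k ≤ p k := by
  rw [← h.init k hk]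
  exact h.anti k hk ⟨le_rfl, T.2⟩ ht ht.1

theorem IsAdmissible.summable {Q : PathSpace T} (h : IsAdmissible p Q)
    (h1 : Summable fun k : ℕ => (k : ℝ) * p k) {t : ℝ} (ht : t ∈ Icc (0 : ℝ) T) :
    Summable fun k : ℕ => (k : ℝ) * Q.zeta t k := by
  refine Summable.of_nonneg_of_le (mul_nonneg_of_nonneg fun k hk => h.nonneg k hk t ht)
    (fun k => ?_) h1
  rcases Nat.eq_zero_or_pos k with rfl | hk
  · simp
  · exact mul_le_mul_of_nonneg_left (h.le_init ht hk) k.cast_nonneg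

theorem IsAdmissible.rk_mem {Q : PathSpace T} (h : IsAdmissible p Q)
    (h1 : Summable fun k : ℕ => (k : ℝ) * p k) {t : ℝ} (ht : t ∈ Icc (0 : ℝ) T) (k : ℕ) :
    rk k (Q.zeta t) ∈ Icc (0 : ℝ) 1 :=
  ⟨rk_nonneg (fun k hk => h.nonneg k hk t ht) (h.summable h1 ht) k,
    rk_le_one (fun k hk => h.nonneg k hk t ht) (h.summable h1 ht) k⟩

/-- A quantity which is at distance at most `δ T + (1 + 1/δ) c` from `b` for all `δ, c > 0`
equals `b`. -/
theorem eq_of_forall_cost {a b τ : ℝ} (hτ : 0 ≤ τ)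
    (h : ∀ δ > 0, ∀ c > 0, |a - b| ≤ δ * τ + (1 + 1 / δ) * c) : a = b := by
  refine eq_of_forall_dist_le fun ε hε => ?_
  rw [Real.dist_eq]
  set δ := ε / (2 * (τ + 1)) with hδ
  have hδpos : 0 < δ := by positivity
  have hc : 0 < ε / (2 * (1 + 1 / δ)) := by positivity
  refine (h δ hδpos _ hc).trans ?_
  have e1 : (1 + 1 / δ) * (ε / (2 * (1 + 1 / δ))) = ε / 2 := by
    have : (1 + 1 / δ) ≠ 0 := by positivity
    field_simp
  have e2 : δ * (τ + 1) = ε / 2 := by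
    rw [hδ]; field_simp
  nlinarith

/-- An infimum equal to 0 yields controls of arbitrarily small cost, whose jump masses are close to
∫ r_k. But these masses are determined by (ζ, ψ) alone: p_k - ζ_k for k ≥ 1, and for k = 0 what
remains of the equation for ψ. So the approximation is an equality. -/
theorem rateFunction_eq_zero {Q : PathSpace T} (h1 : Summable fun k : ℕ => (k : ℝ) * p k)
    (h0 : rateFunction p Q = 0) : IsAdmissible p Q ∧ IsFlow p T Q.zeta ∧
      ∀ t ∈ Icc (0 : ℝ) T, Q.psi t = -2 * (∫ s in (0 : ℝ)..t, rk 0 (Q.zeta s)) +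
        ∑' j : ℕ, (((j + 1 : ℕ) : ℝ) - 2) * (p (j + 1) - Q.zeta t (j + 1)) := by
  rw [rateFunction] at h0
  split_ifs at h0 with hadm
  · have hex : ∀ c > 0, ∃ φ, IsControl p Q φ ∧ controlCost T φ ≤ ENNReal.ofReal c := by
      intro c hc
      have hlt : (⨅ φ ∈ {φ | IsControl p Q φ}, controlCost T φ) < ENNReal.ofReal c := by
        rw [h0]; exact ENNReal.ofReal_pos.2 hc
      obtain ⟨φ, hφ⟩ := iInf_lt_iff.1 hlt
      obtain ⟨hφ1, hφ2⟩ := iInf_lt_iff.1 hφ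
      exact ⟨φ, hφ1, hφ2.le⟩
    have hmeas := measurable_zeta hadm.cts_zeta
    refine ⟨hadm, ⟨hmeas, fun t ht k hk => hadm.nonneg k hk t ht, fun t ht k hk => ?_,
      fun t ht k hk => hadm.le_init ht hk⟩, fun t ht => ?_⟩
    · suffices p k - Q.zeta t k = ∫ s in (0 : ℝ)..t, rk k (Q.zeta s) by linarith
      refine eq_of_forall_cost T.2 fun δ hδ c hc => ?_
      obtain ⟨φ, hφ, hcost⟩ := hex c hc
      rw [show p k - Q.zeta t k = jumpMass Q φ k t by rw [hφ.zeta_eq t ht k hk]; ring]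
      exact abs_jumpMass_sub_le (hφ.meas k) (hφ.integrable k) (measurable_rk hmeas k)
        (fun s hs => hadm.rk_mem h1 hs k) hc.le hδ hcost ht
    · set S := ∑' j : ℕ, (((j + 1 : ℕ) : ℝ) - 2) * (p (j + 1) - Q.zeta t (j + 1)) with hS
      suffices (S - Q.psi t) / 2 = ∫ s in (0 : ℝ)..t, rk 0 (Q.zeta s) by linarith
      refine eq_of_forall_cost T.2 fun δ hδ c hc => ?_
      obtain ⟨φ, hφ, hcost⟩ := hex c hc
      have hsum := (hasSum_nat_add_iff' 1).2 (hφ.psi_eq t ht)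
      have e : ∀ j : ℕ, jumpMass Q φ (j + 1) t = p (j + 1) - Q.zeta t (j + 1) := by
        intro j
        rw [hφ.zeta_eq t ht (j + 1) (by omega)]; ring
      simp only [e, Finset.range_one, Finset.sum_singleton] at hsum
      rw [show (S - Q.psi t) / 2 = jumpMass Q φ 0 t by
        rw [hS, hsum.tsum_eq]; push_cast; ring]
      exact abs_jumpMass_sub_le (hφ.meas 0) (hφ.integrable 0) (measurable_rk hmeas 0)
        (fun s hs => hadm.rk_mem h1 hs 0) hc.le hδ hcost ht
  · exact absurd h0 (by simp)

theorem rateFunction_eq_zero_of_isFlow {Q : PathSpace T}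
    (hp : IsDegreeDistribution p) (h1 : Summable fun k : ℕ => (k : ℝ) * p k)
    (hadm : IsAdmissible p Q) (hflow : IsFlow p T Q.zeta)
    (hpsi : ∀ t ∈ Icc (0 : ℝ) T, Q.psi t = -2 * (∫ s in (0 : ℝ)..t, rk 0 (Q.zeta s)) +
        ∑' j : ℕ, (((j + 1 : ℕ) : ℝ) - 2) * (p (j + 1) - Q.zeta t (j + 1))) :
    rateFunction p Q = 0 := by
  have hrate : ∀ k, jumpRate Q (fun _ _ => 1) k =
      fun z => if z.2 < rk k (Q.zeta z.1) then (1 : ℝ) else 0 := by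
    intro k; funext z; simp [jumpRate]
  have hmass : ∀ k, ∀ t ∈ Icc (0 : ℝ) T,
      jumpMass Q (fun _ _ => 1) k t = ∫ s in (0 : ℝ)..t, rk k (Q.zeta s) := by
    intro k t ht
    rw [jumpMass, hrate k]
    exact integral_box_indicator (measurable_rk hflow.meas k) ht.1
      fun s hs => hadm.rk_mem h1 ⟨hs.1, hs.2.trans ht.2⟩ k
  have hctrl : IsControl p Q (fun _ _ => 1) := by
    refine ⟨fun _ => measurable_const, fun k => ?_, fun t ht => ?_, fun t ht k hk => ?_⟩
    · rw [hrate k]; exact integrableOn_lt_indicator (measurable_rk hflow.meas k) _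
    · rw [← hasSum_nat_add_iff' 1]
      have e : ∀ j : ℕ, jumpMass Q (fun _ _ => 1) (j + 1) t = p (j + 1) - Q.zeta t (j + 1) := by
        intro j
        rw [hmass _ t ht, hflow.integral_eq t ht (j + 1) (by omega)]; ring
      simp only [e, Finset.range_one, Finset.sum_singleton, hmass 0 t ht]
      have hs : Summable fun j : ℕ =>
          (((j + 1 : ℕ) : ℝ) - 2) * (p (j + 1) - Q.zeta t (j + 1)) := by
        have hbd : Summable fun j : ℕ => ((j + 1 : ℕ) : ℝ) * p (j + 1) + 2 * p (j + 1) :=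
          ((summable_nat_add_iff 1).2 h1).add
            (((summable_nat_add_iff 1).2 hp.hasSum.summable).mul_left 2)
        refine Summable.of_norm_bounded hbd fun j => ?_
        have h3 := hflow.le_init t ht (j + 1) (by omega)
        have h4 := hflow.nonneg t ht (j + 1) (by omega)
        rw [norm_mul, Real.norm_eq_abs, Real.norm_of_nonneg (sub_nonneg.2 h3), ← add_mul]
        have h5 : |((j + 1 : ℕ) : ℝ) - 2| ≤ ((j + 1 : ℕ) : ℝ) + 2 := by
          rw [abs_le]; constructor <;> push_cast <;> linarith [(j.cast_nonneg : (0 : ℝ) ≤ j)]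
        exact mul_le_mul h5 (by linarith) (sub_nonneg.2 h3) (by positivity)
      have e3 : Q.psi t - (((0 : ℕ) : ℝ) - 2) * ∫ s in (0 : ℝ)..t, rk 0 (Q.zeta s) =
          ∑' j : ℕ, (((j + 1 : ℕ) : ℝ) - 2) * (p (j + 1) - Q.zeta t (j + 1)) := by
        rw [hpsi t ht]
        push_cast
        ring
      rw [e3]
      exact hs.hasSum
    · rw [hmass k t ht]; exact hflow.integral_eq t ht k hk
  rw [rateFunction, if_pos hadm]
  refine le_antisymm ((iInf₂_le (fun _ _ => (1 : ℝ≥0)) hctrl).trans ?_) zero_le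
  simp [controlCost, ell]

end Cost

/-! ### Zero rate trajectories are fluid trajectories -/

section ZeroRate

variable {p : ℕ → ℝ} {T : ℝ≥0} {Q : PathSpace T}

/-- `inf_{s ≤ t} (ψ(s) ∧ 0)`. -/
noncomputable def runInf (ψ : ℝ → ℝ) (t : ℝ) : ℝ := sInf ((fun s => min (ψ s) 0) '' Icc 0 t)

theorem exists_runInf_eq {ψ : ℝ → ℝ} (hψ : Continuous ψ) {t : ℝ} (ht : 0 ≤ t) :
    ∃ s ∈ Icc 0 t, runInf ψ t = min (ψ s) 0 ∧ ∀ y ∈ Icc 0 t, min (ψ s) 0 ≤ min (ψ y) 0 := by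
  obtain ⟨s, hs, hmin⟩ := isCompact_Icc.exists_isMinOn (nonempty_Icc.2 ht)
    ((hψ.min continuous_const).continuousOn (s := Icc 0 t))
  refine ⟨s, hs, ?_, fun y hy => hmin hy⟩
  refine IsLeast.csInf_eq ⟨⟨s, hs, rfl⟩, ?_⟩
  rintro _ ⟨y, hy, rfl⟩
  exact hmin hy

theorem runInf_antitone {ψ : ℝ → ℝ} (hψ : Continuous ψ) {s t : ℝ} (hs : 0 ≤ s) (hst : s ≤ t) :
    runInf ψ t ≤ runInf ψ s := by
  obtain ⟨y, hy, e, -⟩ := exists_runInf_eq hψ hs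
  obtain ⟨y', -, e', h'⟩ := exists_runInf_eq hψ (hs.trans hst)
  rw [e, e']
  exact h' y ⟨hy.1, hy.2.trans hst⟩

/-- The regulator is constant while the reflected path is positive. -/
theorem runInf_eq_of_pos {ψ : ℝ → ℝ} (hψ : Continuous ψ) {s t : ℝ} (hs : 0 ≤ s) (hst : s ≤ t)
    (hpos : ∀ y ∈ Icc s t, 0 < ψ y - runInf ψ y) : runInf ψ t = runInf ψ s := by
  refine le_antisymm (runInf_antitone hψ hs hst) ?_
  obtain ⟨y, hy, e, -⟩ := exists_runInf_eq hψ (hs.trans hst)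
  obtain ⟨x, -, ex, hx⟩ := exists_runInf_eq hψ hs
  rcases le_total y s with hys | hys
  · rw [e, ex]; exact hx y ⟨hy.1, hys⟩
  · have h1 := hpos y ⟨hys, hy.2⟩
    have h2 := runInf_antitone hψ hy.1 hy.2
    rcases le_total (ψ y) 0 with h0 | h0
    · rw [min_eq_left h0] at e; linarith
    · rw [e, min_eq_right h0, ex]; exact min_le_right _ _

theorem skorokhodMap_nonneg {ψ : ℝ → ℝ} (hψ : Continuous ψ) {t : ℝ} (ht : 0 ≤ t) :
    0 ≤ ψ t - runInf ψ t := by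
  obtain ⟨y, -, e, h⟩ := exists_runInf_eq hψ ht
  have := (h t ⟨ht, le_rfl⟩).trans (min_le_left _ _)
  rw [e]
  linarith

/-- R is the mass of active plus sleeping half-edges; it moves by the growth of the regulator minus
twice the busy time. The only delicate condition is that R decreases, which is not visible from the
reflection. -/
theorem isFluid_of_isFlow (h1 : Summable fun k : ℕ => (k : ℝ) * p k)
    (hadm : IsAdmissible p Q) (hflow : IsFlow p T Q.zeta)
    (hpsi : ∀ t ∈ Icc (0 : ℝ) T, Q.psi t = -2 * (∫ s in (0 : ℝ)..t, rk 0 (Q.zeta s)) +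
        ∑' j : ℕ, (((j + 1 : ℕ) : ℝ) - 2) * (p (j + 1) - Q.zeta t (j + 1))) :
    IsFluid p T Q.zeta (fun t => Q.zeta t 0 + sleepMass (Q.zeta t)) := by
  have hψ : Continuous Q.psi := hadm.cts_psi.Icc_extend'
  have hζ := continuous_zeta hadm.cts_zeta
  have hζ0 : Continuous fun t => Q.zeta t 0 := (continuous_apply 0).comp hζ
  have ha : ∀ t ∈ Icc (0 : ℝ) T, Q.zeta t 0 = Q.psi t - runInf Q.psi t := hadm.zeta_zero
  have ha0 : ∀ t ∈ Icc (0 : ℝ) T, 0 ≤ Q.zeta t 0 := fun t ht => by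
    rw [ha t ht]; exact skorokhodMap_nonneg hψ ht.1
  have h0I : (0 : ℝ) ∈ Icc (0 : ℝ) T := ⟨le_rfl, T.2⟩
  set W : ℝ → ℝ := fun t => sleepMass (Q.zeta t) with hW
  have hnn : ∀ t ∈ Icc (0 : ℝ) T, ∀ k, 1 ≤ k → 0 ≤ Q.zeta t k :=
    fun t ht k hk => hadm.nonneg k hk t ht
  have htot : ∀ t ∈ Icc (0 : ℝ) T, totalMass (Q.zeta t) = Q.zeta t 0 + W t := fun t ht => by
    rw [totalMass, max_eq_left (ha0 t ht)]
  have hW0 : ∀ t ∈ Icc (0 : ℝ) T, 0 ≤ W t := fun t ht => sleepMass_nonneg (hnn t ht)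
  have hWanti : AntitoneOn W (Icc 0 T) := by
    intro s hs t ht hst
    refine (hadm.summable h1 ht).tsum_le_tsum (fun k => ?_) (hadm.summable h1 hs)
    rcases Nat.eq_zero_or_pos k with rfl | hk
    · simp
    · exact mul_le_mul_of_nonneg_left (hadm.anti k hk hs ht hst) k.cast_nonneg
  set g : ℝ → ℝ := fun y => if 0 < totalMass (Q.zeta y) then (1 : ℝ) else 0 with hg
  have hgmeas : Measurable g := by
    refine Measurable.ite (measurableSet_lt measurable_const ?_) measurable_const measurable_const
    exact ((hflow.meas 0).max measurable_const).add
      (Measurable.tsum fun k => (hflow.meas k).const_mul _)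
  have hgint : ∀ s t : ℝ, IntervalIntegrable g volume s t := fun s t => by
    refine (intervalIntegrable_const (c := (1 : ℝ))).mono_fun hgmeas.aestronglyMeasurable
      (ae_of_all _ fun y => ?_)
    simp only [hg]
    split_ifs <;> simp
  have hR : ∀ s ∈ Icc (0 : ℝ) T, ∀ t ∈ Icc (0 : ℝ) T, (Q.zeta t 0 + W t) - (Q.zeta s 0 + W s) =
      (runInf Q.psi s - runInf Q.psi t) - 2 * ∫ y in s..t, g y := by
    intro s hs t ht
    have e1 := hpsi t ht
    have e2 := hpsi s hs
    rw [hflow.psi_formula h1 ht] at e1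
    rw [hflow.psi_formula h1 hs] at e2
    rw [ha t ht, ha s hs, e1, e2,
      ← intervalIntegral.integral_interval_sub_left (hgint 0 t) (hgint 0 s)]
    simp only [hW, hg]
    ring
  have hgle : ∀ s t : ℝ, s ≤ t → ∫ y in s..t, g y ≤ t - s := by
    intro s t hst
    have := intervalIntegral.integral_mono_on hst (hgint s t)
      (intervalIntegrable_const (c := (1 : ℝ))) fun y _ => ?_
    · simpa using this
    · simp only [hg]; split_ifs <;> norm_num
  have hgeq : ∀ s ∈ Icc (0 : ℝ) T, ∀ t ∈ Icc (0 : ℝ) T, s ≤ t →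
      (∀ y ∈ Icc s t, 0 < Q.zeta y 0) → ∫ y in s..t, g y = t - s := by
    intro s hs t ht hst hpos
    have : ∫ y in s..t, g y = ∫ _ in s..t, (1 : ℝ) := by
      refine intervalIntegral.integral_congr fun y hy => ?_
      rw [uIcc_of_le hst] at hy
      have hyI : y ∈ Icc (0 : ℝ) T := ⟨hs.1.trans hy.1, hy.2.trans ht.2⟩
      simp only [hg]
      rw [if_pos]
      rw [htot y hyI]
      linarith [hpos y hy, hW0 y hyI]
    rw [this]; simp
  have hdrop : ∀ s ∈ Icc (0 : ℝ) T, ∀ t ∈ Icc (0 : ℝ) T, s ≤ t →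
      (∀ y ∈ Icc s t, 0 < Q.zeta y 0) →
      Q.zeta t 0 + W t = Q.zeta s 0 + W s - 2 * (t - s) := by
    intro s hs t ht hst hpos
    have e := hR s hs t ht
    rw [hgeq s hs t ht hst hpos, runInf_eq_of_pos hψ hs.1 hst fun y hy => ?_] at e
    · linarith
    · rw [← ha y ⟨hs.1.trans hy.1, hy.2.trans ht.2⟩]; exact hpos y hy
  -- If R_s < R_t then ζ₀(t) > 0. If ζ₀ vanishes somewhere in [s, t], let x be its last zero before
  -- t: after x, R decreases, so R_t ≤ ζ₀(x') + W_s for x' ↓ x, which tends to W_s ≤ R_s.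
  have hanti : AntitoneOn (fun t => Q.zeta t 0 + W t) (Icc 0 T) := by
    intro s hs t ht hst
    simp only
    by_contra hcon
    push Not at hcon
    have hWst := hWanti hs ht hst
    have hat : 0 < Q.zeta t 0 := by linarith [ha0 s hs]
    by_cases hall : ∀ y ∈ Icc s t, 0 < Q.zeta y 0
    · linarith [hdrop s hs t ht hst hall]
    push Not at hall
    obtain ⟨y, hy, hy0⟩ := hall
    obtain ⟨x, hx, hx0, hafter⟩ := exists_last_zero (g := fun y => -Q.zeta y 0) hy.2
      hζ0.neg.continuousOn (by simpa using hy0) (by simpa using hat)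
    have hx0' : Q.zeta x 0 = 0 := by simpa using hx0
    -- W has been replaced by the constant W s because its continuity is not known at this stage.
    have hlim : Tendsto (fun y => Q.zeta y 0 + W s) (𝓝[>] x) (𝓝 (0 + W s)) := by
      have := ((hζ0.tendsto x).mono_left (nhdsWithin_le_nhds (s := Ioi x))).add_const (W s)
      rwa [hx0'] at this
    have hle : Q.zeta t 0 + W t ≤ 0 + W s := by
      refine ge_of_tendsto hlim ?_
      filter_upwards [Ioo_mem_nhdsGT hx.2] with x' hx'
      have hx'I : x' ∈ Icc (0 : ℝ) T :=
        ⟨hs.1.trans (hy.1.trans (hx.1.trans hx'.1.le)), hx'.2.le.trans ht.2⟩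
      have h3 := hdrop x' hx'I t ht hx'.2.le fun w hw => by
        have := hafter w ⟨hx'.1.trans_le hw.1, hw.2⟩
        simpa using this
      have h4 := hWanti hs hx'I (hy.1.trans (hx.1.trans hx'.1.le))
      linarith [hx'.2]
    linarith [ha0 s hs]
  have hRpos : ∀ s ∈ Icc (0 : ℝ) T, ∀ t ∈ Icc (0 : ℝ) T, 0 < Q.zeta t 0 + W t →
      ∀ y ∈ Icc s t, y ∈ Icc (0 : ℝ) T ∧ 0 < Q.zeta y 0 + W y ∧
        Q.zeta t 0 + W t ≤ Q.zeta y 0 + W y ∧ Q.zeta y 0 + W y ≤ Q.zeta s 0 + W s := by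
    intro s hs t ht hpos y hy
    have hyI : y ∈ Icc (0 : ℝ) T := ⟨hs.1.trans hy.1, hy.2.trans ht.2⟩
    have h3 : Q.zeta t 0 + W t ≤ Q.zeta y 0 + W y := hanti hyI ht hy.2
    exact ⟨hyI, hpos.trans_le h3, h3, hanti hs hyI hy.1⟩
  have hrk : ∀ y ∈ Icc (0 : ℝ) T, ∀ k, 1 ≤ k →
      rk k (Q.zeta y) = k * Q.zeta y k / (Q.zeta y 0 + W y) := by
    intro y hy k hk
    rw [rk_eq (hnn y hy) (hadm.summable h1 hy), if_neg (by omega), htot y hy]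
  refine ⟨hadm.init, hadm.anti, hadm.nonneg, ?_, hanti, ?_, ?_, ?_, ?_, ?_⟩
  · have e0 : Q.zeta 0 0 = 0 := by
      rw [hadm.zeta_zero 0 h0I, skorokhodMap]
      simp [hadm.psi_zero]
    rw [e0, zero_add]
    refine tsum_congr fun k => ?_
    rcases Nat.eq_zero_or_pos k with rfl | hk
    · simp
    · rw [hadm.init k hk]
  · intro s hs t ht hst
    have h3 := hR s hs t ht
    have h4 := hgle s t hst
    have h5 := runInf_antitone hψ hs.1 hst
    simp only [hW] at h3
    linarith
  · intro t ht
    linarith [ha0 t ht]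
  · intro s hs t ht hst hlt
    refine hdrop s hs t ht hst fun y hy => ?_
    have hyI : y ∈ Icc (0 : ℝ) T := ⟨hs.1.trans hy.1, hy.2.trans ht.2⟩
    have h3 : Q.zeta t 0 + W t ≤ Q.zeta y 0 + W y := hanti hyI ht hy.2
    have h4 : W y ≤ W s := hWanti hs hyI hy.1
    simp only [hW] at h3 h4
    linarith
  · intro k hk s hs t ht hst hpos
    rw [hflow.sub_eq h1 hs ht hk]
    have := intervalIntegral.integral_mono_on hst
      (intervalIntegrable_const (c := k * Q.zeta t k / (Q.zeta s 0 + W s)))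
      (hflow.intervalIntegrable_rk h1 hs ht k) fun y hy => ?_
    · rwa [intervalIntegral.integral_const, smul_eq_mul] at this
    · obtain ⟨hyI, hy0, -, hy2⟩ := hRpos s hs t ht hpos y hy
      rw [hrk y hyI k hk]
      exact div_le_div₀ (mul_nonneg k.cast_nonneg (hnn y hyI k hk))
        (mul_le_mul_of_nonneg_left (hadm.anti k hk hyI ht hy.2) k.cast_nonneg) hy0 hy2
  · intro k hk s hs t ht hst hpos
    rw [hflow.sub_eq h1 hs ht hk]
    have := intervalIntegral.integral_mono_on hst
      (hflow.intervalIntegrable_rk h1 hs ht k)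
      (intervalIntegrable_const (c := k * Q.zeta s k / (Q.zeta t 0 + W t))) fun y hy => ?_
    · rwa [intervalIntegral.integral_const, smul_eq_mul] at this
    · obtain ⟨hyI, -, hy1, -⟩ := hRpos s hs t ht hpos y hy
      rw [hrk y hyI k hk]
      exact div_le_div₀ (mul_nonneg k.cast_nonneg (hnn s hs k hk))
        (mul_le_mul_of_nonneg_left (hadm.anti k hk hs hyI hy.1) k.cast_nonneg) hpos hy1

/-- The limit trajectory is the unique zero of the rate function. -/
theorem exists_unique_zero (hp : IsDegreeDistribution p)
    (h2 : Summable fun k : ℕ => (k : ℝ) ^ 2 * p k) :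
    ∃ P : PathSpace T,
      (∀ t : Icc (0 : ℝ) T, P.1.toFun t = zetaLim p t ∧ P.2.toFun t = psiLim p t) ∧
      ∀ Q : PathSpace T, rateFunction p Q = 0 ↔ Q = P := by
  have h1 := summable_first_moment hp h2
  have hT : (0 : ℝ) ≤ T := T.2
  obtain ⟨K, hK⟩ := exists_lipschitz_psiLim hp h2 T
  have hc1 : Continuous fun t : Icc (0 : ℝ) T => zetaLim p t := by
    have : (fun t : Icc (0 : ℝ) T => zetaLim p t) = fun t : Icc (0 : ℝ) T => zetaU p t :=
      funext fun t => zetaLim_eq_zetaU hp h2 t.2.1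
    rw [this]
    exact (continuous_zetaU hp h1).comp continuous_subtype_val
  have hc2 : Continuous fun t : Icc (0 : ℝ) T => psiLim p t :=
    continuousOn_iff_continuous_domRestrict.1 hK.continuousOn
  let P : PathSpace T :=
    (⟨fun t => zetaLim p t, fun t => hc1.continuousWithinAt,
      fun t => ⟨_, (hc1.tendsto t).mono_left nhdsWithin_le_nhds⟩⟩,
     ⟨fun t => psiLim p t, fun t => hc2.continuousWithinAt,
      fun t => ⟨_, (hc2.tendsto t).mono_left nhdsWithin_le_nhds⟩⟩)
  have hPz : ∀ t ∈ Icc (0 : ℝ) T, P.zeta t = zetaU p t := by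
    intro t ht
    rw [← zetaLim_eq_zetaU hp h2 ht.1]
    exact IccExtend_of_mem hT _ ht
  have hPψ : ∀ t ∈ Icc (0 : ℝ) T, P.psi t = psiLim p t := fun t ht => IccExtend_of_mem hT _ ht
  have h0I : (0 : ℝ) ∈ Icc (0 : ℝ) T := ⟨le_rfl, hT⟩
  have hint : ∀ (Q : PathSpace T), (∀ t ∈ Icc (0 : ℝ) T, Q.zeta t = zetaU p t) →
      ∀ k, ∀ t ∈ Icc (0 : ℝ) T, ∫ s in (0 : ℝ)..t, rk k (Q.zeta s) =
        ∫ s in (0 : ℝ)..t, rk k (zetaU p s) := by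
    intro Q hQ k t ht
    refine intervalIntegral.integral_congr fun s hs => ?_
    rw [uIcc_of_le ht.1] at hs
    simp only [hQ s ⟨hs.1, hs.2.trans ht.2⟩]
  refine ⟨P, fun t => ⟨rfl, rfl⟩, fun Q => ⟨fun hQ => ?_, ?_⟩⟩
  · obtain ⟨hadm, hflow, hpsi⟩ := rateFunction_eq_zero h1 hQ
    have hfluid := isFluid_of_isFlow h1 hadm hflow hpsi
    have hQz : ∀ t ∈ Icc (0 : ℝ) T, Q.zeta t = zetaU p t := by
      intro t ht
      obtain ⟨hR, hz⟩ := hfluid.eq_limit hp h1 ht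
      have hz' : ∀ k, 1 ≤ k → Q.zeta t k = zetaU p t k := fun k hk => by
        rw [hz k hk, zetaU, if_neg (by omega)]
      have hm : sleepMass (Q.zeta t) = sleepMass (zetaU p t) := by
        refine tsum_congr fun k => ?_
        rcases Nat.eq_zero_or_pos k with rfl | hk
        · simp
        · rw [hz' k hk]
      funext k
      rcases Nat.eq_zero_or_pos k with rfl | hk
      · have := zetaU_zero_add hp h1 t
        simp only [hm] at hR
        linarith
      · exact hz' k hk
    refine Prod.ext (CadlagPath.ext (funext fun t => ?_)) (CadlagPath.ext (funext fun t => ?_))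
    · have := hQz t t.2
      rw [← hPz t t.2] at this
      exact (IccExtend_val hT Q.1.toFun t).symm.trans
        (this.trans (IccExtend_val hT P.1.toFun t))
    · have h3 := hpsi t t.2
      rw [hint Q hQz 0 t t.2, hQz t t.2, ← psiLim_eq_integral hp h2 t.2.1, ← hPψ t t.2] at h3
      exact (IccExtend_val hT Q.2.toFun t).symm.trans
        (h3.trans (IccExtend_val hT P.2.toFun t))
  · rintro rfl
    have hadm : IsAdmissible p P := by
      obtain ⟨C, hC⟩ := exists_rk_le hp h1
      refine ⟨hc1, hc2, ?_, ?_, fun t ht => ?_, fun k hk => ?_, fun k hk => ?_, fun k hk => ?_,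
        fun k hk t ht => ?_⟩
      · rw [hPψ 0 h0I, psiLim_eq hp h2 le_rfl, sleepMass_zetaU hp h1, uLim_zero hp h1,
          G1_one hp h1, min_eq_left (Phi_zero_pos hp h1).le]
        ring
      · refine LipschitzOnWith.absolutelyContinuousOnInterval (K := K) ?_
        rw [uIcc_of_le hT]
        intro s hs t ht
        rw [hPψ s hs, hPψ t ht]
        exact hK hs ht
      · rw [hPz t ht, zetaU_zero_eq_skorokhodMap hp h2 ht.1, skorokhodMap, skorokhodMap, hPψ t ht]
        congr 2
        refine image_congr fun s hs => ?_
        rw [hPψ s ⟨hs.1, hs.2.trans ht.2⟩]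
      · rw [hPz 0 h0I, zetaU, if_neg (by omega), uLim_zero hp h1]
        simp
      · intro s hs t ht hst
        simp only [hPz s hs, hPz t ht]
        exact zetaU_antitone hp h1 hk hst
      · have hlip := lipschitzOnWith_of_antitone (T := T) ((zetaU_antitone hp h1 hk).antitoneOn _)
          fun s hs t _ hst => zetaU_sub_le hp h1 hC hs.1 hst hk
        refine LipschitzOnWith.absolutelyContinuousOnInterval
          (K := (C * (k * p k)).toNNReal) ?_
        rw [uIcc_of_le hT]
        intro s hs t ht
        simp only [hPz s hs, hPz t ht]
        exact hlip hs ht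
      · rw [hPz t ht]; exact zetaU_nonneg hp h1 t k
    have hU := isFlow_zetaU hp h1 T
    refine rateFunction_eq_zero_of_isFlow hp h1 hadm
      ⟨measurable_zeta hc1, fun t ht k hk => hadm.nonneg k hk t ht, fun t ht k hk => ?_,
        fun t ht k hk => hadm.le_init ht hk⟩ fun t ht => ?_
    · rw [hint P hPz k t ht, hPz t ht]
      exact hU.integral_eq t ht k hk
    · rw [hint P hPz 0 t ht, hPz t ht, hPψ t ht]
      exact psiLim_eq_integral hp h2 ht.1

end ZeroRate


/-! ### Paths of the edge-exploration chain -/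

section Paths

/-- The number of sleeping half-edges. -/
def sleepEdges (v : ℕ →₀ ℕ) : ℕ := v.sum fun k m => k * m

/-- The number of half-edges which have not been paired. -/
def totalEdges (x : ℕ × (ℕ →₀ ℕ)) : ℕ := x.1 + sleepEdges x.2

/-- The probability that a sleeping vertex of degree `k` is explored next. -/
noncomputable def wakeProb (k : ℕ) (x : ℕ × (ℕ →₀ ℕ)) : ℝ :=
  ((k * x.2 k : ℕ) : ℝ) / ((sleepEdges x.2 + (x.1 - 1) : ℕ) : ℝ)

/-- The transitions of the edge-exploration chain. -/
def IsStep (x y : ℕ × (ℕ →₀ ℕ)) : Prop :=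
  (x.1 = 0 ∧ x.2 = 0 ∧ y = x) ∨ (2 ≤ x.1 ∧ y = (x.1 - 2, x.2)) ∨
    ∃ k, 1 ≤ k ∧ 1 ≤ x.2 k ∧ y.2 = x.2 - Finsupp.single k 1 ∧
      y.1 + (if 0 < x.1 then 2 else 0) = x.1 + k

theorem sleepEdges_single_add (v : ℕ →₀ ℕ) (k : ℕ) :
    sleepEdges (Finsupp.single k 1 + v) = k + sleepEdges v := by
  rw [sleepEdges, Finsupp.sum_add_index' (by simp) (by intros; ring),
    Finsupp.sum_single_index (by simp), mul_one, sleepEdges]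

theorem sleepEdges_sub_single {v : ℕ →₀ ℕ} {k : ℕ} (hk : 1 ≤ v k) :
    sleepEdges (v - Finsupp.single k 1) + k = sleepEdges v := by
  have h : Finsupp.single k 1 + (v - Finsupp.single k 1) = v :=
    add_tsub_cancel_of_le (by simpa using hk)
  conv_rhs => rw [← h]
  rw [sleepEdges_single_add, add_comm]

theorem sleepEdges_eq_zero_of_eq_zero {v : ℕ →₀ ℕ} (h : v = 0) : sleepEdges v = 0 := by
  rw [h, sleepEdges, Finsupp.sum_zero_index]

variable {x y : ℕ × (ℕ →₀ ℕ)}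

theorem IsStep.apply_le (h : IsStep x y) (k : ℕ) : y.2 k ≤ x.2 k := by
  rcases h with ⟨-, -, rfl⟩ | ⟨-, rfl⟩ | ⟨j, -, -, h, -⟩
  · rfl
  · rfl
  · rw [h]; simp

theorem IsStep.le_apply_add_one (h : IsStep x y) (k : ℕ) : x.2 k ≤ y.2 k + 1 := by
  rcases h with ⟨-, -, rfl⟩ | ⟨-, rfl⟩ | ⟨j, -, -, h, -⟩
  · omega
  · simp
  · rw [h, Finsupp.tsub_apply, Finsupp.single_apply]
    split_ifs <;> omega

/-- Waking a vertex only moves its half-edges from sleeping to active. Two half-edges leave exactly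
when an active one is paired. -/
theorem IsStep.totalEdges_eq (h : IsStep x y) :
    totalEdges y + (if 0 < x.1 then 2 else 0) = totalEdges x := by
  rcases h with ⟨h1, -, rfl⟩ | ⟨h1, rfl⟩ | ⟨j, -, hj, h, h1⟩
  · simp [h1]
  · rw [if_pos (by omega)]; simp only [totalEdges]; omega
  · have := sleepEdges_sub_single hj
    simp only [totalEdges]
    rw [h]
    omega

theorem IsStep.sleepEdges_le (h : IsStep x y) : sleepEdges y.2 ≤ sleepEdges x.2 := by
  rcases h with ⟨-, -, rfl⟩ | ⟨-, rfl⟩ | ⟨j, -, hj, h, -⟩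
  · rfl
  · rfl
  · rw [h, ← sleepEdges_sub_single hj]; omega

theorem IsStep.sleepEdges_lt (h : IsStep x y) (h0 : x.1 = 0) (hv : x.2 ≠ 0) :
    sleepEdges y.2 + 1 ≤ sleepEdges x.2 := by
  rcases h with ⟨-, h1, -⟩ | ⟨h1, -⟩ | ⟨j, hj1, hj, h, -⟩
  · exact absurd h1 hv
  · omega
  · rw [h, ← sleepEdges_sub_single hj]; omega

variable {X : ℕ → ℕ × (ℕ →₀ ℕ)}

open Classical in
/-- The number of components started before step `j`. -/
noncomputable def startCount (X : ℕ → ℕ × (ℕ →₀ ℕ)) (j : ℕ) : ℕ :=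
  ((Finset.range j).filter fun i => (X i).1 = 0 ∧ (X i).2 ≠ 0).card

/-- The compensated number of vertices of degree `k` explored before step `j`. -/
noncomputable def compensated (X : ℕ → ℕ × (ℕ →₀ ℕ)) (k j : ℕ) : ℝ :=
  ∑ i ∈ Finset.range j, (((X i).2 k : ℝ) - (X (i + 1)).2 k - wakeProb k (X i))

theorem startCount_succ (X : ℕ → ℕ × (ℕ →₀ ℕ)) (j : ℕ) [Decidable ((X j).1 = 0 ∧ (X j).2 ≠ 0)] :
    startCount X (j + 1) = startCount X j + if (X j).1 = 0 ∧ (X j).2 ≠ 0 then 1 else 0 := by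
  classical
  rw [startCount, startCount, Finset.range_add_one, Finset.filter_insert]
  split_ifs with h
  · rw [Finset.card_insert_of_notMem (by simp)]
  · rfl

theorem apply_antitone (hX : ∀ j, IsStep (X j) (X (j + 1))) (k : ℕ) :
    Antitone fun j => (X j).2 k :=
  antitone_nat_of_succ_le fun j => (hX j).apply_le k

theorem sleepEdges_antitone (hX : ∀ j, IsStep (X j) (X (j + 1))) :
    Antitone fun j => sleepEdges (X j).2 :=
  antitone_nat_of_succ_le fun j => (hX j).sleepEdges_le

theorem totalEdges_antitone (hX : ∀ j, IsStep (X j) (X (j + 1))) :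
    Antitone fun j => totalEdges (X j) :=
  antitone_nat_of_succ_le fun j => by
    have := (hX j).totalEdges_eq
    omega

theorem startCount_mono (X : ℕ → ℕ × (ℕ →₀ ℕ)) : Monotone (startCount X) := by
  classical
  exact monotone_nat_of_le_succ fun j => by rw [startCount_succ]; omega

/-- Every new component wakes a vertex of degree at least 1. Hence the number of starts is bounded
by the initial number of half-edges, and cannot grow once the sleeping mass is exhausted. -/
theorem startCount_add_antitone (hX : ∀ j, IsStep (X j) (X (j + 1))) :
    Antitone fun j => startCount X j + sleepEdges (X j).2 := by
  classical
  refine antitone_nat_of_succ_le fun j => ?_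
  rw [startCount_succ]
  split_ifs with h
  · have := (hX j).sleepEdges_lt h.1 h.2
    omega
  · have := (hX j).sleepEdges_le
    omega

theorem totalEdges_le_add (hX : ∀ j, IsStep (X j) (X (j + 1))) {i j : ℕ} (hij : i ≤ j) :
    totalEdges (X i) ≤ totalEdges (X j) + 2 * (j - i) := by
  induction j, hij using Nat.le_induction with
  | base => omega
  | succ j hij ih =>
    have := (hX j).totalEdges_eq
    split_ifs at this <;> omega

theorem totalEdges_drop (hX : ∀ j, IsStep (X j) (X (j + 1))) {i j : ℕ} (hij : i ≤ j)
    (hpos : ∀ l, i ≤ l → l < j → 0 < (X l).1) :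
    totalEdges (X i) = totalEdges (X j) + 2 * (j - i) := by
  induction j, hij using Nat.le_induction with
  | base => omega
  | succ j hij ih =>
    have h := (hX j).totalEdges_eq
    rw [if_pos (hpos j hij (by omega))] at h
    have := ih fun l hl hlj => hpos l hl (by omega)
    omega

/-- Each step removes two half-edges unless it starts a component; positivity excludes the absorbed
state, where steps do nothing. -/
theorem totalEdges_add_eq (hX : ∀ j, IsStep (X j) (X (j + 1))) {j : ℕ}
    (hpos : 0 < totalEdges (X j)) :
    totalEdges (X j) + 2 * j = totalEdges (X 0) + 2 * startCount X j := by
  classical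
  induction j with
  | zero => simp [startCount]
  | succ j ih =>
    have h := (hX j).totalEdges_eq
    have hpos' : 0 < totalEdges (X j) := by omega
    have := ih hpos'
    rw [startCount_succ]
    by_cases h0 : 0 < (X j).1
    · rw [if_pos h0] at h
      rw [if_neg (by omega)]
      omega
    · rw [if_neg h0] at h
      have hv : (X j).2 ≠ 0 := by
        intro hv
        have := sleepEdges_eq_zero_of_eq_zero hv
        simp only [totalEdges] at hpos'
        omega
      rw [if_pos ⟨by omega, hv⟩]
      omega

theorem compensated_sub {i j : ℕ} (hij : i ≤ j) (k : ℕ) :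
    ((X i).2 k : ℝ) - (X j).2 k =
      ∑ l ∈ Finset.Ico i j, wakeProb k (X l) + (compensated X k j - compensated X k i) := by
  rw [compensated, compensated, ← Finset.sum_Ico_eq_sub _ hij, Finset.sum_sub_distrib]
  have : ∑ l ∈ Finset.Ico i j, (((X l).2 k : ℝ) - (X (l + 1)).2 k) =
      ((X i).2 k : ℝ) - (X j).2 k := by
    have h := Finset.sum_Ico_sub (fun l => -((X l).2 k : ℝ)) hij
    simp only [neg_sub_neg] at h
    exact h
  rw [this]
  ring

theorem wakeProb_nonneg (k : ℕ) (x : ℕ × (ℕ →₀ ℕ)) : 0 ≤ wakeProb k x := by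
  unfold wakeProb; positivity

theorem le_sum_wakeProb (hX : ∀ j, IsStep (X j) (X (j + 1))) (i j k : ℕ) :
    ((j - i : ℕ) : ℝ) * (k * (X j).2 k / totalEdges (X i)) ≤
      ∑ l ∈ Finset.Ico i j, wakeProb k (X l) := by
  have h : ∀ l ∈ Finset.Ico i j, (k : ℝ) * (X j).2 k / totalEdges (X i) ≤ wakeProb k (X l) := by
    intro l hl
    rw [Finset.mem_Ico] at hl
    have h1 : (X j).2 k ≤ (X l).2 k := apply_antitone hX k hl.2.le
    have h2 : totalEdges (X l) ≤ totalEdges (X i) := totalEdges_antitone hX hl.1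
    -- The case of a zero numerator is treated apart, since only a sleeping vertex of degree k
    -- guarantees a nonzero denominator in `wakeProb`.
    rcases Nat.eq_zero_or_pos (k * (X j).2 k) with h0 | h0
    · rw [← Nat.cast_mul, h0]
      simpa using wakeProb_nonneg k (X l)
    have h3 : k * (X l).2 k ≤ sleepEdges (X l).2 := by
      by_cases hk : (X l).2 k = 0
      · simp [hk]
      · exact Finset.single_le_sum (f := fun k => k * (X l).2 k) (fun _ _ => Nat.zero_le _)
          (Finsupp.mem_support_iff.2 hk)
    have h4 : k * (X j).2 k ≤ k * (X l).2 k := Nat.mul_le_mul_left k h1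
    rw [← Nat.cast_mul, wakeProb]
    refine div_le_div₀ (Nat.cast_nonneg _) (by exact_mod_cast h4) ?_ ?_
    · exact_mod_cast (by omega : 0 < sleepEdges (X l).2 + ((X l).1 - 1))
    · have : sleepEdges (X l).2 + ((X l).1 - 1) ≤ totalEdges (X i) := by
        simp only [totalEdges] at h2 ⊢; omega
      exact_mod_cast this
  have := Finset.card_nsmul_le_sum _ _ _ h
  simpa using this

/-- The loss of 1 in the denominator reflects that an active half-edge is not paired with itself; it
disappears after rescaling. -/
theorem sum_wakeProb_le (hX : ∀ j, IsStep (X j) (X (j + 1))) (i : ℕ) {j : ℕ} (k : ℕ)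
    (hpos : 1 < totalEdges (X j)) :
    ∑ l ∈ Finset.Ico i j, wakeProb k (X l) ≤
      ((j - i : ℕ) : ℝ) * (k * (X i).2 k / ((totalEdges (X j) : ℝ) - 1)) := by
  have h : ∀ l ∈ Finset.Ico i j, wakeProb k (X l) ≤
      (k : ℝ) * (X i).2 k / ((totalEdges (X j) : ℝ) - 1) := by
    intro l hl
    rw [Finset.mem_Ico] at hl
    have h1 : (X l).2 k ≤ (X i).2 k := apply_antitone hX k hl.1
    have h2 : totalEdges (X j) ≤ totalEdges (X l) := totalEdges_antitone hX hl.2.le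
    rw [← Nat.cast_mul, wakeProb]
    refine div_le_div₀ (Nat.cast_nonneg _) (by exact_mod_cast Nat.mul_le_mul_left k h1) ?_ ?_
    · have : (1 : ℝ) < totalEdges (X j) := by exact_mod_cast hpos
      linarith
    · have : totalEdges (X j) ≤ sleepEdges (X l).2 + ((X l).1 - 1) + 1 := by
        simp only [totalEdges] at h2 ⊢; omega
      have : (totalEdges (X j) : ℝ) ≤ ((sleepEdges (X l).2 + ((X l).1 - 1) : ℕ) : ℝ) + 1 := by
        exact_mod_cast this
      linarith
  have := Finset.sum_le_card_nsmul _ _ _ h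
  simpa using this

theorem sum_range_le_sleepEdges (v : ℕ →₀ ℕ) (K : ℕ) :
    ∑ k ∈ Finset.range K, k * v k ≤ sleepEdges v := by
  have : ∑ k ∈ Finset.range K, k * v k = ∑ k ∈ (Finset.range K).filter (· ∈ v.support), k * v k := by
    rw [Finset.sum_filter]
    refine Finset.sum_congr rfl fun k _ => ?_
    split_ifs with h
    · rfl
    · rw [Finsupp.notMem_support_iff.1 h, mul_zero]
  rw [this, sleepEdges, Finsupp.sum]
  exact Finset.sum_le_sum_of_subset fun k hk => (Finset.mem_filter.1 hk).2

/-- Uniform integrability: for degrees k ≥ K, K k v_k ≤ k² v_k, so the half-edges at vertices of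
degree at least K number at most 1/K times the second moment. -/
theorem mul_sleepEdges_le (v : ℕ →₀ ℕ) (K : ℕ) :
    K * sleepEdges v ≤ K * ∑ k ∈ Finset.range K, k * v k + v.sum fun k m => k ^ 2 * m := by
  have h : K * ∑ k ∈ Finset.range K, k * v k =
      ∑ k ∈ v.support, K * (if k < K then k * v k else 0) := by
    rw [← Finset.mul_sum, ← Finset.sum_filter]
    congr 1
    symm
    refine Finset.sum_subset_zero_on_sdiff (fun k hk => ?_) (fun k hk => ?_) fun _ _ => rfl
    · exact Finset.mem_range.2 (Finset.mem_filter.1 hk).2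
    · rw [Finset.mem_sdiff, Finset.mem_filter, Finset.mem_range] at hk
      have : k ∉ v.support := fun h => hk.2 ⟨h, hk.1⟩
      rw [Finsupp.notMem_support_iff.1 this, mul_zero]
  rw [h, sleepEdges, Finsupp.sum, Finsupp.sum, ← Finset.sum_add_distrib, Finset.mul_sum]
  refine Finset.sum_le_sum fun k _ => ?_
  split_ifs with hk
  · omega
  · push Not at hk
    have : K * (k * v k) ≤ k * (k * v k) := Nat.mul_le_mul_right _ hk
    nlinarith

theorem sum_sq_mono {v w : ℕ →₀ ℕ} (h : ∀ k, v k ≤ w k) :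
    (v.sum fun k m => k ^ 2 * m) ≤ w.sum fun k m => k ^ 2 * m := by
  have hs : v.support ⊆ w.support := fun k hk => by
    rw [Finsupp.mem_support_iff] at hk ⊢
    have := h k
    omega
  rw [Finsupp.sum, Finsupp.sum]
  exact (Finset.sum_le_sum fun k _ => Nat.mul_le_mul_left _ (h k)).trans
    (Finset.sum_le_sum_of_subset hs)

end Paths


/-! ### Limits of rescaled paths along an ultrafilter -/

section UltraLimit

/-- Sequences of paths of edge-exploration chains with compensators vanishing in the limit. -/
structure IsScaled (p : ℕ → ℝ) (B L : ℝ) (U : Ultrafilter ℕ) (n : ℕ → ℕ)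
    (X : ℕ → ℕ → ℕ × (ℕ →₀ ℕ)) : Prop where
  tendsto_n : Tendsto (fun m => (n m : ℝ)) U atTop
  step : ∀ m j, IsStep (X m j) (X m (j + 1))
  active_zero : ∀ m, (X m 0).1 = 0
  moment : ∀ m, (((X m 0).2.sum fun k d => k ^ 2 * d : ℕ) : ℝ) ≤ B * n m
  init : ∀ k, 1 ≤ k → Tendsto (fun m => ((X m 0).2 k : ℝ) / n m) U (𝓝 (p k))
  mart : ∀ k, 1 ≤ k → ∀ j : ℕ → ℕ, (∀ m, (j m : ℝ) ≤ L * n m) →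
    Tendsto (fun m => compensated (X m) k (j m) / n m) U (𝓝 0)

/-- Along one ultrafilter all bounded sequences converge, so limits at every time and every degree
exist simultaneously without extracting subsequences. -/
theorem exists_ultralimit (U : Ultrafilter ℕ) {g : ℕ → ℝ} {C : ℝ} (hg : ∀ m, g m ∈ Icc 0 C) :
    ∃ x, Tendsto g U (𝓝 x) := by
  have : (U.map g : Filter ℝ) ≤ 𝓟 (Icc 0 C) := by
    rw [Filter.le_principal_iff]
    exact mem_map.2 (Filter.univ_mem' hg)
  obtain ⟨x, -, hx⟩ := isCompact_Icc.ultrafilter_le_nhds (U.map g) this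
  exact ⟨x, hx⟩

namespace IsScaled

variable {p : ℕ → ℝ} {B L : ℝ} {U : Ultrafilter ℕ} {n : ℕ → ℕ} {X : ℕ → ℕ → ℕ × (ℕ →₀ ℕ)}

theorem eventually_pos (h : IsScaled p B L U n X) : ∀ᶠ m in (U : Filter ℕ), 0 < (n m : ℝ) :=
  h.tendsto_n.eventually_gt_atTop 0

theorem sum_sq_le (h : IsScaled p B L U n X) (m j : ℕ) :
    (((X m j).2.sum fun k d => k ^ 2 * d : ℕ) : ℝ) ≤ B * n m := by
  refine le_trans ?_ (h.moment m)
  exact_mod_cast sum_sq_mono fun k => apply_antitone (h.step m) k (Nat.zero_le j)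

theorem sleepEdges_le (h : IsScaled p B L U n X) (m j : ℕ) :
    (sleepEdges (X m j).2 : ℝ) ≤ B * n m := by
  refine le_trans ?_ (h.sum_sq_le m j)
  have := mul_sleepEdges_le (X m j).2 1
  simp only [one_mul, Finset.range_one, Finset.sum_singleton, zero_mul, zero_add] at this
  exact_mod_cast this

theorem totalEdges_le (h : IsScaled p B L U n X) (m j : ℕ) :
    (totalEdges (X m j) : ℝ) ≤ B * n m := by
  refine le_trans ?_ (h.sleepEdges_le m 0)
  have h1 : totalEdges (X m j) ≤ totalEdges (X m 0) :=
    totalEdges_antitone (h.step m) (Nat.zero_le j)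
  have h2 : totalEdges (X m 0) = sleepEdges (X m 0).2 := by
    simp [totalEdges, h.active_zero m]
  rw [h2] at h1
  exact_mod_cast h1

theorem startCount_le (h : IsScaled p B L U n X) (m j : ℕ) :
    (startCount (X m) j : ℝ) ≤ B * n m := by
  refine le_trans ?_ (h.sleepEdges_le m 0)
  have h1 := startCount_add_antitone (h.step m) (Nat.zero_le j)
  have h2 : startCount (X m) 0 = 0 := by simp [startCount]
  simp only [h2] at h1
  exact_mod_cast (by omega : startCount (X m) j ≤ sleepEdges (X m 0).2)

theorem apply_le (h : IsScaled p B L U n X) (m j : ℕ) {k : ℕ} (hk : 1 ≤ k) :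
    ((X m j).2 k : ℝ) ≤ B * n m := by
  refine le_trans ?_ (h.sleepEdges_le m j)
  have h1 := sum_range_le_sleepEdges (X m j).2 (k + 1)
  have h2 : k * (X m j).2 k ≤ ∑ l ∈ Finset.range (k + 1), l * (X m j).2 l :=
    Finset.single_le_sum (f := fun l => l * (X m j).2 l) (fun _ _ => Nat.zero_le _) (by simp)
  have h3 : (X m j).2 k ≤ k * (X m j).2 k := Nat.le_mul_of_pos_left _ hk
  exact_mod_cast h3.trans (h2.trans h1)

theorem exists_limit {g : ℕ → ℕ} (hg : ∀ m, (g m : ℝ) ≤ B * n m) :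
    ∃ x, Tendsto (fun m => (g m : ℝ) / n m) U (𝓝 x) := by
  refine exists_ultralimit U (C := max B 0) fun m => ⟨by positivity, ?_⟩
  rcases (n m).eq_zero_or_pos with h0 | h0
  · simp [h0]
  · have : (0 : ℝ) < n m := by exact_mod_cast h0
    exact ((div_le_iff₀ this).2 (hg m)).trans (le_max_left _ _)

/-- The step of the chain which corresponds to the time `t`. -/
noncomputable def index (n : ℕ → ℕ) (t : ℝ) (m : ℕ) : ℕ := ⌊(n m : ℝ) * t⌋₊

theorem index_mono (n : ℕ → ℕ) {s t : ℝ} (hst : s ≤ t) (m : ℕ) : index n s m ≤ index n t m :=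
  Nat.floor_mono (mul_le_mul_of_nonneg_left hst (Nat.cast_nonneg _))

theorem index_le (n : ℕ → ℕ) {t L : ℝ} (ht : t ∈ Icc 0 L) (m : ℕ) :
    (index n t m : ℝ) ≤ L * n m := by
  have := ht.1
  refine (Nat.floor_le (by positivity)).trans ?_
  rw [mul_comm]
  exact mul_le_mul_of_nonneg_right ht.2 (Nat.cast_nonneg _)

theorem tendsto_index (h : IsScaled p B L U n X) {t : ℝ} (ht : 0 ≤ t) :
    Tendsto (fun m => (index n t m : ℝ) / n m) U (𝓝 t) := by
  have := (tendsto_nat_floor_mul_div_atTop ht).comp h.tendsto_n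
  refine this.congr fun m => ?_
  simp [index, mul_comm]

theorem tendsto_index_sub (h : IsScaled p B L U n X) {s t : ℝ} (hs : 0 ≤ s) (hst : s ≤ t) :
    Tendsto (fun m => ((index n t m - index n s m : ℕ) : ℝ) / n m) U (𝓝 (t - s)) := by
  refine ((h.tendsto_index (hs.trans hst)).sub (h.tendsto_index hs)).congr fun m => ?_
  rw [Nat.cast_sub (index_mono n hst m), sub_div]

/-- The limit mass of sleeping half-edges. -/
theorem hasSum_limit (h : IsScaled p B L U n X) {j : ℕ → ℕ} {z : ℕ → ℝ} {w : ℝ}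
    (hz : ∀ k, 1 ≤ k → Tendsto (fun m => ((X m (j m)).2 k : ℝ) / n m) U (𝓝 (z k)))
    (hw : Tendsto (fun m => (sleepEdges (X m (j m)).2 : ℝ) / n m) U (𝓝 w)) :
    HasSum (fun k : ℕ => (k : ℝ) * z k) w := by
  have hpart : ∀ K : ℕ, Tendsto (fun m => ((∑ k ∈ Finset.range K, k * (X m (j m)).2 k : ℕ) : ℝ) /
      n m) U (𝓝 (∑ k ∈ Finset.range K, (k : ℝ) * z k)) := by
    intro K
    have : Tendsto (fun m => ∑ k ∈ Finset.range K, (k : ℝ) * (((X m (j m)).2 k : ℝ) / n m)) U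
        (𝓝 (∑ k ∈ Finset.range K, (k : ℝ) * z k)) := by
      refine tendsto_finsetSum _ fun k _ => ?_
      rcases Nat.eq_zero_or_pos k with rfl | hk
      · simp
      · exact (hz k hk).const_mul _
    refine this.congr fun m => ?_
    push_cast
    rw [Finset.sum_div]
    exact Finset.sum_congr rfl fun k _ => by ring
  have hnn : ∀ k : ℕ, 0 ≤ (k : ℝ) * z k := by
    intro k
    rcases Nat.eq_zero_or_pos k with rfl | hk
    · simp
    · exact mul_nonneg k.cast_nonneg (ge_of_tendsto' (hz k hk) fun m => by positivity)
  rw [hasSum_iff_tendsto_nat_of_nonneg hnn]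
  have hle : ∀ K : ℕ, ∑ k ∈ Finset.range K, (k : ℝ) * z k ≤ w := by
    intro K
    refine le_of_tendsto_of_tendsto' (hpart K) hw fun m => ?_
    refine div_le_div_of_nonneg_right ?_ (Nat.cast_nonneg _)
    exact_mod_cast sum_range_le_sleepEdges _ K
  -- The tail beyond K carries mass at most B/K, so no half-edges escape to infinite degree in the
  -- limit.
  have hge : ∀ K : ℕ, 0 < K → w - B / K ≤ ∑ k ∈ Finset.range K, (k : ℝ) * z k := by
    intro K hK
    have hKr : (0 : ℝ) < K := by exact_mod_cast hK
    refine le_of_tendsto_of_tendsto (hw.sub_const _) (hpart K) ?_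
    filter_upwards [h.eventually_pos] with m hm
    have h1 := mul_sleepEdges_le (X m (j m)).2 K
    have h2 := h.sum_sq_le m (j m)
    have h3 : (K : ℝ) * sleepEdges (X m (j m)).2 ≤
        K * ((∑ k ∈ Finset.range K, k * (X m (j m)).2 k : ℕ) : ℝ) + B * n m := by
      refine le_trans ?_ (add_le_add_right h2 _)
      exact_mod_cast h1
    rw [sub_le_iff_le_add, div_add_div _ _ hm.ne' hKr.ne', div_le_div_iff₀ hm (by positivity)]
    nlinarith
  refine tendsto_of_tendsto_of_tendsto_of_le_of_le' (g := fun K : ℕ => w - B / K)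
    (h := fun _ => w) ?_ tendsto_const_nhds ?_ (Eventually.of_forall hle)
  · simpa using (tendsto_const_div_atTop_nhds_zero_nat B).const_sub w
  · filter_upwards [eventually_gt_atTop 0] with K hK using hge K hK

/-- The limits of the rescaled paths form a fluid trajectory. -/
theorem isFluid (h : IsScaled p B L U n X) {z : ℝ → ℕ → ℝ} {R w : ℝ → ℝ}
    (hz : ∀ t k, 1 ≤ k → Tendsto (fun m => ((X m (index n t m)).2 k : ℝ) / n m) U (𝓝 (z t k)))
    (hR : ∀ t, Tendsto (fun m => (totalEdges (X m (index n t m)) : ℝ) / n m) U (𝓝 (R t)))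
    (hw : ∀ t, Tendsto (fun m => (sleepEdges (X m (index n t m)).2 : ℝ) / n m) U (𝓝 (w t))) :
    IsFluid p L z R := by
  have hmass : ∀ t, sleepMass (z t) = w t := fun t => (h.hasSum_limit (hz t) (hw t)).tsum_eq
  have hi0 : ∀ m, index n 0 m = 0 := fun m => by simp [index]
  have hinit : ∀ k, 1 ≤ k → z 0 k = p k := by
    intro k hk
    refine tendsto_nhds_unique (hz 0 k hk) ?_
    simpa [hi0] using h.init k hk
  have hmart : ∀ k, 1 ≤ k → ∀ t ∈ Icc 0 L,
      Tendsto (fun m => compensated (X m) k (index n t m) / n m) U (𝓝 0) :=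
    fun k hk t ht => h.mart k hk _ (index_le n ht)
  have hdiv : ∀ {a b : ℕ} (m : ℕ), a ≤ b → (a : ℝ) / n m ≤ (b : ℝ) / n m := fun m hab =>
    div_le_div_of_nonneg_right (by exact_mod_cast hab) (Nat.cast_nonneg _)
  have hRanti : ∀ s t, s ≤ t → R t ≤ R s := fun s t hst =>
    le_of_tendsto_of_tendsto' (hR t) (hR s) fun m =>
      hdiv m (totalEdges_antitone (h.step m) (index_mono n hst m))
  refine ⟨hinit, fun k hk s _ t _ hst => ?_, fun k hk t _ => ?_, ?_, fun s _ t _ hst =>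
    hRanti s t hst, fun s hs t ht hst => ?_, fun t _ => ?_, fun s hs t ht hst hlt => ?_,
    fun k hk s hs t ht hst hpos => ?_, fun k hk s hs t ht hst hpos => ?_⟩
  · exact le_of_tendsto_of_tendsto' (hz t k hk) (hz s k hk) fun m =>
      hdiv m (apply_antitone (h.step m) k (index_mono n hst m))
  · exact ge_of_tendsto' (hz t k hk) fun m => by positivity
  · have h1 : R 0 = w 0 := by
      refine tendsto_nhds_unique (hR 0) ((hw 0).congr fun m => ?_)
      simp [hi0, totalEdges, h.active_zero m]
    rw [h1, ← hmass 0]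
    refine tsum_congr fun k => ?_
    rcases Nat.eq_zero_or_pos k with rfl | hk
    · simp
    · rw [hinit k hk]
  · refine le_of_tendsto_of_tendsto' ((hR s).sub (hR t))
      ((h.tendsto_index_sub hs.1 hst).const_mul 2) fun m => ?_
    have := totalEdges_le_add (h.step m) (index_mono n hst m)
    rw [← sub_div, mul_div_assoc']
    refine div_le_div_of_nonneg_right ?_ (Nat.cast_nonneg _)
    rw [sub_le_iff_le_add']
    exact_mod_cast this
  · rw [hmass]
    exact le_of_tendsto_of_tendsto' (hw t) (hR t) fun m => hdiv m (by simp [totalEdges])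
  · rw [hmass] at hlt
    have h1 : R s - R t = 2 * (t - s) := by
      refine tendsto_nhds_unique_of_eventuallyEq ((hR s).sub (hR t))
        ((h.tendsto_index_sub hs.1 hst).const_mul 2) ?_
      filter_upwards [(hw s).eventually_lt (hR t) hlt, h.eventually_pos] with m hm hn
      have hm' : sleepEdges (X m (index n s m)).2 < totalEdges (X m (index n t m)) := by
        rw [div_lt_div_iff_of_pos_right hn] at hm
        exact_mod_cast hm
      -- By monotonicity the sleeping count stays strictly below the total on the whole range of
      -- steps, so active half-edges are always present there.
      have := totalEdges_drop (h.step m) (index_mono n hst m) fun l hl hlt => ?_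
      · rw [this]
        push_cast
        ring
      · have h2 : sleepEdges (X m l).2 ≤ sleepEdges (X m (index n s m)).2 :=
          sleepEdges_antitone (h.step m) hl
        have h3 : totalEdges (X m (index n t m)) ≤ totalEdges (X m l) :=
          totalEdges_antitone (h.step m) hlt.le
        simp only [totalEdges] at h3 hm'
        omega
    linarith
  · have hposs : 0 < R s := hpos.trans_le (hRanti s t hst)
    have hlim1 := (h.tendsto_index_sub hs.1 hst).mul
      (((hz t k hk).const_mul (k : ℝ)).div (hR s) hposs.ne')
    have hlim2 := ((hz s k hk).sub (hz t k hk)).sub ((hmart k hk t ht).sub (hmart k hk s hs))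
    rw [sub_zero, sub_zero] at hlim2
    refine le_of_tendsto_of_tendsto hlim1 hlim2 ?_
    filter_upwards [h.eventually_pos] with m hn
    have h1 := le_sum_wakeProb (h.step m) (index n s m) (index n t m) k
    have h2 := compensated_sub (X := X m) (index_mono n hst m) k
    have e : ((index n t m - index n s m : ℕ) : ℝ) / n m *
        (k * (((X m (index n t m)).2 k : ℝ) / n m) / ((totalEdges (X m (index n s m)) : ℝ) / n m)) =
        ((index n t m - index n s m : ℕ) : ℝ) *
        (k * (X m (index n t m)).2 k / totalEdges (X m (index n s m))) / n m := by
      rw [mul_div_assoc' (k : ℝ), div_div_div_cancel_right₀ hn.ne']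
      ring
    simp only [Pi.div_apply]
    rw [e, ← sub_div, ← sub_div, ← sub_div]
    exact div_le_div_of_nonneg_right (by linarith) hn.le
  · have hinv : Tendsto (fun m => (1 : ℝ) / n m) U (𝓝 0) := tendsto_const_nhds.div_atTop h.tendsto_n
    have hR1 := (hR t).sub hinv
    rw [sub_zero] at hR1
    have hlim1 := (h.tendsto_index_sub hs.1 hst).mul
      (((hz s k hk).const_mul (k : ℝ)).div hR1 hpos.ne')
    have hlim2 := ((hz s k hk).sub (hz t k hk)).sub ((hmart k hk t ht).sub (hmart k hk s hs))
    rw [sub_zero, sub_zero] at hlim2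
    refine le_of_tendsto_of_tendsto hlim2 hlim1 ?_
    filter_upwards [h.eventually_pos, hR1.eventually (lt_mem_nhds hpos)] with m hn hm
    rw [← sub_div] at hm
    have hm' : 1 < totalEdges (X m (index n t m)) := by
      have := (div_pos_iff_of_pos_right hn).1 hm
      exact_mod_cast sub_pos.1 this
    have h1 := sum_wakeProb_le (h.step m) (index n s m) k hm'
    have h2 := compensated_sub (X := X m) (index_mono n hst m) k
    have e : ((index n t m - index n s m : ℕ) : ℝ) / n m *
        (k * (((X m (index n s m)).2 k : ℝ) / n m) /
          ((totalEdges (X m (index n t m)) : ℝ) / n m - 1 / n m)) =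
        ((index n t m - index n s m : ℕ) : ℝ) *
        (k * (X m (index n s m)).2 k / ((totalEdges (X m (index n t m)) : ℝ) - 1)) / n m := by
      rw [mul_div_assoc' (k : ℝ), ← sub_div, div_div_div_cancel_right₀ hn.ne']
      ring
    simp only [Pi.div_apply]
    rw [e, ← sub_div, ← sub_div, ← sub_div]
    exact div_le_div_of_nonneg_right (by linarith) hn.le

/-- Antitone functions which converge pointwise to a continuous limit converge along moving
indices. -/
theorem tendsto_moving (h : IsScaled p B L U n X) {g : ℕ → ℕ → ℝ} (hg : ∀ m, Antitone (g m))
    {G : ℝ → ℝ} (hG : Continuous G)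
    (hlim : ∀ t ∈ Icc 0 L, Tendsto (fun m => g m (index n t m) / n m) U (𝓝 (G t)))
    {j : ℕ → ℕ} {t : ℝ} (ht : t ∈ Ico 0 L)
    (hj : Tendsto (fun m => (j m : ℝ) / n m) U (𝓝 t)) :
    Tendsto (fun m => g m (j m) / n m) U (𝓝 (G t)) := by
  rw [tendsto_order]
  constructor
  · intro a ha
    -- The moving index is sandwiched between the indices of fixed times on either side of t; the
    -- room to the right is why t < L is required.
    have h1 : ∀ᶠ s in 𝓝[>] t, a < G s ∧ s ∈ Ioo t L :=
      ((hG.tendsto t).eventually (lt_mem_nhds ha)).filter_mono nhdsWithin_le_nhds |>.and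
        (Ioo_mem_nhdsGT ht.2)
    obtain ⟨s, hs, hsI⟩ := h1.exists
    have hsL : s ∈ Icc 0 L := ⟨ht.1.trans hsI.1.le, hsI.2.le⟩
    filter_upwards [(hlim s hsL).eventually (lt_mem_nhds hs), hj.eventually (gt_mem_nhds hsI.1),
      h.eventually_pos] with m hm1 hm2 hn
    refine hm1.trans_le (div_le_div_of_nonneg_right (hg m (Nat.le_floor ?_)) hn.le)
    rw [div_lt_iff₀ hn] at hm2
    linarith
  · intro b hb
    rcases ht.1.eq_or_lt with h0 | h0
    · subst h0
      filter_upwards [(hlim 0 ⟨le_rfl, ht.2.le⟩).eventually (gt_mem_nhds hb),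
        h.eventually_pos] with m hm1 hn
      refine lt_of_le_of_lt (div_le_div_of_nonneg_right (hg m ?_) hn.le) hm1
      simp [index]
    · have h1 : ∀ᶠ s in 𝓝[<] t, G s < b ∧ s ∈ Ioo 0 t :=
        ((hG.tendsto t).eventually (gt_mem_nhds hb)).filter_mono nhdsWithin_le_nhds |>.and
          (Ioo_mem_nhdsLT h0)
      obtain ⟨s, hs, hsI⟩ := h1.exists
      have hsL : s ∈ Icc 0 L := ⟨hsI.1.le, hsI.2.le.trans ht.2.le⟩
      filter_upwards [(hlim s hsL).eventually (gt_mem_nhds hs), hj.eventually (lt_mem_nhds hsI.2),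
        h.eventually_pos] with m hm1 hm2 hn
      refine lt_of_le_of_lt (div_le_div_of_nonneg_right (hg m (Nat.floor_le_of_le ?_)) hn.le) hm1
      rw [lt_div_iff₀ hn] at hm2
      linarith

/-- Convergence of the rescaled paths along moving indices. -/
theorem tendsto_limit (h : IsScaled p B L U n X) (hp : IsDegreeDistribution p)
    (h2 : Summable fun k : ℕ => (k : ℝ) ^ 2 * p k) {j : ℕ → ℕ} {t : ℝ} (ht : t ∈ Ico 0 L)
    (hj : Tendsto (fun m => (j m : ℝ) / n m) U (𝓝 t)) :
    (∀ k, 1 ≤ k → Tendsto (fun m => ((X m (j m)).2 k : ℝ) / n m) U (𝓝 (zetaLim p t k))) ∧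
    Tendsto (fun m => (((X m (j m)).1 : ℝ) - 1) / n m) U (𝓝 (zetaLim p t 0)) ∧
    Tendsto (fun m => (((X m (j m)).1 : ℝ) - 1) / n m - 2 / n m * startCount (X m) (j m)) U
      (𝓝 (psiLim p t)) := by
  have h1 := summable_first_moment hp h2
  choose! z hz using fun (t : ℝ) (k : ℕ) (hk : 1 ≤ k) =>
    exists_limit (U := U) (n := n) (B := B) (g := fun m => (X m (index n t m)).2 k) fun m => h.apply_le m _ hk
  choose R hR using fun t : ℝ =>
    exists_limit (U := U) (n := n) (B := B) (g := fun m => totalEdges (X m (index n t m))) fun m => h.totalEdges_le m _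
  choose w hw using fun t : ℝ =>
    exists_limit (U := U) (n := n) (B := B) (g := fun m => sleepEdges (X m (index n t m)).2) fun m => h.sleepEdges_le m _
  choose c hc using fun t : ℝ =>
    exists_limit (U := U) (n := n) (B := B) (g := fun m => startCount (X m) (index n t m)) fun m => h.startCount_le m _
  have hfluid := h.isFluid hz hR hw
  have hlim : ∀ t ∈ Icc 0 L, R t = uLim p t * kap p (uLim p t) ∧ w t = sleepMass (zetaU p t) ∧
      ∀ k, 1 ≤ k → z t k = zetaU p t k := by
    intro t ht
    obtain ⟨hR', hz'⟩ := hfluid.eq_limit hp h1 ht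
    have hz'' : ∀ k, 1 ≤ k → z t k = zetaU p t k := fun k hk => by
      rw [hz' k hk, zetaU, if_neg (by omega)]
    refine ⟨hR', ?_, hz''⟩
    rw [← (h.hasSum_limit (hz t) (hw t)).tsum_eq]
    refine tsum_congr fun k => ?_
    rcases Nat.eq_zero_or_pos k with rfl | hk
    · simp
    · rw [hz'' k hk]
  -- The expected regulator; 2c, with c the limit of the rescaled number of starts, must equal it.
  set η : ℝ → ℝ := fun t => uLim p t * kap p (uLim p t) - mean p + 2 * Phi p (uLim p t) with hη
  have hu := continuous_uLim hp h1
  have hkc : Continuous fun t => uLim p t * kap p (uLim p t) := by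
    refine hu.mul ?_
    rw [← continuousOn_univ]
    exact (continuousOn_kap hp h1).comp hu.continuousOn fun t _ => uLim_mem hp h1 t
  have hηc : Continuous η := by
    refine (hkc.sub continuous_const).add (continuous_const.mul ?_)
    rw [← continuousOn_univ]
    exact (continuousOn_Phi hp h1).comp hu.continuousOn fun t _ => uLim_mem hp h1 t
  have hwc : Continuous fun t => sleepMass (zetaU p t) := by
    simp only [sleepMass_zetaU hp h1]
    refine (continuous_const.mul hu).mul ?_
    rw [← continuousOn_univ]
    exact (continuousOn_G1 hp h1).comp hu.continuousOn fun t _ => uLim_mem hp h1 t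
  -- Before extinction half-edges remain with eventual certainty, and the exact balance of
  -- half-edges determines the number of starts.
  have hcpos : ∀ t ∈ Icc 0 L, t < Phi p 0 → c t = η t / 2 := by
    intro t ht hlt
    have hRt : 0 < R t := by
      rw [(hlim t ht).1, ← totalMass_zetaU hp h1]
      exact (totalMass_zetaU_pos_iff hp h1 t).2 hlt
    have hR0 : R 0 = mean p := hfluid.R_zero
    have hi0 : ∀ m, index n 0 m = 0 := fun m => by simp [index]
    have e : R t + 2 * t = R 0 + 2 * c t := by
      refine tendsto_nhds_unique_of_eventuallyEq ((hR t).add ((h.tendsto_index ht.1).const_mul 2))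
        ((hR 0).add ((hc t).const_mul 2)) ?_
      filter_upwards [(hR t).eventually (lt_mem_nhds hRt), h.eventually_pos] with m hm hn
      have hm' : 0 < totalEdges (X m (index n t m)) := by
        have := (div_pos_iff_of_pos_right hn).1 hm
        exact_mod_cast this
      have h3 := totalEdges_add_eq (h.step m) hm'
      have h4 : (totalEdges (X m (index n t m)) : ℝ) + 2 * index n t m =
          totalEdges (X m 0) + 2 * startCount (X m) (index n t m) := by exact_mod_cast h3
      rw [hi0, mul_div_assoc', mul_div_assoc', ← add_div, ← add_div, h4]
    have e2 : Phi p (uLim p t) = t := by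
      rw [Phi_uLim hp h1, max_eq_left ht.1, min_eq_left hlt.le]
    rw [(hlim t ht).1, hR0] at e
    simp only [hη]
    rw [e2]
    linarith
  have hcmono : ∀ s t, s ≤ t → c s ≤ c t := fun s t hst =>
    le_of_tendsto_of_tendsto' (hc s) (hc t) fun m => div_le_div_of_nonneg_right
      (by exact_mod_cast startCount_mono (X m) (index_mono n hst m)) (Nat.cast_nonneg _)
  have hcle : ∀ s t, s ≤ t → c t + w t ≤ c s + w s := fun s t hst =>
    le_of_tendsto_of_tendsto' ((hc t).add (hw t)) ((hc s).add (hw s)) fun m => by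
      rw [← add_div, ← add_div]
      refine div_le_div_of_nonneg_right ?_ (Nat.cast_nonneg _)
      exact_mod_cast startCount_add_antitone (h.step m) (index_mono n hst m)
  have hceq : ∀ t ∈ Icc 0 L, c t = η t / 2 := by
    intro t ht
    rcases lt_or_ge t (Phi p 0) with hlt | hge
    · exact hcpos t ht hlt
    -- After extinction the balance fails. There c is caught between two monotonicities as s ↑ t0: c
    -- is nondecreasing, and c + w is nonincreasing with w = 0 from t0 on.
    set t0 := Phi p 0 with ht0
    have ht0pos : 0 < t0 := Phi_zero_pos hp h1
    have hηt : η t = η t0 := by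
      simp only [hη]
      rw [uLim_eq_zero hp h1 hge, uLim_eq_zero hp h1 le_rfl]
    have hwt : w t = 0 := by
      rw [(hlim t ht).2.1, sleepMass_zetaU hp h1, uLim_eq_zero hp h1 hge]; simp
    have hw0 : sleepMass (zetaU p t0) = 0 := by
      rw [sleepMass_zetaU hp h1, uLim_eq_zero hp h1 le_rfl]; simp
    have hnear : ∀ᶠ s in 𝓝[<] t0, s ∈ Ioo 0 t0 := Ioo_mem_nhdsLT ht0pos
    rw [hηt]
    refine le_antisymm ?_ ?_
    · have hl : Tendsto (fun s => η s / 2 + sleepMass (zetaU p s)) (𝓝[<] t0)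
          (𝓝 (η t0 / 2 + sleepMass (zetaU p t0))) :=
        (((hηc.div_const 2).add hwc).tendsto t0).mono_left nhdsWithin_le_nhds
      rw [hw0, add_zero] at hl
      refine ge_of_tendsto hl (hnear.mono fun s hs => ?_)
      have hsI : s ∈ Icc 0 L := ⟨hs.1.le, hs.2.le.trans (hge.trans ht.2)⟩
      have h3 := hcle s t (hs.2.le.trans hge)
      rw [hwt, add_zero, hcpos s hsI hs.2, (hlim s hsI).2.1] at h3
      exact h3
    · have hl : Tendsto (fun s => η s / 2) (𝓝[<] t0) (𝓝 (η t0 / 2)) :=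
        ((hηc.div_const 2).tendsto t0).mono_left nhdsWithin_le_nhds
      refine le_of_tendsto hl (hnear.mono fun s hs => ?_)
      have hsI : s ∈ Icc 0 L := ⟨hs.1.le, hs.2.le.trans (hge.trans ht.2)⟩
      rw [← hcpos s hsI hs.2]
      exact hcmono s t (hs.2.le.trans hge)
  have hzm : ∀ k, 1 ≤ k →
      Tendsto (fun m => ((X m (j m)).2 k : ℝ) / n m) U (𝓝 (zetaU p t k)) := fun k hk =>
    h.tendsto_moving (g := fun m i => ((X m i).2 k : ℝ)) (G := fun t => zetaU p t k)
      (fun m a b hab => Nat.cast_le.2 (apply_antitone (h.step m) k hab))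
      ((continuous_apply k).comp (continuous_zetaU hp h1))
      (fun s hs => by rw [← (hlim s hs).2.2 k hk]; exact hz s k hk) ht hj
  have hRm : Tendsto (fun m => (totalEdges (X m (j m)) : ℝ) / n m) U
      (𝓝 (uLim p t * kap p (uLim p t))) :=
    h.tendsto_moving (g := fun m i => (totalEdges (X m i) : ℝ))
      (fun m a b hab => Nat.cast_le.2 (totalEdges_antitone (h.step m) hab)) hkc
      (fun s hs => by rw [← (hlim s hs).1]; exact hR s) ht hj
  have hwm : Tendsto (fun m => (sleepEdges (X m (j m)).2 : ℝ) / n m) U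
      (𝓝 (sleepMass (zetaU p t))) :=
    h.tendsto_moving (g := fun m i => (sleepEdges (X m i).2 : ℝ))
      (fun m a b hab => Nat.cast_le.2 (sleepEdges_antitone (h.step m) hab)) hwc
      (fun s hs => by rw [← (hlim s hs).2.1]; exact hw s) ht hj
  have hcm : Tendsto (fun m => -(startCount (X m) (j m) : ℝ) / n m) U (𝓝 (-(η t / 2))) :=
    h.tendsto_moving (g := fun m i => -(startCount (X m) i : ℝ)) (G := fun t => -(η t / 2))
      (fun m a b hab => neg_le_neg (by exact_mod_cast startCount_mono (X m) hab))
      (hηc.div_const 2).neg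
      (fun s hs => by
        rw [← hceq s hs]
        exact (hc s).neg.congr fun m => by rw [neg_div]) ht hj
  have hinv : Tendsto (fun m => (1 : ℝ) / n m) U (𝓝 0) := tendsto_const_nhds.div_atTop h.tendsto_n
  have ham : Tendsto (fun m => (((X m (j m)).1 : ℝ) - 1) / n m) U (𝓝 (zetaU p t 0)) := by
    have h3 := (hRm.sub hwm).sub hinv
    rw [sub_zero, ← zetaU_zero_add hp h1, add_sub_cancel_right] at h3
    refine h3.congr fun m => ?_
    rw [← sub_div, ← sub_div]
    simp [totalEdges]
  rw [zetaLim_eq_zetaU hp h2 ht.1]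
  refine ⟨hzm, ham, ?_⟩
  have h3 := ham.add (hcm.const_mul 2)
  have e : zetaU p t 0 + 2 * -(η t / 2) = psiLim p t := by
    have e2 : Phi p (uLim p t) = min t (Phi p 0) := by
      rw [Phi_uLim hp h1, max_eq_left ht.1]
    rw [psiLim_eq hp h2 ht.1, ← e2]
    simp only [hη]
    linarith [zetaU_zero_add hp h1 t]
  rw [e] at h3
  refine h3.congr fun m => ?_
  ring

end IsScaled

end UltraLimit


/-! ### The edge-exploration chain -/

section Chain

variable {x y : ℕ × (ℕ →₀ ℕ)}

/-- Truncated subtraction does no harm: pure pairing has weight (a - 1)⁺, which is 0 unless a ≥ 2,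
and a waking move has k ≥ 1, so a + k ≥ 2 when a > 0. -/
theorem isStep_of_stepProb_ne_zero (h : stepProb x y ≠ 0) : IsStep x y := by
  unfold stepProb at h
  split_ifs at h with h0 h1 h2
  · exact Or.inl ⟨h0.1, h0.2, h1⟩
  · exact absurd rfl h
  · have hu : ∀ k, 1 ≤ k → x.1 + k - 2 + 2 = x.1 + k := fun k hk => by omega
    rcases not_and_or.1 (mt (fun h => add_eq_zero.2 h) h) with h | h
    · by_cases hy : y = (x.1 - 2, x.2)
      · rw [if_pos hy] at h
        by_cases hx : 2 ≤ x.1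
        · exact Or.inr (Or.inl ⟨hx, hy⟩)
        · rw [show x.1 - 1 = 0 by omega] at h; simp at h
      · rw [if_neg hy] at h; exact absurd rfl h
    · obtain ⟨k, -, hk⟩ := Finset.exists_ne_zero_of_sum_ne_zero h
      by_cases hy : y = (x.1 + k - 2, x.2 - Finsupp.single k 1)
      · rw [if_pos hy] at hk
        have : k * x.2 k ≠ 0 := fun h => by rw [h] at hk; simp at hk
        have h1 := Nat.pos_of_ne_zero (left_ne_zero_of_mul this)
        refine Or.inr (Or.inr ⟨k, h1, Nat.pos_of_ne_zero (right_ne_zero_of_mul this), by rw [hy], ?_⟩)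
        rw [if_pos h2, hy]; exact hu k h1
      · rw [if_neg hy] at hk; exact absurd rfl hk
  · rcases not_and_or.1 (mt (fun h => add_eq_zero.2 h) h) with h | h
    · rw [show x.1 - 1 = 0 by omega] at h; simp at h
    · obtain ⟨k, -, hk⟩ := Finset.exists_ne_zero_of_sum_ne_zero h
      by_cases hy : y = (x.1 + k - 0, x.2 - Finsupp.single k 1)
      · rw [if_pos hy] at hk
        have : k * x.2 k ≠ 0 := fun h => by rw [h] at hk; simp at hk
        have h1 := Nat.pos_of_ne_zero (left_ne_zero_of_mul this)
        refine Or.inr (Or.inr ⟨k, h1, Nat.pos_of_ne_zero (right_ne_zero_of_mul this), by rw [hy], ?_⟩)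
        rw [if_neg h2, hy]; simp
      · rw [if_neg hy] at hk; exact absurd rfl hk

theorem mul_apply_le_sleepEdges (v : ℕ →₀ ℕ) (k : ℕ) : k * v k ≤ sleepEdges v := by
  refine le_trans ?_ (sum_range_le_sleepEdges v (k + 1))
  exact Finset.single_le_sum (f := fun k => k * v k) (fun _ _ => Nat.zero_le _) (by simp)

theorem wakeProb_le_one (k : ℕ) (x : ℕ × (ℕ →₀ ℕ)) : wakeProb k x ≤ 1 := by
  refine div_le_one_of_le₀ ?_ (Nat.cast_nonneg _)
  exact_mod_cast (mul_apply_le_sleepEdges x.2 k).trans (Nat.le_add_right _ _)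

/-- The count of degree k changes only when a vertex of that degree wakes, which leads to a single
target state. -/
theorem indicator_stepProb (x : ℕ × (ℕ →₀ ℕ)) (k : ℕ) (y : ℕ × (ℕ →₀ ℕ)) :
    {y : ℕ × (ℕ →₀ ℕ) | y.2 k ≠ x.2 k}.indicator (fun y => (stepProb x y : ℝ≥0∞)) y =
      if y = (x.1 + k - (if 0 < x.1 then 2 else 0), x.2 - Finsupp.single k 1) then
        ENNReal.ofReal (wakeProb k x) else 0 := by
  by_cases hv : x.2 k = 0
  · have : wakeProb k x = 0 := by simp [wakeProb, hv]
    rw [this, ENNReal.ofReal_zero, ite_self, Set.indicator_apply_eq_zero]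
    intro hy
    by_contra h
    have := (isStep_of_stepProb_ne_zero (x := x) (y := y) (by simpa using h)).apply_le k
    exact hy (by omega)
  · by_cases hy : y.2 k = x.2 k
    · rw [Set.indicator_of_notMem (by simpa using hy), if_neg]
      rintro rfl
      simp at hy
      omega
    · rw [Set.indicator_of_mem (by simpa using hy)]
      unfold stepProb
      have h0 : ¬ (x.1 = 0 ∧ x.2 = 0) := fun h => hv (by rw [h.2]; rfl)
      rw [if_neg h0]
      simp only
      rw [if_neg (fun h => hy (by rw [h])), zero_add, Finset.sum_eq_single k]
      · split_ifs
        all_goals try rfl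
        all_goals
          rw [wakeProb, ENNReal.ofReal, Real.toNNReal_div (by positivity), Real.toNNReal_natCast,
            Real.toNNReal_natCast, sleepEdges]
      · intro j _ hj
        rw [if_neg]
        rintro rfl
        simp [hj] at hy
      · intro hk
        exact absurd (Finsupp.notMem_support_iff.1 hk) hv

theorem tsum_indicator_stepProb (x : ℕ × (ℕ →₀ ℕ)) (k : ℕ) :
    ∑' y, {y : ℕ × (ℕ →₀ ℕ) | y.2 k ≠ x.2 k}.indicator (fun y => (stepProb x y : ℝ≥0∞)) y =
      ENNReal.ofReal (wakeProb k x) := by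
  simp_rw [indicator_stepProb]
  exact tsum_ite_eq _ _

variable {Ω : Type*} [MeasurableSpace Ω] {μ : Measure Ω} {n : ℕ} {d : Fin n → ℕ}
  {A : ℕ → Ω → ℕ} {V : ℕ → Ω → ℕ →₀ ℕ}

/-- The path of the exploration chain. -/
def chainPath (A : ℕ → Ω → ℕ) (V : ℕ → Ω → ℕ →₀ ℕ) (ω : Ω) (j : ℕ) : ℕ × (ℕ →₀ ℕ) :=
  (A j ω, V j ω)

/-- A finite path, continued by zero. -/
def extendPath {m : ℕ} (z : Fin m → ℕ × (ℕ →₀ ℕ)) (i : ℕ) : ℕ × (ℕ →₀ ℕ) :=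
  if h : i < m then z ⟨i, h⟩ else 0

theorem extendPath_restrict (X : ℕ → ℕ × (ℕ →₀ ℕ)) {m i : ℕ} (h : i < m) :
    extendPath (fun l : Fin m => X l) i = X i := by
  rw [extendPath, dif_pos h]

namespace IsEdgeExploration

theorem measurableSet_eq (h : IsEdgeExploration μ d A V) (j : ℕ) (x : ℕ × (ℕ →₀ ℕ)) :
    MeasurableSet {ω | chainPath A V ω j = x} := by
  have : {ω | chainPath A V ω j = x} = {ω | A j ω = x.1} ∩ ⋂ k, {ω | V j ω k = x.2 k} := by
    ext ω
    simp [chainPath, Prod.ext_iff, Finsupp.ext_iff]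
  rw [this]
  exact (h.meas_A j (measurableSet_singleton _)).inter
    (MeasurableSet.iInter fun k => h.meas_V j k (measurableSet_singleton _))

theorem measurableSet_path (h : IsEdgeExploration μ d A V) (j : ℕ) (x : ℕ → ℕ × (ℕ →₀ ℕ)) :
    MeasurableSet {ω | ∀ i ≤ j, chainPath A V ω i = x i} := by
  have : {ω | ∀ i ≤ j, chainPath A V ω i = x i} =
      ⋂ i, ⋂ (_ : i ≤ j), {ω | chainPath A V ω i = x i} := by
    ext ω; simp
  rw [this]
  exact MeasurableSet.iInter fun i => MeasurableSet.iInter fun _ => h.measurableSet_eq i _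

/-- The state space is countable, so every function of the state is measurable. -/
theorem measurable_comp (h : IsEdgeExploration μ d A V) (j : ℕ) {β : Type*} [MeasurableSpace β]
    (g : ℕ × (ℕ →₀ ℕ) → β) : Measurable fun ω => g (chainPath A V ω j) := by
  intro s _
  have : (fun ω => g (chainPath A V ω j)) ⁻¹' s =
      ⋃ x ∈ g ⁻¹' s, {ω | chainPath A V ω j = x} := by
    ext ω; simp
  rw [this]
  exact MeasurableSet.biUnion (Set.to_countable _) fun x _ => h.measurableSet_eq j x

theorem ae_isStep (h : IsEdgeExploration μ d A V) :
    ∀ᵐ ω ∂μ, ∀ j, IsStep (chainPath A V ω j) (chainPath A V ω (j + 1)) := by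
  rw [ae_all_iff]
  intro j
  -- Only finite histories are quantified over: there are countably many, so null sets can be
  -- collected.
  have : ∀ᵐ ω ∂μ, ∀ z : Fin (j + 2) → ℕ × (ℕ →₀ ℕ),
      (∀ i ≤ j + 1, chainPath A V ω i = extendPath z i) →
        IsStep (extendPath z j) (extendPath z (j + 1)) := by
    rw [ae_all_iff]
    intro z
    by_cases hs : stepProb (extendPath z j) (extendPath z (j + 1)) = 0
    · have := h.markov j (extendPath z)
      rw [hs, ENNReal.coe_zero, mul_zero] at this
      filter_upwards [measure_eq_zero_iff_ae_notMem.1 this] with ω hω h'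
      exact absurd h' hω
    · exact Eventually.of_forall fun _ _ => isStep_of_stepProb_ne_zero hs
  filter_upwards [this] with ω hω
  have := hω (fun l => chainPath A V ω l) fun i hi => (extendPath_restrict _ (by omega)).symm
  rwa [extendPath_restrict _ (by omega), extendPath_restrict _ (by omega)] at this

/-- Countable additivity extends the Markov property from single next states to sets of them. -/
theorem measure_path_inter (h : IsEdgeExploration μ d A V) (j : ℕ) (x : ℕ → ℕ × (ℕ →₀ ℕ))
    (C : Set (ℕ × (ℕ →₀ ℕ))) :
    μ ({ω | chainPath A V ω (j + 1) ∈ C} ∩ {ω | ∀ i ≤ j, chainPath A V ω i = x i}) =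
      μ {ω | ∀ i ≤ j, chainPath A V ω i = x i} *
        ∑' y, C.indicator (fun y => (stepProb (x j) y : ℝ≥0∞)) y := by
  have h1 := tsum_measure_preimage_singleton
    (μ := μ.restrict {ω | ∀ i ≤ j, chainPath A V ω i = x i})
    (f := fun ω => chainPath A V ω (j + 1)) C.to_countable
    (fun y _ => h.measurableSet_eq (j + 1) y)
  rw [Measure.restrict_apply] at h1
  swap
  · let _ : MeasurableSpace (ℕ × (ℕ →₀ ℕ)) := ⊤
    exact h.measurable_comp (j + 1) id trivial
  refine h1.symm.trans ?_
  rw [← tsum_subtype C fun y => (stepProb (x j) y : ℝ≥0∞), ← ENNReal.tsum_mul_left]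
  refine tsum_congr fun y => ?_
  rw [Measure.restrict_apply (by exact h.measurableSet_eq (j + 1) y)]
  have h2 := h.markov j (Function.update x (j + 1) y)
  rw [Function.update_self, Function.update_of_ne (by omega)] at h2
  have h3 : {ω | ∀ i ≤ j + 1, (A i ω, V i ω) = Function.update x (j + 1) (y : ℕ × (ℕ →₀ ℕ)) i} =
      (fun ω => chainPath A V ω (j + 1)) ⁻¹' {(y : ℕ × (ℕ →₀ ℕ))} ∩
        {ω | ∀ i ≤ j, chainPath A V ω i = x i} := by
    ext ω
    constructor
    · intro hω
      refine ⟨by simpa [chainPath] using hω (j + 1) le_rfl, fun i hi => ?_⟩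
      have := hω i (by omega)
      rwa [Function.update_of_ne (by omega)] at this
    · rintro ⟨h1, h2⟩ i hi
      rcases Nat.lt_or_ge j i with hij | hij
      · obtain rfl : i = j + 1 := by omega
        simpa [chainPath] using h1
      · rw [Function.update_of_ne (by omega)]
        exact h2 i hij
  have h4 : {ω | ∀ i ≤ j, (A i ω, V i ω) = Function.update x (j + 1) (y : ℕ × (ℕ →₀ ℕ)) i} =
      {ω | ∀ i ≤ j, chainPath A V ω i = x i} := by
    ext ω
    refine forall₂_congr fun i hi => ?_
    rw [Function.update_of_ne (by omega)]
    rfl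
  rw [h3, h4] at h2
  exact h2

/-- Given the path up to step `j`, the compensated increment has mean zero. -/
theorem setIntegral_path (h : IsEdgeExploration μ d A V) [IsProbabilityMeasure μ] (j k : ℕ)
    (x : ℕ → ℕ × (ℕ →₀ ℕ)) :
    ∫ ω in {ω | ∀ i ≤ j, chainPath A V ω i = x i}, ((((chainPath A V ω j).2 k : ℝ) -
      (chainPath A V ω (j + 1)).2 k) - wakeProb k (chainPath A V ω j)) ∂μ = 0 := by
  have hE := h.measurableSet_path j x
  set E := {ω | ∀ i ≤ j, chainPath A V ω i = x i} with hEdef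
  set C : Set (ℕ × (ℕ →₀ ℕ)) := {y | y.2 k ≠ (x j).2 k} with hC
  have hD : MeasurableSet {ω | chainPath A V ω (j + 1) ∈ C} := by
    let _ : MeasurableSpace (ℕ × (ℕ →₀ ℕ)) := ⊤
    exact h.measurable_comp (j + 1) id (t := C) trivial
  -- Almost surely a step lowers the count by 0 or 1, so the decrement is the indicator of a change.
  have h1 : ∫ ω in E, ((((chainPath A V ω j).2 k : ℝ) -
      (chainPath A V ω (j + 1)).2 k) - wakeProb k (chainPath A V ω j)) ∂μ =
      ∫ ω in E, ({ω | chainPath A V ω (j + 1) ∈ C}.indicator (fun _ => (1 : ℝ)) ω -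
        wakeProb k (x j)) ∂μ := by
    refine setIntegral_congr_ae hE ?_
    filter_upwards [h.ae_isStep] with ω hω hωE
    have e := hωE j le_rfl
    have a := (hω j).apply_le k
    have b := (hω j).le_apply_add_one k
    rw [e] at a b ⊢
    by_cases hc : chainPath A V ω (j + 1) ∈ C
    · rw [Set.indicator_of_mem (by exact hc)]
      have : (x j).2 k = (chainPath A V ω (j + 1)).2 k + 1 := by
        have : (chainPath A V ω (j + 1)).2 k ≠ (x j).2 k := hc
        omega
      rw [this]; push_cast; ring
    · rw [Set.indicator_of_notMem (by exact hc)]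
      have : (chainPath A V ω (j + 1)).2 k = (x j).2 k := not_not.1 hc
      rw [this]; ring
  have hm : μ ({ω | chainPath A V ω (j + 1) ∈ C} ∩ E) =
      μ E * ENNReal.ofReal (wakeProb k (x j)) := by
    rw [← tsum_indicator_stepProb]; exact h.measure_path_inter j x C
  rw [h1, integral_sub ((integrable_const 1).indicator hD) (integrable_const _),
    integral_indicator hD, setIntegral_const, integral_const, measureReal_restrict_apply hD,
    measureReal_restrict_apply MeasurableSet.univ, univ_inter, measureReal_def, hm,
    ENNReal.toReal_mul, ENNReal.toReal_ofReal (wakeProb_nonneg _ _), measureReal_def]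
  simp

theorem measurable_compensated (h : IsEdgeExploration μ d A V) (j k : ℕ) :
    Measurable fun ω => compensated (chainPath A V ω) k j := by
  unfold compensated
  refine Finset.measurable_sum _ fun i _ => ?_
  exact ((h.measurable_comp i fun x => (x.2 k : ℝ)).sub
    (h.measurable_comp (i + 1) fun x => (x.2 k : ℝ))).sub (h.measurable_comp i (wakeProb k))

end IsEdgeExploration

/-! ### Martingale estimates for the compensated counts -/

theorem IsStep.abs_increment_le (h : IsStep x y) (k : ℕ) :
    |(x.2 k : ℝ) - y.2 k - wakeProb k x| ≤ 1 := by
  have a : (y.2 k : ℝ) ≤ x.2 k := by exact_mod_cast h.apply_le k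
  have b : (x.2 k : ℝ) ≤ y.2 k + 1 := by exact_mod_cast h.le_apply_add_one k
  have c := wakeProb_nonneg k x
  have e := wakeProb_le_one k x
  rw [abs_le]
  constructor <;> linarith

theorem compensated_succ (X : ℕ → ℕ × (ℕ →₀ ℕ)) (k j : ℕ) : compensated X k (j + 1) =
    compensated X k j + (((X j).2 k : ℝ) - (X (j + 1)).2 k - wakeProb k (X j)) := by
  rw [compensated, Finset.sum_range_succ, ← compensated]

theorem abs_compensated_sub_le {X : ℕ → ℕ × (ℕ →₀ ℕ)} (hX : ∀ j, IsStep (X j) (X (j + 1)))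
    (k : ℕ) {i j : ℕ} (hij : i ≤ j) :
    |compensated X k j - compensated X k i| ≤ (j : ℝ) - i := by
  induction j, hij using Nat.le_induction with
  | base => simp
  | succ j hij ih =>
    rw [compensated_succ]
    have := (hX j).abs_increment_le k
    rw [abs_le] at *
    push_cast
    constructor <;> linarith

theorem abs_compensated_le {X : ℕ → ℕ × (ℕ →₀ ℕ)} (hX : ∀ j, IsStep (X j) (X (j + 1)))
    (k j : ℕ) : |compensated X k j| ≤ j := by
  simpa [compensated] using abs_compensated_sub_le hX k (Nat.zero_le j)

theorem integral_eq_zero_of_fiber {ι : Type*} [Countable ι] {Z : Ω → ι} {g : Ω → ℝ}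
    (hZ : ∀ z, MeasurableSet {ω | Z ω = z}) (hg : Integrable g μ)
    (h : ∀ z, ∫ ω in {ω | Z ω = z}, g ω ∂μ = 0) : ∫ ω, g ω ∂μ = 0 := by
  have hu : ⋃ z, {ω | Z ω = z} = univ := by ext; simp
  have := hasSum_integral_iUnion (μ := μ) (f := g) hZ
    (fun a b hab => Set.disjoint_left.2 fun ω h1 h2 => hab (h1.symm.trans h2)) hg.integrableOn
  rw [hu, setIntegral_univ] at this
  simp_rw [h] at this
  exact this.unique hasSum_zero

namespace IsEdgeExploration

/-- Orthogonality of martingale increments, without conditional expectations: the space is cut into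
countably many events fixing the history, on each of which the compensated count is constant and the
next increment has mean zero. -/
theorem integral_compensated_mul (h : IsEdgeExploration μ d A V) [IsProbabilityMeasure μ]
    (j k : ℕ) :
    Integrable (fun ω => compensated (chainPath A V ω) k j * (((chainPath A V ω j).2 k : ℝ) -
      (chainPath A V ω (j + 1)).2 k - wakeProb k (chainPath A V ω j))) μ ∧
    ∫ ω, compensated (chainPath A V ω) k j * (((chainPath A V ω j).2 k : ℝ) -
      (chainPath A V ω (j + 1)).2 k - wakeProb k (chainPath A V ω j)) ∂μ = 0 := by
  have hint : Integrable (fun ω => compensated (chainPath A V ω) k j *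
      (((chainPath A V ω j).2 k : ℝ) -
      (chainPath A V ω (j + 1)).2 k - wakeProb k (chainPath A V ω j))) μ := by
    refine Integrable.of_bound (C := j) (Measurable.aestronglyMeasurable ?_) ?_
    · exact (h.measurable_compensated j k).mul (((h.measurable_comp j fun x => (x.2 k : ℝ)).sub
        (h.measurable_comp (j + 1) fun x => (x.2 k : ℝ))).sub (h.measurable_comp j (wakeProb k)))
    · filter_upwards [h.ae_isStep] with ω hω
      rw [Real.norm_eq_abs, abs_mul]
      calc _ ≤ (j : ℝ) * 1 := mul_le_mul (abs_compensated_le hω k j)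
            ((hω j).abs_increment_le k) (abs_nonneg _) (Nat.cast_nonneg _)
        _ = j := mul_one _
  refine ⟨hint, ?_⟩
  have hset : ∀ z : Fin (j + 1) → ℕ × (ℕ →₀ ℕ),
      {ω | (fun l : Fin (j + 1) => chainPath A V ω l) = z} =
        {ω | ∀ i ≤ j, chainPath A V ω i = extendPath z i} := by
    intro z
    ext ω
    constructor
    · rintro rfl i hi
      exact (extendPath_restrict _ (by omega)).symm
    · intro hω
      funext l
      have := hω l (by omega)
      rwa [extendPath, dif_pos l.2] at this
  refine integral_eq_zero_of_fiber (Z := fun ω (l : Fin (j + 1)) => chainPath A V ω l) ?_ hint ?_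
  · intro z
    rw [hset]
    exact h.measurableSet_path j _
  · intro z
    rw [hset]
    have : ∫ ω in {ω | ∀ i ≤ j, chainPath A V ω i = extendPath z i},
        compensated (chainPath A V ω) k j * (((chainPath A V ω j).2 k : ℝ) -
      (chainPath A V ω (j + 1)).2 k - wakeProb k (chainPath A V ω j)) ∂μ =
      ∫ ω in {ω | ∀ i ≤ j, chainPath A V ω i = extendPath z i},
        compensated (extendPath z) k j * (((chainPath A V ω j).2 k : ℝ) -
      (chainPath A V ω (j + 1)).2 k - wakeProb k (chainPath A V ω j)) ∂μ := by
      refine setIntegral_congr_fun (h.measurableSet_path j _) fun ω hω => ?_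
      have : compensated (chainPath A V ω) k j = compensated (extendPath z) k j := by
        refine Finset.sum_congr rfl fun i hi => ?_
        have hi := Finset.mem_range.1 hi
        rw [hω i hi.le, hω (i + 1) hi]
      simp only [this]
    rw [this, integral_const_mul, h.setIntegral_path, mul_zero]

/-- Orthogonal increments bounded by 1 add at most 1 to the variance at each step. -/
theorem integral_sq_compensated_le (h : IsEdgeExploration μ d A V) [IsProbabilityMeasure μ]
    (k j : ℕ) : Integrable (fun ω => compensated (chainPath A V ω) k j ^ 2) μ ∧
      ∫ ω, compensated (chainPath A V ω) k j ^ 2 ∂μ ≤ j := by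
  induction j with
  | zero => simp [compensated]
  | succ j ih =>
    have hD : Integrable (fun ω => (((chainPath A V ω j).2 k : ℝ) -
      (chainPath A V ω (j + 1)).2 k - wakeProb k (chainPath A V ω j)) ^ 2) μ := by
      refine Integrable.of_bound (C := 1) (Measurable.aestronglyMeasurable ?_) ?_
      · exact (((h.measurable_comp j fun x => (x.2 k : ℝ)).sub
          (h.measurable_comp (j + 1) fun x => (x.2 k : ℝ))).sub
          (h.measurable_comp j (wakeProb k))).pow_const 2
      · filter_upwards [h.ae_isStep] with ω hω
        rw [Real.norm_eq_abs, abs_pow]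
        exact pow_le_one₀ (abs_nonneg _) ((hω j).abs_increment_le k)
    have hD1 : ∫ ω, (((chainPath A V ω j).2 k : ℝ) -
      (chainPath A V ω (j + 1)).2 k - wakeProb k (chainPath A V ω j)) ^ 2 ∂μ ≤ 1 := by
      have : ∫ ω : Ω, (1 : ℝ) ∂μ = 1 := by simp
      rw [← this]
      refine integral_mono_ae hD (integrable_const 1) ?_
      filter_upwards [h.ae_isStep] with ω hω
      rw [← sq_abs]
      exact pow_le_one₀ (abs_nonneg _) ((hω j).abs_increment_le k)
    have hM := h.integral_compensated_mul j k
    have heq : (fun ω => compensated (chainPath A V ω) k (j + 1) ^ 2) =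
        fun ω => compensated (chainPath A V ω) k j ^ 2 +
          2 * (compensated (chainPath A V ω) k j * (((chainPath A V ω j).2 k : ℝ) -
            (chainPath A V ω (j + 1)).2 k - wakeProb k (chainPath A V ω j))) +
          (((chainPath A V ω j).2 k : ℝ) -
            (chainPath A V ω (j + 1)).2 k - wakeProb k (chainPath A V ω j)) ^ 2 := by
      funext ω
      rw [compensated_succ]; ring
    rw [heq]
    refine ⟨(ih.1.add (hM.1.const_mul 2)).add hD, ?_⟩
    rw [integral_add (by exact ih.1.add (hM.1.const_mul 2)) hD, integral_add ih.1 (hM.1.const_mul 2),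
      integral_const_mul, hM.2]
    push_cast
    linarith [ih.2]

theorem measureReal_compensated_le (h : IsEdgeExploration μ d A V) [IsProbabilityMeasure μ]
    (k j : ℕ) {c : ℝ} (hc : 0 < c) :
    μ.real {ω | c ≤ |compensated (chainPath A V ω) k j|} ≤ j / c ^ 2 := by
  obtain ⟨h1, h2⟩ := h.integral_sq_compensated_le k j
  have := mul_meas_ge_le_integral_of_nonneg (Eventually.of_forall fun ω =>
    sq_nonneg (compensated (chainPath A V ω) k j)) h1 (c ^ 2)
  rw [le_div_iff₀ (by positivity), mul_comm]
  refine le_trans ?_ (this.trans h2)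
  refine mul_le_mul_of_nonneg_left (measureReal_mono ?_) (by positivity)
  intro ω hω
  rw [mem_ofPred_eq, ← sq_abs (compensated _ _ _)]
  exact pow_le_pow_left₀ hc.le hω 2

/-- On a grid of mesh `s`, the compensated counts are controlled uniformly. -/
theorem measureReal_exists_compensated_le (h : IsEdgeExploration μ d A V)
    [IsProbabilityMeasure μ] (k G : ℕ) {s : ℕ} (hs : 0 < s) {c : ℝ} (hc : 0 < c) :
    μ.real {ω | ∃ j ≤ G * s, c + s < |compensated (chainPath A V ω) k j|} ≤
      (G + 1) * (G * s / c ^ 2) := by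
  have hsub : {ω | ∃ j ≤ G * s, c + s < |compensated (chainPath A V ω) k j|} ≤ᵐ[μ]
      ⋃ i ∈ Finset.range (G + 1), {ω | c ≤ |compensated (chainPath A V ω) k (i * s)|} := by
    filter_upwards [h.ae_isStep] with ω hω hmem
    obtain ⟨j, hj, hcj⟩ := hmem
    -- The grid point just before j is at most s steps away, and each step moves the compensated
    -- count by at most 1.
    have h1 : j / s * s ≤ j := Nat.div_mul_le_self j s
    have h2 := abs_compensated_sub_le hω k h1
    have h3 : (j : ℝ) ≤ (j / s * s : ℕ) + s := by
      exact_mod_cast (Nat.lt_div_mul_add hs).le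
    refine Set.mem_iUnion₂.2 ⟨j / s, Finset.mem_range.2 ?_, ?_⟩
    · exact Nat.lt_succ_of_le (Nat.div_le_of_le_mul (by rwa [mul_comm]))
    · have := abs_sub_abs_le_abs_sub (compensated (chainPath A V ω) k j)
        (compensated (chainPath A V ω) k (j / s * s))
      simp only [mem_ofPred_eq]
      linarith
  calc _ ≤ μ.real (⋃ i ∈ Finset.range (G + 1),
        {ω | c ≤ |compensated (chainPath A V ω) k (i * s)|}) :=
        ENNReal.toReal_mono (measure_ne_top _ _) (measure_mono_ae hsub)
    _ ≤ ∑ i ∈ Finset.range (G + 1),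
        μ.real {ω | c ≤ |compensated (chainPath A V ω) k (i * s)|} := measureReal_biUnion_finset_le _ _
    _ ≤ ∑ i ∈ Finset.range (G + 1), (G * s / c ^ 2 : ℝ) := by
        refine Finset.sum_le_sum fun i hi => (h.measureReal_compensated_le k _ hc).trans ?_
        have : i ≤ G := Nat.lt_succ_iff.1 (Finset.mem_range.1 hi)
        push_cast
        gcongr
    _ = _ := by simp

end IsEdgeExploration

end Chain


/-! ### The Poisson clock -/

section Poisson

open scoped Nat

theorem hasSum_poisson_sq (l : ℝ≥0) :
    HasSum (fun n : ℕ => Real.exp (-l) * (l : ℝ) ^ n / n ! * ((n : ℝ) - l) ^ 2) l := by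
  have h0 := hasSum_one_poissonMeasure l
  set w : ℕ → ℝ := fun n => Real.exp (-l) * (l : ℝ) ^ n / n ! with hw
  -- This shift identity for the Poisson weights yields the first two moments, and from them the
  -- variance.
  have hsucc : ∀ n, ((n + 1 : ℕ) : ℝ) * w (n + 1) = l * w n := fun n => by
    simp only [hw]
    rw [Nat.factorial_succ, pow_succ]
    push_cast
    have : (n ! : ℝ) ≠ 0 := by positivity
    field_simp
  have h1 : HasSum (fun n : ℕ => (n : ℝ) * w n) l := by
    have := (hasSum_nat_add_iff (f := fun n : ℕ => (n : ℝ) * w n) (g := (l : ℝ)) 1).1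
      (by simp_rw [hsucc]; simpa using h0.mul_left (l : ℝ))
    simpa using this
  have h2 : HasSum (fun n : ℕ => (n : ℝ) * ((n : ℝ) * w n)) (l * l + l) := by
    have := (hasSum_nat_add_iff (f := fun n : ℕ => (n : ℝ) * ((n : ℝ) * w n))
      (g := (l : ℝ) * l + l) 1).1 (by
        simp_rw [hsucc]
        convert! (h1.mul_left (l : ℝ)).add (h0.mul_left (l : ℝ)) using 1
        · funext n; push_cast; ring
        · ring)
    simpa using this
  convert! (h2.sub (h1.mul_left (2 * l : ℝ))).add (h0.mul_left ((l : ℝ) ^ 2)) using 1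
  · funext n; ring
  · ring

theorem poissonMeasure_real_ge_le (l : ℝ≥0) {c : ℝ} (hc : 0 < c) :
    (poissonMeasure l).real {m | c ≤ |(m : ℝ) - l|} ≤ l / c ^ 2 := by
  have hs := hasSum_poisson_sq l
  have hi : Integrable (fun m : ℕ => ((m : ℝ) - l) ^ 2) (poissonMeasure l) := by
    rw [integrable_poissonMeasure_iff]
    refine hs.summable.congr fun m => ?_
    rw [Real.norm_of_nonneg (sq_nonneg _)]
  have h1 : ∫ m : ℕ, ((m : ℝ) - l) ^ 2 ∂poissonMeasure l = l := by
    rw [integral_poissonMeasure]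
    exact hs.tsum_eq
  have := mul_meas_ge_le_integral_of_nonneg (Eventually.of_forall fun m : ℕ =>
    sq_nonneg ((m : ℝ) - l)) hi (c ^ 2)
  rw [h1] at this
  rw [le_div_iff₀ (by positivity), mul_comm]
  refine le_trans ?_ this
  refine mul_le_mul_of_nonneg_left (measureReal_mono ?_) (by positivity)
  intro m hm
  rw [mem_ofPred_eq, ← sq_abs ((m : ℝ) - l)]
  exact pow_le_pow_left₀ hc.le hm 2

variable {Ω : Type*} [MeasurableSpace Ω] {μ : Measure Ω} {rate : ℝ≥0} {N : ℝ≥0 → Ω → ℕ}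

namespace IsPoissonProcess

theorem measureReal_ge_le (h : IsPoissonProcess μ rate N) (t : ℝ≥0) {c : ℝ} (hc : 0 < c) :
    μ.real {ω | c ≤ |(N t ω : ℝ) - rate * t|} ≤ rate * t / c ^ 2 := by
  have hl := h.law 0 t zero_le
  have h1 := poissonMeasure_real_ge_le (rate * (t - 0)) hc
  rw [← hl.map_eq, measureReal_def,
    Measure.map_apply_of_aemeasurable hl.aemeasurable (MeasurableSet.of_discrete)] at h1
  have h2 : μ {ω | c ≤ |(N t ω : ℝ) - rate * t|} ≤
      μ ((fun ω => N t ω - N 0 ω) ⁻¹' {m | c ≤ |(m : ℝ) - (rate * (t - 0) : ℝ≥0)|}) := by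
    refine measure_mono_ae ?_
    filter_upwards [h.zero] with ω hω hm
    have hm : c ≤ |(N t ω : ℝ) - rate * t| := hm
    change c ≤ |((N t ω - N 0 ω : ℕ) : ℝ) - (rate * (t - 0) : ℝ≥0)|
    simpa [hω] using hm
  have h3 : IsFiniteMeasure μ := hl.isFiniteMeasure_iff.2 inferInstance
  refine (ENNReal.toReal_mono (measure_ne_top _ _) h2).trans (h1.trans_eq ?_)
  simp

/-- Chebyshev at the points of a grid of mesh δ. In between, N is monotone and its mean moves by at
most δ · rate, whence the factor 2. The grid has G + 2 points because a time up to T needs a right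
neighbour, of index at most G + 1. -/
theorem measureReal_exists_le (h : IsPoissonProcess μ rate N) [IsProbabilityMeasure μ]
    {T δ : ℝ≥0} {G : ℕ} (hδ : 0 < δ) (hr : 0 < rate) (hG : T ≤ G * δ) :
    μ.real {ω | ∃ t ≤ T, 2 * (δ * rate) < |(N t ω : ℝ) - rate * t|} ≤
      (G + 2) * (rate * ((G + 1) * δ) / (δ * rate) ^ 2) := by
  have hc : (0 : ℝ) < δ * rate := by positivity
  have hsub : {ω | ∃ t ≤ T, 2 * (δ * rate) < |(N t ω : ℝ) - rate * t|} ≤ᵐ[μ]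
      ⋃ i ∈ Finset.range (G + 2),
        {ω | (δ * rate : ℝ) ≤ |(N (i * δ) ω : ℝ) - rate * (i * δ : ℝ≥0)|} := by
    filter_upwards [h.paths] with ω hω hmem
    obtain ⟨t, ht, hlt⟩ := hmem
    by_contra hcon
    have hgrid : ∀ i ≤ G + 1, |(N (i * δ) ω : ℝ) - rate * (i * δ)| < δ * rate := by
      intro i hi
      by_contra hi'
      refine hcon (Set.mem_iUnion₂.2 ⟨i, Finset.mem_range.2 (by omega), ?_⟩)
      rw [mem_ofPred_eq]
      push_cast
      exact not_lt.1 hi'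
    set i := ⌊t / δ⌋₊ with hi
    have h1 : (i : ℝ≥0) * δ ≤ t := by
      have := Nat.floor_le (zero_le (a := t / δ))
      rwa [le_div_iff₀ hδ] at this
    have h2 : t ≤ ((i + 1 : ℕ) : ℝ≥0) * δ := by
      have := (Nat.lt_floor_add_one (t / δ)).le
      rw [div_le_iff₀ hδ] at this
      exact_mod_cast this
    have hiG : i ≤ G := by
      refine Nat.floor_le_of_le ?_
      rw [div_le_iff₀ hδ]
      exact ht.trans hG
    have m1 : (N (i * δ) ω : ℝ) ≤ N t ω := by exact_mod_cast hω.1 h1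
    have m2 : (N t ω : ℝ) ≤ N ((i + 1 : ℕ) * δ) ω := by exact_mod_cast hω.1 h2
    have g1 := abs_lt.1 (hgrid i (by omega))
    have g2 := abs_lt.1 (hgrid (i + 1) (by omega))
    have h1' : (i : ℝ) * δ ≤ t := by exact_mod_cast h1
    have h2' : (t : ℝ) ≤ (i + 1) * δ := by exact_mod_cast h2
    have hr0 : (0 : ℝ) ≤ rate := rate.2
    have e1 := mul_le_mul_of_nonneg_left h1' hr0
    have e2 := mul_le_mul_of_nonneg_left h2' hr0
    rw [show ((i + 1 : ℕ) : ℝ) = i + 1 from Nat.cast_succ i] at g2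
    refine absurd hlt (not_lt.2 (abs_le.2 ⟨?_, ?_⟩))
    · nlinarith
    · nlinarith
  calc _ ≤ μ.real (⋃ i ∈ Finset.range (G + 2),
        {ω | (δ * rate : ℝ) ≤ |(N (i * δ) ω : ℝ) - rate * (i * δ : ℝ≥0)|}) :=
        ENNReal.toReal_mono (measure_ne_top _ _) (measure_mono_ae hsub)
    _ ≤ ∑ i ∈ Finset.range (G + 2),
        μ.real {ω | (δ * rate : ℝ) ≤ |(N (i * δ) ω : ℝ) - rate * (i * δ : ℝ≥0)|} :=
        measureReal_biUnion_finset_le _ _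
    _ ≤ ∑ i ∈ Finset.range (G + 2), (rate * ((G + 1) * δ) / (δ * rate) ^ 2 : ℝ) := by
        refine Finset.sum_le_sum fun i hi => (h.measureReal_ge_le _ hc).trans ?_
        have : (i : ℝ) ≤ G + 1 := by
          exact_mod_cast Nat.lt_succ_iff.1 (Finset.mem_range.1 hi)
        push_cast
        gcongr
    _ = _ := by simp

end IsPoissonProcess

end Poisson


/-! ### The law of large numbers -/

section LawOfLargeNumbers

variable {p : ℕ → ℝ} {B L δ : ℝ}

/-- Paths of the exploration chain of a configuration model on `n` vertices which follow the
fluid dynamics up to an error `δ`. -/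
structure IsTypical (p : ℕ → ℝ) (B L δ : ℝ) (n : ℕ) (X : ℕ → ℕ × (ℕ →₀ ℕ)) : Prop where
  large : 1 / δ ≤ n
  step : ∀ j, IsStep (X j) (X (j + 1))
  active_zero : (X 0).1 = 0
  moment : (((X 0).2.sum fun k d => k ^ 2 * d : ℕ) : ℝ) ≤ B * n
  init : ∀ k : ℕ, 1 ≤ k → (k : ℝ) ≤ 1 / δ → |((X 0).2 k : ℝ) / n - p k| ≤ δ
  mart : ∀ k : ℕ, 1 ≤ k → (k : ℝ) ≤ 1 / δ → ∀ j : ℕ, (j : ℝ) ≤ L * n →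
    |compensated X k j| ≤ δ * n

theorem IsTypical.isScaled {n : ℕ → ℕ} {X : ℕ → ℕ → ℕ × (ℕ →₀ ℕ)}
    (h : ∀ m : ℕ, IsTypical p B L (1 / ((m : ℝ) + 1)) (n m) (X m)) {U : Ultrafilter ℕ}
    (hU : (U : Filter ℕ) ≤ atTop) : IsScaled p B L U n X := by
  have hδ : Tendsto (fun m : ℕ => 1 / ((m : ℝ) + 1)) U (𝓝 0) :=
    tendsto_one_div_add_atTop_nhds_zero_nat.mono_left hU
  have hn : ∀ m : ℕ, (m : ℝ) + 1 ≤ n m := fun m => by simpa using (h m).large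
  have hk : ∀ k : ℕ, ∀ᶠ m : ℕ in (U : Filter ℕ), (k : ℝ) ≤ 1 / (1 / ((m : ℝ) + 1)) := fun k => by
    filter_upwards [hU (eventually_ge_atTop k)] with m hm
    have : (k : ℝ) ≤ m := by exact_mod_cast hm
    rw [one_div_one_div]; linarith
  refine ⟨?_, fun m => (h m).step, fun m => (h m).active_zero, fun m => (h m).moment, ?_, ?_⟩
  · refine tendsto_atTop_mono (fun m => ?_) (tendsto_natCast_atTop_atTop.mono_left hU)
    exact (le_add_of_nonneg_right zero_le_one).trans (hn m)
  · intro k hk1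
    rw [tendsto_iff_norm_sub_tendsto_zero]
    refine squeeze_zero' (Eventually.of_forall fun _ => norm_nonneg _) ?_ hδ
    filter_upwards [hk k] with m hm using (h m).init k hk1 hm
  · intro k hk1 j hj
    refine squeeze_zero_norm' ?_ hδ
    filter_upwards [hk k] with m hm
    have h0 : (0 : ℝ) < n m := lt_of_lt_of_le (by positivity) (hn m)
    rw [Real.norm_eq_abs, abs_div, abs_of_pos h0, div_le_iff₀ h0]
    exact (h m).mart k hk1 hm _ (hj m)

/-- By contradiction and compactness: violations with δ = 1/(m+1) form a sequence of typical paths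
whose limit along a nonprincipal ultrafilter follows the explicit trajectory. The resulting
tolerance is deterministic, so probability enters only through the event of being typical. -/
theorem exists_tolerance (hp : IsDegreeDistribution p)
    (h2 : Summable fun k : ℕ => (k : ℝ) ^ 2 * p k) (B : ℝ) {T ε : ℝ}
    (hε : 0 < ε) {k : ℕ} (hk : 1 ≤ k) :
    ∃ δ : ℝ, 0 < δ ∧ ∀ n X, IsTypical p B (T + 1) δ n X → ∀ t ∈ Icc 0 T, ∀ j : ℕ,
      |(j : ℝ) / n - t| ≤ δ →
      |((X j).2 k : ℝ) / n - zetaLim p t k| < ε ∧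
      |(((X j).1 : ℝ) - 1) / n - zetaLim p t 0| < ε ∧
      |((((X j).1 : ℝ) - 1) / n - 2 / n * startCount X j) - psiLim p t| < ε := by
  by_contra hcon
  push Not at hcon
  choose n X hX t ht j hj hbad using fun m : ℕ =>
    hcon (1 / ((m : ℝ) + 1)) (by positivity)
  obtain ⟨t', ht'⟩ := exists_ultralimit (hyperfilter ℕ) ht
  have hU : (hyperfilter ℕ : Filter ℕ) ≤ atTop := Nat.hyperfilter_le_atTop
  have htT : t' ∈ Icc 0 T := isClosed_Icc.mem_of_tendsto ht' (Eventually.of_forall ht)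
  have hjt : Tendsto (fun m => (j m : ℝ) / n m) (hyperfilter ℕ : Filter ℕ) (𝓝 t') := by
    have : Tendsto (fun m => (j m : ℝ) / n m - t m) (hyperfilter ℕ : Filter ℕ) (𝓝 0) :=
      squeeze_zero_norm hj (tendsto_one_div_add_atTop_nhds_zero_nat.mono_left hU)
    simpa using this.add ht'
  obtain ⟨l1, l2, l3⟩ := (IsTypical.isScaled hX hU).tendsto_limit hp h2
    -- Compensators are controlled up to time T + 1 so that the limit time is strictly inside the
    -- window.
    ⟨htT.1, by linarith [htT.2]⟩ hjt
  have hz : ∀ i, Tendsto (fun m => zetaLim p (t m) i) (hyperfilter ℕ : Filter ℕ)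
      (𝓝 (zetaLim p t' i)) := fun i => by
    have hc := ((continuous_apply i).comp (continuous_zetaU hp
      (summable_first_moment hp h2))).tendsto t' |>.comp ht'
    rw [zetaLim_eq_zetaU hp h2 htT.1]
    refine hc.congr fun m => ?_
    rw [zetaLim_eq_zetaU hp h2 (ht m).1]
    rfl
  have hψ : Tendsto (fun m => psiLim p (t m)) (hyperfilter ℕ : Filter ℕ)
      (𝓝 (psiLim p t')) := by
    obtain ⟨K, hK⟩ := exists_lipschitz_psiLim hp h2 T
    exact (hK.continuousOn t' htT).tendsto.comp
      (tendsto_nhdsWithin_iff.2 ⟨ht', Eventually.of_forall ht⟩)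
  have key : ∀ {a b : ℕ → ℝ} {c : ℝ}, Tendsto a (hyperfilter ℕ : Filter ℕ) (𝓝 c) →
      Tendsto b (hyperfilter ℕ : Filter ℕ) (𝓝 c) →
      ∀ᶠ m in (hyperfilter ℕ : Filter ℕ), |a m - b m| < ε := fun ha hb => by
    have := (ha.sub hb).abs
    rw [sub_self, abs_zero] at this
    exact this.eventually (gt_mem_nhds hε)
  obtain ⟨m, m1, m2, m3⟩ :=
    ((key (l1 k hk) (hz k)).and ((key l2 (hz 0)).and (key l3 hψ))).exists
  exact absurd m3 (not_lt.2 (hbad m m1 m2))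

/-! ### Probability of atypical explorations -/

variable {d : (n : ℕ) → Fin n → ℕ}

theorem exists_second_moment_le (hd : BoundedSecondMoment d) :
    ∃ B, ∀ (n : ℕ) (s : Finset ℕ), ∑ k ∈ s, (degCount (d n) k : ℝ) / n * (k : ℝ) ^ 2 ≤ B := by
  obtain ⟨B, hB⟩ := hd
  refine ⟨B, fun n s => ?_⟩
  refine le_trans (Summable.sum_le_tsum s (fun k _ => by positivity) ?_) (hB ⟨n, rfl⟩)
  refine summable_of_ne_finset_zero (s := Finset.univ.image (d n)) fun k hk => ?_
  have : degCount (d n) k = 0 := by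
    rw [degCount, Finset.card_eq_zero, Finset.filter_eq_empty_iff]
    exact fun i _ hi => hk (Finset.mem_image.2 ⟨i, Finset.mem_univ i, hi⟩)
  rw [this]; simp

/-- Fatou for series: every finite partial sum of ∑ k² p_k is a limit of quantities bounded by B. -/
theorem summable_second_moment (hp : IsDegreeDistribution p) (hc : DegreesConverge d p)
    (hd : BoundedSecondMoment d) : Summable fun k : ℕ => (k : ℝ) ^ 2 * p k := by
  obtain ⟨B, hB⟩ := exists_second_moment_le hd
  refine summable_of_sum_le (c := B) (fun k => mul_nonneg (by positivity) (hp.nonneg k)) fun s => ?_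
  have ht : Tendsto (fun n : ℕ => ∑ k ∈ s, (degCount (d n) k : ℝ) / n * (k : ℝ) ^ 2) atTop
      (𝓝 (∑ k ∈ s, (k : ℝ) ^ 2 * p k)) := by
    refine tendsto_finsetSum _ fun k _ => ?_
    rcases Nat.eq_zero_or_pos k with rfl | hk
    · simp
    · rw [mul_comm]; exact (hc k hk).mul_const _
  exact le_of_tendsto' ht fun n => hB n s

variable {Ω : ℕ → Type*} [∀ n, MeasurableSpace (Ω n)] {μ : (n : ℕ) → Measure (Ω n)}
  [∀ n, IsProbabilityMeasure (μ n)] {A : (n : ℕ) → ℕ → Ω n → ℕ}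
  {V : (n : ℕ) → ℕ → Ω n → ℕ →₀ ℕ} {N : (n : ℕ) → ℝ≥0 → Ω n → ℕ}

/-- The event that the exploration leaves the `ε`-neighbourhood of the limit trajectory. -/
def deviation {Ω : Type*} (p : ℕ → ℝ) (T : ℝ≥0) (ε : ℝ) (k n : ℕ) (A : ℕ → Ω → ℕ)
    (V : ℕ → Ω → ℕ →₀ ℕ) (N : ℝ≥0 → Ω → ℕ) : Set Ω :=
  {ω | ∃ t ≤ T, ε ≤ |stateX n A V N t ω k - zetaLim p t k| ∨
    ε ≤ |stateX n A V N t ω 0 - zetaLim p t 0| ∨ ε ≤ |stateY n A V N t ω - psiLim p t|}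

/-- Outside the two exceptional events the path is typical and the clock is within δ of t, so
`exists_tolerance` applies for every t at once. Each event is a finite union with a number of terms
independent of n, each of probability O(1/n). -/
theorem exists_measureReal_deviation_le (hp : IsDegreeDistribution p) (hc : DegreesConverge d p)
    (hd : BoundedSecondMoment d) (h : ∀ n, IsExploration (μ n) (d n) (A n) (V n) (N n))
    (T : ℝ≥0) {ε : ℝ} (hε : 0 < ε) {k : ℕ} (hk : 1 ≤ k) :
    ∃ C : ℝ, ∀ᶠ n : ℕ in atTop, (μ n).real (deviation p T ε k n (A n) (V n) (N n)) ≤ C / n := by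
  obtain ⟨B, hB⟩ := exists_second_moment_le hd
  obtain ⟨δ, hδ, htol⟩ := exists_tolerance hp (summable_second_moment hp hc hd) B (T := T) hε hk
  -- Only degrees up to K = ⌊1/δ⌋ matter for typicality. G blocks of length at least δn/3 cover the
  -- (T + 1)n steps, and the halving in δ' below turns the factor 2 of the clock estimate into δ.
  set K := ⌊1 / δ⌋₊
  set G := ⌈3 * ((T : ℝ) + 1) / δ⌉₊
  let δ' : ℝ≥0 := ⟨δ / 2, by positivity⟩
  have hδ' : 0 < δ' := by
    rw [← NNReal.coe_pos]; exact half_pos hδ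
  have hδ'c : (δ' : ℝ) = δ / 2 := rfl
  set G' := ⌈T / δ'⌉₊
  refine ⟨K * ((G + 1) * (G * 2 / (δ / 3))) + (G' + 2) * ((G' + 1) / δ'), ?_⟩
  have hinit : ∀ᶠ n : ℕ in atTop, ∀ i ∈ Finset.Icc 1 K,
      |(degCount (d n) i : ℝ) / n - p i| ≤ δ := by
    rw [Filter.eventually_all_finset]
    intro i hi
    exact (hc i (Finset.mem_Icc.1 hi).1).eventually (Metric.closedBall_mem_nhds _ hδ)
  filter_upwards [hinit, tendsto_natCast_atTop_atTop.eventually_ge_atTop (3 / δ)] with n hn1 hn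
  have hn0 : (0 : ℝ) < n := lt_of_lt_of_le (by positivity) hn
  -- Grid deviation c plus mesh s = ⌈c⌉ is at most 2c + 1 ≤ 3c = δn, since n ≥ 3/δ makes c ≥ 1.
  set c := δ / 3 * (n : ℝ) with hcdef
  have hc1 : 1 ≤ c := by
    rw [div_le_iff₀ hδ] at hn; rw [hcdef]; linarith
  have hc0 : 0 < c := by linarith
  set s := ⌈c⌉₊
  have hs : 0 < s := Nat.ceil_pos.2 hc0
  have hs1 : c ≤ s := Nat.le_ceil c
  have hs2 : (s : ℝ) ≤ 2 * c := (Nat.ceil_lt_add_one hc0.le).le.trans (by linarith)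
  have hs3 : c + s ≤ δ * n := by
    have := (Nat.ceil_lt_add_one hc0.le).le
    change (s : ℝ) ≤ c + 1 at this
    have : δ * n = 3 * c := by rw [hcdef]; ring
    linarith
  have hsub : deviation p T ε k n (A n) (V n) (N n) ≤ᵐ[μ n]
      ((⋃ i ∈ Finset.Icc 1 K,
        {ω | ∃ j ≤ G * s, c + s < |compensated (chainPath (A n) (V n) ω) i j|}) ∪
        {ω | ∃ t ≤ T, 2 * (δ' * (n : ℝ≥0)) < |(N n t ω : ℝ) - (n : ℝ≥0) * t|} : Set (Ω n)) := by
    filter_upwards [(h n).chain.ae_isStep, (h n).chain.init] with ω hstep hω hmem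
    by_contra hcon
    obtain ⟨hM, hN⟩ := not_or.1 (show ¬(ω ∈ (⋃ i ∈ Finset.Icc 1 K,
      {ω | ∃ j ≤ G * s, c + s < |compensated (chainPath (A n) (V n) ω) i j|}) ∨
        ω ∈ {ω | ∃ t ≤ T, 2 * (δ' * (n : ℝ≥0)) < |(N n t ω : ℝ) - (n : ℝ≥0) * t|}) from hcon)
    have hV : ∀ i, (chainPath (A n) (V n) ω 0).2 i = degCount (d n) i := hω.2
    have htyp : IsTypical p B (T + 1) δ n (chainPath (A n) (V n) ω) := by
      refine ⟨?_, hstep, hω.1, ?_, ?_, ?_⟩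
      · refine le_trans ?_ hn
        gcongr
        norm_num
      · have := mul_le_mul_of_nonneg_right
          (hB n (chainPath (A n) (V n) ω 0).2.support) hn0.le
        refine le_trans (le_of_eq ?_) this
        rw [Finsupp.sum, Finset.sum_mul]
        push_cast
        refine Finset.sum_congr rfl fun i _ => ?_
        rw [hV]
        field_simp
      · intro i hi1 hi
        rw [hV]
        exact hn1 i (Finset.mem_Icc.2 ⟨hi1, Nat.le_floor hi⟩)
      · intro i hi1 hi j hj
        by_contra hlt
        refine hM (Set.mem_iUnion₂.2 ⟨i, Finset.mem_Icc.2 ⟨hi1, Nat.le_floor hi⟩, j, ?_, ?_⟩)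
        · have hG : 3 * ((T : ℝ) + 1) / δ ≤ G := Nat.le_ceil _
          have : (j : ℝ) ≤ G * s := by
            calc (j : ℝ) ≤ (T + 1) * n := hj
              _ = 3 * ((T : ℝ) + 1) / δ * c := by rw [hcdef]; field_simp
              _ ≤ G * s := by gcongr
          exact_mod_cast this
        · exact hs3.trans_lt (not_le.1 hlt)
    obtain ⟨t, ht, hbad⟩ := hmem
    have hNt : |(N n t ω : ℝ) / n - t| ≤ δ := by
      have : |(N n t ω : ℝ) - (n : ℝ≥0) * t| ≤ 2 * (δ' * (n : ℝ≥0)) := by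
        by_contra hlt
        exact hN ⟨t, ht, not_le.1 hlt⟩
      rw [hδ'c, NNReal.coe_natCast] at this
      have e : (N n t ω : ℝ) / n - t = ((N n t ω : ℝ) - n * t) / n := by field_simp
      rw [e, abs_div, abs_of_pos hn0, div_le_iff₀ hn0]
      linarith
    obtain ⟨r1, r2, r3⟩ := htol n _ htyp t ⟨t.2, by exact_mod_cast ht⟩ (N n t ω) hNt
    rcases hbad with hb | hb | hb
    · rw [stateX, if_neg (by omega)] at hb
      exact absurd r1 (not_lt.2 hb)
    · rw [stateX, if_pos rfl] at hb
      exact absurd r2 (not_lt.2 hb)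
    · rw [stateY, stateX, if_pos rfl, regulator] at hb
      exact absurd r3 (not_lt.2 hb)
  calc (μ n).real (deviation p T ε k n (A n) (V n) (N n))
      ≤ _ := ENNReal.toReal_mono (measure_ne_top _ _) (measure_mono_ae hsub)
    _ ≤ _ := measureReal_union_le _ _
    _ ≤ ∑ i ∈ Finset.Icc 1 K, (G + 1) * (G * s / c ^ 2) +
        (G' + 2) * ((n : ℝ≥0) * ((G' + 1) * δ') / (δ' * (n : ℝ≥0)) ^ 2) := by
        refine add_le_add ((measureReal_biUnion_finset_le _ _).trans
          (Finset.sum_le_sum fun i _ =>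
            (h n).chain.measureReal_exists_compensated_le i G hs hc0)) ?_
        refine (h n).clock.measureReal_exists_le hδ' (by exact_mod_cast hn0) ?_
        have := Nat.le_ceil (T / δ')
        rwa [div_le_iff₀ hδ'] at this
    _ ≤ K * ((G + 1) * (G * (2 * c) / c ^ 2)) +
        (G' + 2) * ((n : ℝ≥0) * ((G' + 1) * δ') / (δ' * (n : ℝ≥0)) ^ 2) := by
        rw [Finset.sum_const, Nat.card_Icc, nsmul_eq_mul, Nat.add_sub_cancel]
        gcongr
    _ = _ := by
        have : (δ' : ℝ) ≠ 0 := (NNReal.coe_pos.2 hδ').ne'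
        rw [NNReal.coe_natCast, hcdef]
        field_simp

theorem tendsto_measure_deviation (hp : IsDegreeDistribution p) (hc : DegreesConverge d p)
    (hd : BoundedSecondMoment d) (h : ∀ n, IsExploration (μ n) (d n) (A n) (V n) (N n))
    (T : ℝ≥0) {ε : ℝ} (hε : 0 < ε) {k : ℕ} (hk : 1 ≤ k) :
    Tendsto (fun n => μ n (deviation p T ε k n (A n) (V n) (N n))) atTop (𝓝 0) := by
  obtain ⟨C, hC⟩ := exists_measureReal_deviation_le hp hc hd h T hε hk
  rw [← ENNReal.tendsto_toReal_iff (fun _ => measure_ne_top _ _) ENNReal.zero_ne_top,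
    ENNReal.toReal_zero]
  exact squeeze_zero' (Eventually.of_forall fun _ => ENNReal.toReal_nonneg) hC
    (tendsto_const_div_atTop_nhds_zero_nat C)

end LawOfLargeNumbers

end ConfigModel

theorem mainTheorem6 (p : ℕ → ℝ) (hp : IsDegreeDistribution p) (T : ℝ≥0)
    (hT : mean p / 2 ≤ T) :
    (Summable (fun k : ℕ => (k : ℝ) ^ 2 * p k) →
      (0 < criticality p → 0 < p 1 → ∃! z : ℝ, z ∈ Ioo (0 : ℝ) 1 ∧ G1 p z = z) ∧
      ∃ P : PathSpace T,
        (∀ t : Icc (0 : ℝ) T, P.1.toFun t = zetaLim p t ∧ P.2.toFun t = psiLim p t) ∧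
        ∀ Q : PathSpace T, rateFunction p Q = 0 ↔ Q = P) ∧
    (∀ d : (n : ℕ) → Fin n → ℕ, IsDegreeArray d → DegreesConverge d p → BoundedSecondMoment d →
      Summable (fun k : ℕ => (k : ℝ) ^ 2 * p k) ∧
      ∀ (Ω : ℕ → Type*) [∀ n, MeasurableSpace (Ω n)] (μ : (n : ℕ) → Measure (Ω n))
        [∀ n, IsProbabilityMeasure (μ n)]
        (A : (n : ℕ) → ℕ → Ω n → ℕ) (V : (n : ℕ) → ℕ → Ω n → ℕ →₀ ℕ)
        (N : (n : ℕ) → ℝ≥0 → Ω n → ℕ),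
        (∀ n, IsExploration (μ n) (d n) (A n) (V n) (N n)) →
        ∀ ε : ℝ, 0 < ε →
          (∀ k : ℕ, Tendsto (fun n => μ n {ω | ∃ t ≤ T,
            ε ≤ |stateX n (A n) (V n) (N n) t ω k - zetaLim p t k|}) atTop (𝓝 0)) ∧
          Tendsto (fun n => μ n {ω | ∃ t ≤ T,
            ε ≤ |stateY n (A n) (V n) (N n) t ω - psiLim p t|}) atTop (𝓝 0)) := by
  refine ⟨fun h2 => ⟨fun hc hp1 => existsUnique_fixedPoint hp h2 hc hp1, exists_unique_zero hp h2⟩,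
    fun d _ hc hd => ⟨summable_second_moment hp hc hd, ?_⟩⟩
  intro Ω _ μ _ A V N h ε hε
  have key : ∀ (k : ℕ) (E : (n : ℕ) → Set (Ω n)), 1 ≤ k →
      (∀ n, E n ⊆ deviation p T ε k n (A n) (V n) (N n)) →
        Tendsto (fun n => μ n (E n)) atTop (𝓝 0) := fun k E hk hE =>
    tendsto_of_tendsto_of_tendsto_of_le_of_le tendsto_const_nhds
      (tendsto_measure_deviation hp hc hd h T hε hk) (fun _ => zero_le) fun n =>
        measure_mono (hE n)
  refine ⟨fun k => ?_, key 1 _ le_rfl fun n ω ⟨t, ht, hb⟩ => ⟨t, ht, Or.inr (Or.inr hb)⟩⟩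
  -- The event `deviation` covers the coordinate 0 and Y for any index k ≥ 1, so index 1 serves for
  -- these.
  rcases Nat.eq_zero_or_pos k with rfl | hk
  · exact key 1 _ le_rfl fun n ω ⟨t, ht, hb⟩ => ⟨t, ht, Or.inr (Or.inl hb)⟩
  · exact key k _ hk fun n ω ⟨t, ht, hb⟩ => ⟨t, ht, Or.inl hb⟩
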